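/- **Snake graphs and signs.** A tile is a unit square in the plane with axis-parallel sides, viewed as a graph with 4 vertices and 4 edges. A snake graph $\mathcal G=(G_1,\dots,G_d)$, $d\ge 1$, is a sequence of tiles such that each $G_{i+1}$ is placed directly north or directly east of $G_i$; the edge shared by $G_i$ and $G_{i+1}$ is the interior edge $e_i$, and the edges lying in only one tile are the boundary edges. $\mathcal G[i,j]$ denotes the subgraph $(G_i,\dots,G_j)$ (empty if $j<i$). A single edge is also regarded as a snake graph. A sign function assigns a sign $\pm$ to every edge such that on every tile the north and west edges have the same sign, the south and east edges have the same sign, and the north and south edges have opposite signs. $\mathrm{Match}\,\mathcal G$ is the set of perfect matchings of $\mathcal G$. A band graph $\mathcal G^b$ is obtained from a snake graph with a sign function by identifying the south or west edge $b$ of the first tile with the north or east edge $b'$ of the last tile that has the same sign; the southwest vertex of the first tile is identified with the endpoint of $b'$ that is not the northeast vertex of the last tile. The interior edges of $\mathcal G^b$ are those of $\mathcal G$ and the edge $b=b'$. $\mathrm{Match}\,\mathcal G^b$ is the set of good perfect matchings: those perfect matchings $P$ of $\mathcal G^b$ for which there is an interior edge $e$ such that $P\sqcup\{e\}$ is a perfect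 matching of the snake graph obtained by cutting $\mathcal G^b$ along $e$ (where the added edge is one of the two copies of $e$). **Setting.** Let $\mathcal G_1=(G_1,\dots,G_d)$ be a snake graph with sign function $f$. Let $1\le s\le t$, $s<s'\le t'\le d$, $t'-s'=t-s$, and let $\iota:\mathcal G_1[s,t]\to\mathcal G_1[s',t']$ be an isomorphism sending $G_{s+k}$ to $G_{s'+k}$ and the southwest vertex of $G_s$ to the southwest vertex of $G_{s'}$, and preserving $f$ (thus $\iota$ is a translation, possibly combined with the reflection in the diagonal direction). Assume that $\iota$ is a self-overlap, i.e. maximal: if $s<t$, then $\iota$ does not extend to an isomorphism $\mathcal G_1[a,b]\to\mathcal G_1[a+s'-s,\,b+s'-s]$ of the same kind (a translation or reflected translation) with $[a,b]\supsetneq[s,t]$; if $s=t$, then either one of $s,s'$ is in $\{1,d\}$, or $(G_{s-1},G_s,G_{s+1})$ and $(G_{s'-1},G_{s'},G_{s'+1})$ are both straight or both not straight. Assume that $\mathcal G_1$ self-crosses in this overlap: $f(e_t)=f(e_{s'-1})$, and in addition $f(e_{s-1})=-f(e_t)$ if $s>1$, or $f(e_{s'-1})=-f(e_{t'})$ if $t'<d$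 (at least one of these two equations holds with its side condition, unless $s=1$ and $t'=d$, when nothing more is required). Finally assume $s'>t+1$. **Resolution.** * $\mathcal G_3=\mathcal G_1[1,t]\cup\mathcal G_1[t'+1,d]$, where $G_{t'+1}$ is glued to $G_t$ along the edge $\iota^{-1}(e_{t'})$ (if $t'<d$). * $\mathcal G_4^\circ$ is the band graph obtained from $\mathcal G_1[s,s'-1]$ by identifying $e_{s'-1}$ with the south or west edge of $G_s$ of the same sign. * $\mathcal G_{56}'=\mathcal G_1[1,s-1]\cup\overline{\mathcal G}_1[s'-1,t+1]\cup\mathcal G_1[t'+1,d]$, where the middle part is traversed in reversed order; if $s>1$, the north or east boundary edge of $G_{s-1}$ other than $e_{s-1}$ is glued to the north or east edge of $G_{s'-1}$ other than $e_{s'-1}$; if $t'<d$, the south or west edge of $G_{t+1}$ other than $e_t$ is glued to the south or west edge of $G_{t'+1}$ other than $e_{t'}$. This is a snake graph; "first" and "last" refer to its order of tiles. Let $f_{56}$ be a sign function on $\mathcal G_{56}'$. * $\mathcal G_{56}$ is the following subgraph of $\mathcal G_{56}'$. If $s\ne1$, $t'\neq d$: $\mathcal G_{56}=\mathcal G_{56}'$.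 If $s=1$, $t'\ne d$: let $e$ be the first edge with $f_{56}(e)=f_{56}(e_{s'-1})$ among the interior edges of $\mathcal G'_{56}$ followed by the north and east edges of its last tile; $\mathcal G_{56}$ consists of the tiles after $e$, or of the single edge $e$ if $e$ is not interior. If $s\ne1$, $t'=d$: let $e'$ be the last edge with $f_{56}(e')=f_{56}(e_t)$ among the south and west edges of the first tile of $\mathcal G_{56}'$ followed by the interior edges; $\mathcal G_{56}$ consists of the tiles before $e'$, or of the single edge $e'$ if $e'$ is not interior. If $s=1$, $t'=d$: let $e$ and $e'$ be the first and the last interior edge of $\mathcal G_{56}'$ whose sign is $f_{56}(e_{s'-1})=f_{56}(e_t)$; $\mathcal G_{56}$ consists of the tiles between $e$ and $e'$, is the single edge $e$ if $e=e'$, and is $0$ (with no matchings) if there is no such edge. Put $\mathrm{Match}(\mathrm{Res})=(\mathrm{Match}\,\mathcal G_3\times\mathrm{Match}\,\mathcal G_4^\circ)\sqcup\mathrm{Match}\,\mathcal G_{56}$. **The maps.** Positions in the overlap $\mathcal G=\mathcal G_1[s,t]\cong\mathcal G_1[s',t']$ are numbered $0,1,\dots,t-s+2$: position $0$ is its beginning,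 position $t-s+2$ its end, and position $m$ with $1\le m\le t-s+1$ is at the diagonal, from the northwest to the southeast vertex, of its $m$-th tile. For $P_1\in\mathrm{Match}\,\mathcal G_1$ and a position $m$, let $P_3$ be the set of edges of $\mathcal G_3$ that agrees with $P_1$ outside $\mathcal G$, and on $\mathcal G$ agrees with $P_1|_{\mathcal G_1[s,t]}$ before and with $P_1|_{\mathcal G_1[s',t']}$ after position $m$; let $P_4$ be the set of edges of $\mathcal G_4^\circ$ that agrees with $P_1$ outside $\mathcal G$, and on $\mathcal G$ agrees with $P_1|_{\mathcal G_1[s',t']}$ before and with $P_1|_{\mathcal G_1[s,t]}$ after position $m$. Call $m$ a switching position of $P_1$ if $P_3$ is a perfect matching of $\mathcal G_3$. Define $\varphi(P_1)=(P_3,P_4)$ for the first switching position, if there is one, and $\varphi(P_1)=P_1|_{\mathcal G_{56}}$ otherwise, where a glueing edge of $\mathcal G_{56}$ that comes from two edges of $\mathcal G_1$ belongs to the restriction if and only if both of these are in $P_1$. Conversely, for $(P_3,P_4)\in\mathrm{Match}\,\mathcal G_3\times\mathrm{Match}\,\mathcal G_4^\circ$ let $\psi(P_3,P_4)$ be the set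 of edges of $\mathcal G_1$ that agrees with $P_3$ on $\mathcal G_1[1,s-1]\cup\mathcal G_1[t'+1,d]$ and with $P_4$ on $\mathcal G_1[t+1,s'-1]$ outside the overlaps, agrees on $\mathcal G_1[s,t]$ with $P_3$ before and $P_4$ after position $m$, and on $\mathcal G_1[s',t']$ with $P_4$ before and $P_3$ after position $m$, where $m$ is the first position for which this is a perfect matching of $\mathcal G_1$. For $P_{56}\in\mathrm{Match}\,\mathcal G_{56}$ let $\psi(P_{56})$ be the perfect matching of $\mathcal G_1$ obtained by completing $P_{56}$ to a perfect matching of $\mathcal G_{56}'$ using only boundary edges of $\mathcal G_{56}'$, and then completing the corresponding edges of $\mathcal G_1$ to a perfect matching of $\mathcal G_1$ using only boundary edges of $\mathcal G_1$. **Theorem.** In this setting the completion $\psi(P_{56})$ exists and is unique for every $P_{56}\in\mathrm{Match}\,\mathcal G_{56}$, and $\varphi$ is a bijection from $\mathrm{Match}\,\mathcal G_1$ to $\mathrm{Match}(\mathrm{Res})=\mathrm{Match}\big((\mathcal G_3\sqcup\mathcal G_4^\circ)+\mathcal G_{56}\big)$, with inverse $\psi:\mathrm{Match}(\mathrm{Res})\to\mathrm{Match}\,\mathcal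 G_1$. -/

import Mathlib

open Set

namespace SnakeCalculus

/-! ## Tiles -/

/-- The four vertices of a tile (a square with sides parallel to the axes). -/
inductive Corner
  | sw | se | nw | ne

/-- The four edges of a tile. -/
inductive Side
  | south | west | north | east

namespace Side

/-- The endpoint of a side that is the southwest vertex of the tile (for the south and the west
side), respectively the northeast vertex of the tile (for the north and the east side). -/
def apex : Side → Corner
  | south => .sw
  | west => .sw
  | north => .ne
  | east => .ne

/-- The other endpoint of a side: the northwest or the southeast vertex of the tile. -/
def foot : Side → Corner
  | south => .se
  | west => .nw
  | north => .nw
  | east => .se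

/-- The reflection of the tile in its diagonal through the southwest and the northeast vertex.
It exchanges the two elements of `{south, west}` and the two elements of `{north, east}`. -/
def reflect : Side → Side
  | south => west
  | west => south
  | north => east
  | east => north

/-- `0` for the south and the west side, `1` for the north and the east side. -/
def level : Side → ℕ
  | south => 0
  | west => 0
  | north => 1
  | east => 1

/-- The south or the west side. -/
def IsSW (x : Side) : Prop := x = south ∨ x = west

/-- The north or the east side. -/
def IsNE (x : Side) : Prop := x = north ∨ x = east

end Side

/-! ## Graphs glued from tiles -/

/-- Tiles, indexed by natural numbers, some of whose sides are glued in pairs. The pair `(i, x)`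
stands for the side `x` of the `i`-th tile. -/
structure TileComplex where
  /-- the tiles of the graph -/
  tiles : Set ℕ
  /-- the pairs of sides that are glued together -/
  glued : ℕ × Side → ℕ × Side → Prop

/-- `P` is a perfect matching of the multigraph `G`. -/
def IsPerfectMatching {α β : Type*} (G : Graph α β) (P : Set β) : Prop :=
  P ⊆ G.edgeSet ∧ ∀ v ∈ G.vertexSet, ∃! e, e ∈ P ∧ G.Inc e v

namespace TileComplex

variable (T : TileComplex)

/-- If two sides are glued, then the `apex` of each one is identified with the `foot` of the other.
If the north side of `G` is glued to the south side of `G'` (or the east side of `G` to the west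
side of `G'`), this is the identification that one has when `G'` is placed north (or east) of `G`
in the plane. If a north or east side of `G` is glued to a north or east side of `G'`, it is the
identification that one has when `G'` is rotated by 180 degrees (or reflected in its diagonal
through the northwest and the southeast vertex) and then placed north or east of `G`. When the first
and the last tile of a snake graph are glued to a band graph, it identifies the southwest vertex of
the first tile with the endpoint of the glueing edge that is not the northeast vertex of the last
tile. -/
def identified (u v : ℕ × Corner) : Prop :=
  ∃ a b, T.glued a b ∧
    ((u = (a.1, a.2.apex) ∧ v = (b.1, b.2.foot)) ∨ (u = (a.1, a.2.foot) ∧ v = (b.1, b.2.apex)))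

/-- Vertices: tile vertices modulo the equivalence relation generated by the glueings. -/
def Vertex : Type := Quot T.identified

/-- Edges: tile sides modulo the equivalence relation generated by the glueings. -/
def Edge : Type := Quot T.glued

/-- The vertex given by a vertex of a tile. -/
def vertex (u : ℕ × Corner) : T.Vertex := Quot.mk _ u

/-- The edge given by a side of a tile. -/
def edge (a : ℕ × Side) : T.Edge := Quot.mk _ a

/-- The two endpoints of an edge. -/
def ends : T.Edge → Sym2 T.Vertex :=
  Quot.lift (fun a => s(T.vertex (a.1, a.2.apex), T.vertex (a.1, a.2.foot))) (by
    intro a b h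
    have h1 : T.vertex (a.1, a.2.apex) = T.vertex (b.1, b.2.foot) :=
      Quot.sound ⟨a, b, h, Or.inl ⟨rfl, rfl⟩⟩
    have h2 : T.vertex (a.1, a.2.foot) = T.vertex (b.1, b.2.apex) :=
      Quot.sound ⟨a, b, h, Or.inr ⟨rfl, rfl⟩⟩
    show s(_, _) = s(_, _)
    rw [h1, h2, Sym2.eq_swap])

/-- The edges of the tiles with index in `A`. -/
def edgesOf (A : Set ℕ) : Set T.Edge := {e | ∃ i ∈ A, ∃ x, e = T.edge (i, x)}

/-- The subgraph consisting of a set `F` of edges and their endpoints. -/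
def subgraph (F : Set T.Edge) : Graph T.Vertex T.Edge where
  vertexSet := {v | ∃ e ∈ F, v ∈ T.ends e}
  IsLink e u v := e ∈ F ∧ T.ends e = s(u, v)
  isLink_symm := by
    rintro e - 
    exact ⟨fun u v h => ⟨h.1, by rw [h.2, Sym2.eq_swap]⟩⟩
  eq_or_eq_of_isLink_of_isLink := by
    rintro e x y v w ⟨-, h1⟩ ⟨-, h2⟩
    have h := h1.symm.trans h2
    rw [Sym2.eq_iff] at h
    rcases h with h | h
    · exact Or.inl h.1
    · exact Or.inr h.1
  left_mem_of_isLink := by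
    rintro e x y ⟨he, h⟩
    exact ⟨e, he, by rw [h]; exact Sym2.mem_mk_left x y⟩

/-- The graph obtained from the tiles by the glueings. -/
def graph : Graph T.Vertex T.Edge := T.subgraph (T.edgesOf T.tiles)

/-- The interior edges: those that come from a glueing. -/
def interior : Set T.Edge := {e | ∃ a b, T.glued a b ∧ e = T.edge a}

/-- The boundary edges. -/
def boundary : Set T.Edge := T.edgesOf T.tiles \ T.interior

/-- Sign functions, with `true` for `+` and `false` for `-`: on every tile the north and the west
edge have the same sign, the south and the east edge have the same sign, and the sign of the north
edge is opposite to the sign of the south edge. -/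
def IsSignFunction (f : T.Edge → Bool) : Prop :=
  ∀ i ∈ T.tiles, f (T.edge (i, .north)) = f (T.edge (i, .west)) ∧
    f (T.edge (i, .south)) = f (T.edge (i, .east)) ∧
    f (T.edge (i, .north)) ≠ f (T.edge (i, .south))

/-- Cutting along the interior edge given by the glueing of `a` and `b`: this glueing is undone. -/
def cut (a b : ℕ × Side) : TileComplex where
  tiles := T.tiles
  glued x y := T.glued x y ∧ ¬ (x = a ∧ y = b)

/-- The map on edges from the graph that has been cut to the original graph. -/
def reglue (a b : ℕ × Side) : (T.cut a b).Edge → T.Edge :=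
  Quot.lift (fun x => T.edge x) (fun _ _ h => Quot.sound h.1)

/-- Good perfect matchings of a band graph: perfect matchings `P` for which there is an interior
edge `e` such that `P ⊔ {e}` is a perfect matching `Q` of the snake graph obtained by cutting along
`e`. In the snake graph there are two copies of `e`, given by the sides `a` and `b`; the edge that
is added to `P` is one of these copies. -/
def IsGoodMatching (P : Set T.Edge) : Prop :=
  IsPerfectMatching T.graph P ∧
    ∃ a b, T.glued a b ∧ ∃ Q : Set (T.cut a b).Edge, IsPerfectMatching (T.cut a b).graph Q ∧
      ∃ c, (c = a ∨ c = b) ∧ (T.cut a b).edge c ∈ Q ∧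
        P = T.reglue a b '' (Q \ {(T.cut a b).edge c})

end TileComplex

/-! ## Snake graphs -/

/-- The direction from a tile of a snake graph to the next one. -/
inductive Step
  | north | east

/-- A snake graph with tiles `G_1, …, G_d`, where `d ≥ 1`, determined up to translation by the
directions from `G_i` to `G_{i+1}` for `1 ≤ i < d`. (The other values of `step` play no role.) -/
structure SnakeGraph where
  d : ℕ
  one_le_d : 1 ≤ d
  step : ℕ → Step

namespace SnakeGraph

variable (G : SnakeGraph)

/-- The side of `G_i` that is the interior edge `e_i`. -/
def outSide (i : ℕ) : Side :=
  match G.step i with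
  | .north => .north
  | .east => .east

/-- The side of `G_{i+1}` that is the interior edge `e_i`. -/
def inSide (i : ℕ) : Side :=
  match G.step i with
  | .north => .south
  | .east => .west

/-- The snake graph as a graph: `e_i` is the north edge of `G_i` and the south edge of `G_{i+1}`,
or the east edge of `G_i` and the west edge of `G_{i+1}`. -/
def complex : TileComplex where
  tiles := Icc 1 G.d
  glued a b := ∃ i, 1 ≤ i ∧ i < G.d ∧ a = (i, G.outSide i) ∧ b = (i + 1, G.inSide i)

/-- The edges of the snake graph. -/
abbrev Edge : Type := G.complex.Edge

/-- The edge given by the side `x` of the tile `G_i`. -/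
abbrev edge (i : ℕ) (x : Side) : G.Edge := G.complex.edge (i, x)

/-- The interior edge `e_i`, shared by `G_i` and `G_{i+1}` (for `1 ≤ i < d`). -/
def intEdge (i : ℕ) : G.Edge := G.edge i (G.outSide i)

/-- The glueings of the snake graph between tiles with index in `A`. -/
def gluedIn (A : Set ℕ) (a b : ℕ × Side) : Prop := G.complex.glued a b ∧ a.1 ∈ A ∧ b.1 ∈ A

/-- The map sending the side `x` of `G_i` to the side `ρ x` of `G_{i+δ}`, for `a ≤ i ≤ b`, is an
isomorphism of snake graphs from `G[a, b]` to `G[a+δ, b+δ]`. -/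
def IsIso (ρ : Side → Side) (δ a b : ℕ) : Prop :=
  ∀ i, a ≤ i → i < b → ρ (G.outSide i) = G.outSide (i + δ)

end SnakeGraph

/-! ## Self-overlaps in the same direction -/

/-- A self-overlap `G[s, t] ≅ G[s', t']` in the same direction of a snake graph `G` with sign
function `f`. An isomorphism that maps the southwest vertex of `G_s` to the southwest vertex of
`G_{s'}` is a translation, possibly composed with the reflection in the diagonal direction. It is
given by the map `ρ` on sides, and it has to preserve the signs. -/
structure SelfOverlap (G : SnakeGraph) (f : G.Edge → Bool) where
  s : ℕ
  t : ℕ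
  s' : ℕ
  t' : ℕ
  ρ : Side → Side
  one_le_s : 1 ≤ s
  s_le_t : s ≤ t
  s_lt_s' : s < s'
  t'_eq : t' = t + (s' - s)
  t'_le_d : t' ≤ G.d
  ρ_eq : ρ = id ∨ ρ = Side.reflect
  isIso : G.IsIso ρ (s' - s) s t
  sign_eq : ∀ i, s ≤ i → i ≤ t → ∀ x, f (G.edge (i + (s' - s)) (ρ x)) = f (G.edge i x)
  /-- maximality, if the overlap has at least two tiles -/
  maximal : s < t → ∀ a b, 1 ≤ a → a ≤ s → t ≤ b → b + (s' - s) ≤ G.d →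
    G.IsIso ρ (s' - s) a b → a = s ∧ b = t
  /-- maximality, if the overlap is a single tile: one of the two tiles is the first or the last
  tile of `G`, or their neighbourhoods are both straight or both zigzag -/
  maximal_single : s = t → (s = 1 ∨ s = G.d ∨ s' = 1 ∨ s' = G.d) ∨
    (G.step (s - 1) = G.step s ↔ G.step (s' - 1) = G.step s')

namespace SelfOverlap

variable {G : SnakeGraph} {f : G.Edge → Bool} (O : SelfOverlap G f)

/-- `G` self-crosses in the overlap. The first condition reads
`f(e_{s-1}) = -f(e_t)` if `s > 1`, or `f(e_{s'-1}) = -f(e_{t'})` if `t' < d`;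
it is void if `s = 1` and `t' = d`. -/
def IsCrossing : Prop :=
  ((O.s = 1 ∧ O.t' = G.d) ∨
    (1 < O.s ∧ f (G.intEdge (O.s - 1)) ≠ f (G.intEdge O.t)) ∨
    (O.t' < G.d ∧ f (G.intEdge (O.s' - 1)) ≠ f (G.intEdge O.t'))) ∧
  f (G.intEdge O.t) = f (G.intEdge (O.s' - 1))

/-! ## The resolution for an overlap in the same direction with `s' > t + 1`

All graphs are glued from the tiles of `G`, which keep their indices. -/

/-- The tiles of `G[1, s-1] ∪ G[t'+1, d]`. -/
def outer : Set ℕ := Icc 1 (O.s - 1) ∪ Icc (O.t' + 1) G.d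

/-- The tiles of `G[t+1, s'-1]`. -/
def middle : Set ℕ := Icc (O.t + 1) (O.s' - 1)

/-- The tiles of `G[s, t]`. -/
def overlap : Set ℕ := Icc O.s O.t

/-- The snake graph `G₃ = G[1, t] ∪ G[t'+1, d]`. The tile `G_{t'+1}` is glued to `G_t` in the way
in which it is glued to `G_{t'}` in `G`, where `G_t` and `G_{t'}` are identified by the overlap. -/
def G3 : TileComplex where
  tiles := O.outer ∪ O.overlap
  glued a b := G.gluedIn (O.outer ∪ O.overlap) a b ∨
    (O.t' < G.d ∧ a = (O.t, O.ρ (G.outSide O.t')) ∧ b = (O.t' + 1, G.inSide O.t'))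

/-- The band graph `G₄°`, obtained from `G[s, s'-1]` by glueing the edge `e_{s'-1}` of the last
tile to the south or west edge of the first tile `G_s` that has the same sign. -/
def G4 : TileComplex where
  tiles := O.overlap ∪ O.middle
  glued a b := G.gluedIn (O.overlap ∪ O.middle) a b ∨
    (a = (O.s' - 1, G.outSide (O.s' - 1)) ∧
      ∃ x : Side, x.IsSW ∧ f (G.edge O.s x) = f (G.intEdge (O.s' - 1)) ∧ b = (O.s, x))

/-- The snake graph `G₅₆' = G[1, s-1] ∪ (G[t+1, s'-1] in reversed order) ∪ G[t'+1, d]`.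
If `s > 1`, the boundary edge of `G_{s-1}` which is north or east (the one that is not `e_{s-1}`) is
glued to the boundary edge of `G_{s'-1}` which is north or east. If `t' < d`, the boundary edge of
`G_{t+1}` which is south or west is glued to the boundary edge of `G_{t'+1}` which is south or
west. -/
def G56' : TileComplex where
  tiles := O.outer ∪ O.middle
  glued a b := G.gluedIn (O.outer ∪ O.middle) a b ∨
    (1 < O.s ∧ a = (O.s - 1, (G.outSide (O.s - 1)).reflect) ∧
      b = (O.s' - 1, (G.outSide (O.s' - 1)).reflect)) ∨
    (O.t' < G.d ∧ a = (O.t + 1, (G.inSide O.t).reflect) ∧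
      b = (O.t' + 1, (G.inSide O.t').reflect))

/-- The number of tiles of `G₅₆'`. -/
def n56 : ℕ := (O.s - 1) + (O.s' - 1 - O.t) + (G.d - O.t')

/-- The `k`-th tile of the snake graph `G₅₆'`, for `1 ≤ k ≤ n56`. -/
def tile56 (k : ℕ) : ℕ :=
  if k < O.s then k
  else if k < O.s + (O.s' - 1 - O.t) then O.s' - 1 - (k - O.s)
  else O.t' + 1 + (k - (O.s + (O.s' - 1 - O.t)))

/-- `e` is the `k`-th interior edge of `G₅₆'`: it is shared by the `k`-th and the `(k+1)`-st
tile. -/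
def IsInt56 (k : ℕ) (e : O.G56'.Edge) : Prop :=
  1 ≤ k ∧ k < O.n56 ∧ e ∈ O.G56'.edgesOf {O.tile56 k} ∧ e ∈ O.G56'.edgesOf {O.tile56 (k + 1)}

/-- The indices of the interior edges of `G₅₆'` that have sign `κ`. -/
def intOfSign (f56 : O.G56'.Edge → Bool) (κ : Bool) : Set ℕ :=
  {k | ∃ e, O.IsInt56 k e ∧ f56 e = κ}

/-- The edges of the `k`-th tiles of `G₅₆'` with `a < k ≤ b`. -/
def segment56 (a b : ℕ) : Set O.G56'.Edge := O.G56'.edgesOf (O.tile56 '' Ioc a b)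

open Classical in
/-- The graph `G₅₆`, given by its set of edges as a subgraph of `G₅₆'`, where `f56` is a sign
function on `G₅₆'`; `none` stands for `G₅₆ = 0`. Let `κ` be the sign of `e_{s'-1}` and `κ'` the
sign of `e_t` in `G₅₆'`.
* If `s ≠ 1` and `t' ≠ d`, it is `G₅₆'`.
* If `s = 1` and `t' ≠ d`, it is `G₅₆' \ pred(e)`, where `e` is the first edge of sign `κ` among
  the interior edges, followed by the north and the east edge of the last tile.
* If `s ≠ 1` and `t' = d`, it is `G₅₆' \ succ(e')`, where `e'` is the last edge of sign `κ'` among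
  the interior edges, preceded by the south and the west edge of the first tile.
* If `s = 1` and `t' = d`, it is `G₅₆' \ pred(e) \ succ(e')`, and a single edge if `e = e'`. It is
  zero if there are no such interior edges. -/
noncomputable def G56 (f56 : O.G56'.Edge → Bool) : Option (Set O.G56'.Edge) :=
  let κ := f56 (O.G56'.edge (O.s' - 1, G.outSide (O.s' - 1)))
  let κ' := f56 (O.G56'.edge (O.t + 1, G.inSide O.t))
  let K := O.intOfSign f56 κ
  let K' := O.intOfSign f56 κ'
  if 1 < O.s ∧ O.t' < G.d then some (O.segment56 0 O.n56)
  else if O.t' < G.d then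
    if K.Nonempty then some (O.segment56 (sInf K) O.n56)
    else some {e | ∃ x : Side, x.IsNE ∧ e = O.G56'.edge (G.d, x) ∧ f56 e = κ}
  else if 1 < O.s then
    if K'.Nonempty then some (O.segment56 0 (sSup K'))
    else some {e | ∃ x : Side, x.IsSW ∧ e = O.G56'.edge (1, x) ∧ f56 e = κ'}
  else
    if K.Nonempty ∧ K'.Nonempty then
      if sInf K < sSup K' then some (O.segment56 (sInf K) (sSup K'))
      else if sInf K = sSup K' then some {e | O.IsInt56 (sInf K) e}
      else none
    else none

/-- The perfect matchings of `G`. -/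
def matchG1 (_O : SelfOverlap G f) : Set (Set G.Edge) := {P | IsPerfectMatching G.complex.graph P}

/-- The perfect matchings of `G₃`. -/
def matchG3 : Set (Set O.G3.Edge) := {P | IsPerfectMatching O.G3.graph P}

/-- The good perfect matchings of the band graph `G₄°`. -/
def matchG4 : Set (Set O.G4.Edge) := {P | O.G4.IsGoodMatching P}

/-- The perfect matchings of `G₅₆`; there is none if `G₅₆ = 0`. -/
def matchG56 (f56 : O.G56'.Edge → Bool) : Set (Set O.G56'.Edge) :=
  {P | ∃ F, O.G56 f56 = some F ∧ IsPerfectMatching (O.G56'.subgraph F) P}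

/-- Pairs of edge sets of `G₃` and `G₄°`, or edge sets of `G₅₆'`. -/
abbrev ResEdgeSets : Type := (Set O.G3.Edge × Set O.G4.Edge) ⊕ Set O.G56'.Edge

/-- The perfect matchings of the resolution `(G₃ ⊔ G₄°) + G₅₆`. -/
def matchRes (f56 : O.G56'.Edge → Bool) : Set O.ResEdgeSets :=
  Sum.inl '' (O.matchG3 ×ˢ O.matchG4) ∪ Sum.inr '' O.matchG56 f56

/-! ## Switching -/

/-- The edge of `G[s', t']` that corresponds to the side `x` of the tile `G_i` of `G[s, t]`. -/
def image (i : ℕ) (x : Side) : G.Edge := G.edge (i + (O.s' - O.s)) (O.ρ x)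

/-- The positions in the overlap are numbered `0, 1, …, t-s+2`. The side `x` of the tile `G_i` in
the overlap is before position `m` if it is a south or west side and `i - s < m`, or if it is a
north or east side and `i - s + 1 < m`. Thus position `0` is the beginning and position `t-s+2` is
the end of the overlap, and position `m` with `1 ≤ m ≤ t-s+1` is at the diagonal of the `m`-th tile
of the overlap from its northwest to its southeast vertex. -/
def Before (m i : ℕ) (x : Side) : Prop := i - O.s + x.level < m

/-- The edge set of `G₃` which is `P` on `G[1, s-1] ∪ G[t'+1, d]`, and on the overlap is `P` on
`G[s, t]` before position `m` and `P` on `G[s', t']` after position `m`. -/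
def switch3 (m : ℕ) (P : Set G.Edge) : Set O.G3.Edge :=
  {e | ∃ i ∈ O.overlap, ∃ x, e = O.G3.edge (i, x) ∧
    ((O.Before m i x ∧ G.edge i x ∈ P) ∨ (¬ O.Before m i x ∧ O.image i x ∈ P))} ∪
  {e | e ∉ O.G3.edgesOf O.overlap ∧
    ∃ i ∈ O.outer, ∃ x, e = O.G3.edge (i, x) ∧ G.edge i x ∈ P}

/-- The edge set of `G₄°` which is `P` on `G[t+1, s'-1]`, and on the overlap is `P` on
`G[s', t']` before position `m` and `P` on `G[s, t]` after position `m`. -/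
def switch4 (m : ℕ) (P : Set G.Edge) : Set O.G4.Edge :=
  {e | ∃ i ∈ O.overlap, ∃ x, e = O.G4.edge (i, x) ∧
    ((O.Before m i x ∧ O.image i x ∈ P) ∨ (¬ O.Before m i x ∧ G.edge i x ∈ P))} ∪
  {e | e ∉ O.G4.edgesOf O.overlap ∧
    ∃ i ∈ O.middle, ∃ x, e = O.G4.edge (i, x) ∧ G.edge i x ∈ P}

/-- `m` is a switching position of `P` in `G[s, t]` and `G[s', t']`. -/
def IsSwitchingPosition (P : Set G.Edge) (m : ℕ) : Prop :=
  m ≤ O.t - O.s + 2 ∧ O.switch3 m P ∈ O.matchG3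

/-- The restriction of `P` to `G₅₆`. An edge of `G₅₆` along which two parts of `G` have been
glued comes from two edges of `G`; it belongs to the restriction if both of them are in `P`. -/
def restrict56 (f56 : O.G56'.Edge → Bool) (P : Set G.Edge) : Set O.G56'.Edge :=
  {e | (∃ F, O.G56 f56 = some F ∧ e ∈ F) ∧
    ∀ i x, O.G56'.edge (i, x) = e → G.edge i x ∈ P}

open Classical in
/-- The map `φ`: switch at the first switching position, if there is one, and otherwise restrict
to `G₅₆`. -/
noncomputable def φ (f56 : O.G56'.Edge → Bool) (P : Set G.Edge) : O.ResEdgeSets :=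
  if h : ∃ m, O.IsSwitchingPosition P m then
    Sum.inl (O.switch3 (Nat.find h) P, O.switch4 (Nat.find h) P)
  else Sum.inr (O.restrict56 f56 P)

/-- The edge set of `G` which is `P₃` on `G[1, s-1] ∪ G[t'+1, d]` and `P₄` on `G[t+1, s'-1]`,
which on `G[s, t]` is `P₃` before position `m` and `P₄` after position `m`, and which on
`G[s', t']` is `P₄` before position `m` and `P₃` after position `m`. -/
def switchBack (m : ℕ) (P3 : Set O.G3.Edge) (P4 : Set O.G4.Edge) : Set G.Edge :=
  {e | ∃ i ∈ O.overlap, ∃ x, e = G.edge i x ∧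
    ((O.Before m i x ∧ O.G3.edge (i, x) ∈ P3) ∨ (¬ O.Before m i x ∧ O.G4.edge (i, x) ∈ P4))} ∪
  {e | ∃ i ∈ O.overlap, ∃ x, e = O.image i x ∧
    ((O.Before m i x ∧ O.G4.edge (i, x) ∈ P4) ∨ (¬ O.Before m i x ∧ O.G3.edge (i, x) ∈ P3))} ∪
  {e | e ∉ G.complex.edgesOf (Icc O.s O.t ∪ Icc O.s' O.t') ∧
    ((∃ i ∈ O.outer, ∃ x, e = G.edge i x ∧ O.G3.edge (i, x) ∈ P3) ∨
      (∃ i ∈ O.middle, ∃ x, e = G.edge i x ∧ O.G4.edge (i, x) ∈ P4))}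

/-- `m` is a switching position of the pair `(P₃, P₄)`. -/
def IsSwitchingPosition34 (P3 : Set O.G3.Edge) (P4 : Set O.G4.Edge) (m : ℕ) : Prop :=
  m ≤ O.t - O.s + 2 ∧ O.switchBack m P3 P4 ∈ O.matchG1

/-- The edges of `G` from which the edges in a set of edges of `G₅₆'` come. -/
def lift56 (P : Set O.G56'.Edge) : Set G.Edge :=
  {e | ∃ i x, O.G56'.edge (i, x) ∈ P ∧ e = G.edge i x}

/-- `P₁` is a perfect matching of `G` obtained from `P₅₆` by first completing `P₅₆` to a perfect
matching `P'` of `G₅₆'` using only boundary edges of `G₅₆'`, and then completing `P'` to a perfect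
matching of `G` using only boundary edges of `G`. -/
def IsCompletion (P56 : Set O.G56'.Edge) (P1 : Set G.Edge) : Prop :=
  ∃ P' : Set O.G56'.Edge, IsPerfectMatching O.G56'.graph P' ∧
    P56 ⊆ P' ∧ P' \ P56 ⊆ O.G56'.boundary ∧
    P1 ∈ O.matchG1 ∧ O.lift56 P' ⊆ P1 ∧ P1 \ O.lift56 P' ⊆ G.complex.boundary

open Classical in
/-- The map `ψ`: switch a pair `(P₃, P₄)` at its first switching position, and send a matching of
`G₅₆` to its completion. (The value `∅` is never taken on matchings of the resolution.) -/
noncomputable def ψ : O.ResEdgeSets → Set G.Edge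
  | Sum.inl (P3, P4) =>
    if h : ∃ m, O.IsSwitchingPosition34 P3 P4 m then O.switchBack (Nat.find h) P3 P4 else ∅
  | Sum.inr P56 => if h : ∃ P1, O.IsCompletion P56 P1 then h.choose else ∅

end SelfOverlap

end SnakeCalculus

/-!
# Resolution of a self-crossing

The proof replaces perfect matchings by a local description. A *selection* chooses, on every tile,
one of the two pairs of opposite sides; it is *admissible* if of any two sides that are glued at
least one is chosen. On a chain of tiles, the perfect matchings are the edge sets of the
admissible selections, where an edge is taken if it is chosen in all tiles that contain it
(`IsChain.isPerfectMatching_iff`). The same holds for the good matchings of the band graph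
(`isGoodMatching_iff`), since these are what remains of perfect matchings of the chains obtained
by cutting.

The crossing enters through two facts (`Regular`): the overlap does not extend at either end, and
the edges at which the overlap meets the tiles between its two copies, `e_{s'-1}` and `e_t`, have
the same sign.

*Switching.* A selection `σ` on `G` gives two selections on the overlap, `σ` itself on `G[s, t]`,
and `O.shift σ` on `G[s', t']`. A position is a switching position if and only if these meet there
(`Agree`): they coincide on the tile of the position or, for the two ends, the neighbouring tiles
choose the edges at that end (`isSwitchingPosition_iff`). Switching exchanges the two selections
after the position, and so leaves this condition unchanged for every position; the same
description holds for pairs of matchings of `G₃` and `G₄°` (`isSwitchingPosition34_iff`). Hence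
the first switching positions correspond to each other, and switching twice is the identity. For a
pair of matchings there always is a switching position (`exists_agree`): otherwise the two
selections are opposite to each other and without interior edges on the overlap, and along such a
selection the choices at the two ends are determined by the signs there, in contradiction to the
equality of the signs of `e_{s'-1}` and `e_t`.

*No switching position.* For a matching of `G` without a switching position, the same argument
shows that the selections on both copies of the overlap are determined (`Opposed`). The remaining
conditions concern the other tiles: not both of `e_{s-1}` and `e_{s'-1}` may be chosen, and not
both of `e_t` and `e_{t'}`. If these edges exist, this is admissibility at the new glueings of
`G₅₆'`, in which the opposite choices are glued. If `s = 1`, it says that `e_{s'-1}` is not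
chosen, and similarly for `t' = d` (`fits56_iff'`).

*The graph `G₅₆`.* With a sign `κ` fixed, a selection on a chain is given by one coordinate, up or
down, on every tile (`Up`). Admissibility means that the coordinate can only go down at interior
edges of sign `κ`, and only up at the others (`admissible_iff_up`). If it has to begin with up, it
stays up until the first edge of sign `κ`; if it has to end with down, it is down from the last
such edge on. This is why removing the tiles up to that edge, or from it on, gives a graph with
the same matchings, and why the removed part is completed by boundary edges in exactly one way
(`IsWindow`, `exists_window`). This includes the cases in which a single edge is left, or nothing,
when no selection can begin with up and end with down.
-/

namespace SnakeCalculus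

/-! ### Sides of a tile -/

namespace Side

/-- The other side of the tile at the northwest or southeast vertex of a side. -/
def cofoot : Side → Side
  | south => east
  | east => south
  | north => west
  | west => north

@[simp] theorem reflect_reflect (x : Side) : x.reflect.reflect = x := by cases x <;> rfl
@[simp] theorem cofoot_cofoot (x : Side) : x.cofoot.cofoot = x := by cases x <;> rfl
@[simp] theorem apex_reflect (x : Side) : x.reflect.apex = x.apex := by cases x <;> rfl
@[simp] theorem level_reflect (x : Side) : x.reflect.level = x.level := by cases x <;> rfl
@[simp] theorem foot_cofoot (x : Side) : x.cofoot.foot = x.foot := by cases x <;> rfl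
theorem reflect_cofoot (x : Side) : x.cofoot.reflect = x.reflect.cofoot := by cases x <;> rfl
theorem reflect_ne (x : Side) : x.reflect ≠ x := by cases x <;> nofun
theorem cofoot_ne (x : Side) : x.cofoot ≠ x := by cases x <;> nofun
theorem level_cofoot_ne (x : Side) : x.cofoot.level ≠ x.level := by cases x <;> decide
theorem apex_ne_foot (x y : Side) : x.apex ≠ y.foot := by cases x <;> cases y <;> nofun
theorem reflect_injective {x y : Side} (h : x.reflect = y.reflect) : x = y := by
  rw [← reflect_reflect x, h, reflect_reflect]

theorem eq_or_eq_reflect_of_apex {x y : Side} (h : x.apex = y.apex) : x = y ∨ x = y.reflect := by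
  cases x <;> cases y <;> simp_all [apex, reflect]

theorem eq_or_eq_cofoot_of_foot {x y : Side} (h : x.foot = y.foot) : x = y ∨ x = y.cofoot := by
  cases x <;> cases y <;> simp_all [foot, cofoot]

theorem eq_or_eq_reflect_of_level {x y : Side} (h : x.level = y.level) :
    x = y ∨ x = y.reflect := by
  cases x <;> cases y <;> simp_all [level, reflect]

theorem eq_cofoot_or_of_level_ne {x y : Side} (h : x.level ≠ y.level) :
    x = y.cofoot ∨ x = y.reflect.cofoot := by
  cases x <;> cases y <;> simp_all [level, reflect, cofoot]

end Side

namespace TileComplex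

variable {T : TileComplex}

/-! ### Edges and vertices of a strip of tiles -/

/-- Two sides are glued, in one order or the other. -/
def Glue (T : TileComplex) (a b : ℕ × Side) : Prop := T.glued a b ∨ T.glued b a

theorem Glue.symm {a b : ℕ × Side} (h : T.Glue a b) : T.Glue b a := Or.symm h

/-- Every side is glued to at most one side, of a different tile, and of the two sides at the
southwest vertex of a tile (or at its northeast vertex) at most one is glued. So the tiles form
paths and cycles. -/
structure IsStrip (T : TileComplex) : Prop where
  unique : ∀ {a b c}, T.Glue a b → T.Glue a c → b = c
  reflect : ∀ {a b c}, T.Glue a b → ¬ T.Glue (a.1, a.2.reflect) c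
  ne : ∀ {a b}, T.Glue a b → a.1 ≠ b.1

/-- A set of tiles is convex if no tile outside of it has two neighbours in it. -/
def IsConvex (T : TileComplex) (A : Set ℕ) : Prop :=
  ∀ j ∉ A, ∀ x y a b, T.Glue (j, x) a → T.Glue (j, y) b → a.1 ∈ A → b.1 ∈ A → a = b

namespace IsStrip

theorem edge_eq_iff (hT : T.IsStrip) {a b : ℕ × Side} :
    T.edge a = T.edge b ↔ a = b ∨ T.Glue a b := by
  constructor
  · intro h
    have h' := Quot.eqvGen_exact h
    clear h
    induction h' with
    | rel x y h => exact Or.inr (Or.inl h)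
    | refl x => exact Or.inl rfl
    | symm x y _ ih => exact ih.imp Eq.symm Glue.symm
    | trans x y z _ _ ih₁ ih₂ =>
      rcases ih₁ with rfl | h₁
      · exact ih₂
      · rcases ih₂ with rfl | h₂
        · exact Or.inr h₁
        · exact Or.inl (hT.unique h₁.symm h₂)
  · rintro (rfl | h | h)
    · rfl
    · exact Quot.sound h
    · exact (Quot.sound h).symm

end IsStrip

theorem edge_eq_of_glue {a b : ℕ × Side} (h : T.Glue a b) : T.edge a = T.edge b := by
  rcases h with h | h
  · exact Quot.sound h
  · exact (Quot.sound h).symm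

theorem vertex_eq_of_glue {a b : ℕ × Side} (h : T.Glue a b) :
    T.vertex (a.1, a.2.apex) = T.vertex (b.1, b.2.foot) := by
  rcases h with h | h
  · exact Quot.sound ⟨a, b, h, Or.inl ⟨rfl, rfl⟩⟩
  · exact (Quot.sound ⟨b, a, h, Or.inr ⟨rfl, rfl⟩⟩).symm

open Classical in
/-- A representative of the vertex given by a vertex `u` of a tile: if `u` is the `apex` of a glued
side, it is the `foot` of the side that is glued to it, and otherwise it is `u`. -/
noncomputable def normalForm (T : TileComplex) (u : ℕ × Corner) : ℕ × Corner :=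
  if h : ∃ b a, T.Glue a b ∧ u = (a.1, a.2.apex) then (h.choose.1, h.choose.2.foot) else u

theorem IsStrip.normalForm_glue (hT : T.IsStrip) {a b : ℕ × Side} (h : T.Glue a b) :
    T.normalForm (a.1, a.2.apex) = (b.1, b.2.foot) := by
  have hex : ∃ b' a', T.Glue a' b' ∧ (a.1, a.2.apex) = (a'.1, a'.2.apex) := ⟨b, a, h, rfl⟩
  rw [normalForm, dif_pos hex]
  obtain ⟨a', h', he⟩ := hex.choose_spec
  have h1 : a'.1 = a.1 := (congrArg Prod.fst he).symm
  have h2 : a'.2.apex = a.2.apex := (congrArg Prod.snd he).symm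
  have : a' = a := by
    rcases Side.eq_or_eq_reflect_of_apex h2 with h3 | h3
    · exact Prod.ext h1 h3
    · have : a' = (a.1, a.2.reflect) := Prod.ext h1 h3
      exact absurd (this ▸ h') (hT.reflect h)
  subst this
  rw [hT.unique h h']

theorem normalForm_foot (i : ℕ) (x : Side) :
    T.normalForm (i, x.foot) = (i, x.foot) := by
  rw [normalForm, dif_neg]
  rintro ⟨b, a, -, h⟩
  exact Side.apex_ne_foot _ _ (congrArg Prod.snd h).symm

theorem normalForm_apex {i : ℕ} {x : Side} (h₁ : ∀ b, ¬ T.Glue (i, x) b)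
    (h₂ : ∀ b, ¬ T.Glue (i, x.reflect) b) : T.normalForm (i, x.apex) = (i, x.apex) := by
  rw [normalForm, dif_neg]
  rintro ⟨b, ⟨j, y⟩, hg, h⟩
  simp only [Prod.mk.injEq] at h
  obtain ⟨rfl, h⟩ := h
  rcases Side.eq_or_eq_reflect_of_apex h.symm with rfl | rfl
  · exact h₁ _ hg
  · exact h₂ _ hg

theorem IsStrip.normalForm_eq (hT : T.IsStrip) {u v : ℕ × Corner}
    (h : T.vertex u = T.vertex v) : T.normalForm u = T.normalForm v := by
  have key : ∀ a b, T.Glue a b →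
      T.normalForm (a.1, a.2.apex) = T.normalForm (b.1, b.2.foot) := fun a b h => by
    rw [hT.normalForm_glue h, normalForm_foot]
  refine congrArg (Quot.lift T.normalForm ?_) h
  rintro u v ⟨a, b, hg, ⟨rfl, rfl⟩ | ⟨rfl, rfl⟩⟩
  · exact key _ _ (Or.inl hg)
  · exact (key _ _ (Or.inr hg)).symm

theorem mem_ends {j : ℕ} {x : Side} {v : T.Vertex} :
    v ∈ T.ends (T.edge (j, x)) ↔ v = T.vertex (j, x.apex) ∨ v = T.vertex (j, x.foot) :=
  Sym2.mem_iff

/-- The edges of the tiles in `A` at the vertex `p.foot` of the `i`-th tile: two sides of the tile,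
and for each of them that is glued, one further side of the neighbouring tile. -/
theorem IsStrip.mem_ends_foot (hT : T.IsStrip) {A : Set ℕ} {i : ℕ} {p : Side} {e : T.Edge}
    (hi : i ∈ A) :
    (e ∈ T.edgesOf A ∧ T.vertex (i, p.foot) ∈ T.ends e) ↔
      ((e = T.edge (i, p) ∨ ∃ b, T.Glue (i, p) b ∧ b.1 ∈ A ∧ e = T.edge (b.1, b.2.reflect)) ∨
      (e = T.edge (i, p.cofoot) ∨
        ∃ b, T.Glue (i, p.cofoot) b ∧ b.1 ∈ A ∧ e = T.edge (b.1, b.2.reflect))) := by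
  constructor
  · rintro ⟨⟨j, hj, x, rfl⟩, hv⟩
    rw [mem_ends] at hv
    rcases hv with hv | hv
    · have hn := hT.normalForm_eq hv
      rw [normalForm_foot] at hn
      by_cases hg : ∃ a b, T.Glue a b ∧ a.1 = j ∧ a.2.apex = x.apex
      · obtain ⟨⟨j', x'⟩, ⟨i', q⟩, hg, rfl, hx⟩ := hg
        have h2 := hT.normalForm_glue hg
        simp only at h2 hx
        rw [hx, ← hn] at h2
        simp only [Prod.mk.injEq] at h2
        obtain ⟨rfl, h2⟩ := h2
        have hq : T.edge (j', x) = T.edge (i, q) ∨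
            ∃ b, T.Glue (i, q) b ∧ b.1 ∈ A ∧ T.edge (j', x) = T.edge (b.1, b.2.reflect) := by
          rcases Side.eq_or_eq_reflect_of_apex hx with rfl | rfl
          · exact Or.inl (edge_eq_of_glue hg)
          · exact Or.inr ⟨_, hg.symm, hj, by simp⟩
        rcases Side.eq_or_eq_cofoot_of_foot h2 with rfl | rfl
        · exact Or.inl hq
        · rw [Side.cofoot_cofoot]; exact Or.inr hq
      · rw [normalForm_apex (fun b hb => hg ⟨_, b, hb, rfl, rfl⟩)
          (fun b hb => hg ⟨_, b, hb, rfl, by simp⟩)] at hn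
        exact absurd (congrArg Prod.snd hn).symm (Side.apex_ne_foot _ _)
    · have hn := hT.normalForm_eq hv
      rw [normalForm_foot, normalForm_foot] at hn
      simp only [Prod.mk.injEq] at hn
      obtain ⟨rfl, hn⟩ := hn
      rcases Side.eq_or_eq_cofoot_of_foot hn with rfl | rfl
      · exact Or.inl (Or.inl rfl)
      · rw [Side.cofoot_cofoot]; exact Or.inr (Or.inl rfl)
  · have key : ∀ q : Side, q.foot = p.foot → (e = T.edge (i, q) ∨
        ∃ b, T.Glue (i, q) b ∧ b.1 ∈ A ∧ e = T.edge (b.1, b.2.reflect)) →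
        (e ∈ T.edgesOf A ∧ T.vertex (i, p.foot) ∈ T.ends e) := by
      rintro q hq (rfl | ⟨b, hb, hbA, rfl⟩)
      · exact ⟨⟨i, hi, q, rfl⟩, mem_ends.2 (Or.inr (by rw [hq]))⟩
      · refine ⟨⟨b.1, hbA, _, rfl⟩, mem_ends.2 (Or.inl ?_)⟩
        rw [Side.apex_reflect, vertex_eq_of_glue hb.symm, hq]
    rintro (h | h)
    · exact key p rfl h
    · exact key _ (Side.foot_cofoot p) h

/-- The edges of the tiles in `A` at the vertex `p.apex` of the `i`-th tile, if neither of the two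
sides at this vertex is glued to a tile in `A`. -/
theorem IsStrip.mem_ends_apex (hT : T.IsStrip) {A : Set ℕ} (hA : T.IsConvex A) {i : ℕ} {p : Side}
    {e : T.Edge} (hi : i ∈ A) (h₁ : ∀ b, T.Glue (i, p) b → b.1 ∉ A)
    (h₂ : ∀ b, T.Glue (i, p.reflect) b → b.1 ∉ A) :
    (e ∈ T.edgesOf A ∧ T.vertex (i, p.apex) ∈ T.ends e) ↔
      (e = T.edge (i, p) ∨ e = T.edge (i, p.reflect)) := by
  constructor
  · rintro ⟨⟨j, hj, x, rfl⟩, hv⟩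
    rw [mem_ends] at hv
    have hn : T.normalForm (i, p.apex) = T.normalForm (j, x.apex) ∨
        T.normalForm (i, p.apex) = T.normalForm (j, x.foot) :=
      hv.imp hT.normalForm_eq hT.normalForm_eq
    by_cases hg : ∃ a b, T.Glue a b ∧ a.1 = i ∧ a.2.apex = p.apex
    · obtain ⟨⟨i', p'⟩, b, hg, rfl, hp⟩ := hg
      simp only at hp
      have hb : b.1 ∉ A := by
        rcases Side.eq_or_eq_reflect_of_apex hp with rfl | rfl
        · exact h₁ b hg
        · exact h₂ b hg
      have h3 := hT.normalForm_glue hg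
      simp only [hp] at h3
      rw [h3] at hn
      rcases hn with hn | hn
      · by_cases hg2 : ∃ a b, T.Glue a b ∧ a.1 = j ∧ a.2.apex = x.apex
        · obtain ⟨⟨j', x'⟩, c, hg2, rfl, hx⟩ := hg2
          simp only at hx
          have h4 := hT.normalForm_glue hg2
          simp only [hx] at h4
          rw [h4] at hn
          have hbc : b.1 = c.1 := (Prod.mk.inj hn).1
          have := hA b.1 hb b.2 c.2 _ _ hg.symm (by rw [hbc]; exact hg2.symm) hi hj
          simp only [Prod.mk.injEq] at this
          obtain ⟨rfl, rfl⟩ := this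
          rcases Side.eq_or_eq_reflect_of_apex (hx.symm.trans hp) with rfl | rfl
          · exact Or.inl rfl
          · exact Or.inr rfl
        · rw [normalForm_apex (fun b hb => hg2 ⟨_, b, hb, rfl, rfl⟩)
            (fun b hb => hg2 ⟨_, b, hb, rfl, by simp⟩)] at hn
          exact absurd (congrArg Prod.snd hn).symm (Side.apex_ne_foot _ _)
      · rw [normalForm_foot] at hn
        exact absurd (by rw [congrArg Prod.fst hn]; exact hj) hb
    · rw [normalForm_apex (fun b hb => hg ⟨_, b, hb, rfl, rfl⟩)
        (fun b hb => hg ⟨_, b, hb, rfl, by simp⟩)] at hn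
      rcases hn with hn | hn
      · by_cases hg2 : ∃ a b, T.Glue a b ∧ a.1 = j ∧ a.2.apex = x.apex
        · obtain ⟨⟨j', x'⟩, c, hg2, rfl, hx⟩ := hg2
          simp only at hx
          have h4 := hT.normalForm_glue hg2
          simp only [hx] at h4
          rw [h4] at hn
          exact absurd (congrArg Prod.snd hn) (Side.apex_ne_foot _ _)
        · rw [normalForm_apex (fun b hb => hg2 ⟨_, b, hb, rfl, rfl⟩)
            (fun b hb => hg2 ⟨_, b, hb, rfl, by simp⟩)] at hn
          simp only [Prod.mk.injEq] at hn
          obtain ⟨rfl, hn⟩ := hn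
          rcases Side.eq_or_eq_reflect_of_apex hn.symm with rfl | rfl
          · exact Or.inl rfl
          · exact Or.inr rfl
      · rw [normalForm_foot] at hn
        exact absurd (congrArg Prod.snd hn) (Side.apex_ne_foot _ _)
  · rintro (rfl | rfl)
    · exact ⟨⟨i, hi, _, rfl⟩, mem_ends.2 (Or.inl rfl)⟩
    · exact ⟨⟨i, hi, _, rfl⟩, mem_ends.2 (Or.inl (by simp))⟩

/-! ### Perfect matchings as selections -/

theorem edgeSet_subgraph (F : Set T.Edge) : (T.subgraph F).edgeSet = F := by
  ext e
  rw [Graph.edge_mem_iff_exists_isLink]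
  constructor
  · rintro ⟨x, y, h⟩
    exact h.1
  · intro h
    induction hz : T.ends e using Sym2.ind with
    | _ x y => exact ⟨x, y, h, hz⟩

theorem inc_subgraph {F : Set T.Edge} {e : T.Edge} {v : T.Vertex} :
    (T.subgraph F).Inc e v ↔ e ∈ F ∧ v ∈ T.ends e := by
  constructor
  · rintro ⟨w, h⟩
    exact ⟨h.1, by rw [h.2]; exact Sym2.mem_mk_left _ _⟩
  · rintro ⟨h, w, hw⟩
    exact ⟨w, h, hw⟩

theorem isPerfectMatching_subgraph {F P : Set T.Edge} :
    IsPerfectMatching (T.subgraph F) P ↔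
      P ⊆ F ∧ ∀ e ∈ F, ∀ v ∈ T.ends e, ∃! e', e' ∈ P ∧ e' ∈ F ∧ v ∈ T.ends e' := by
  rw [IsPerfectMatching, edgeSet_subgraph]
  simp only [inc_subgraph]
  refine and_congr_right fun _ => ⟨fun h e he v hv => h v ⟨e, he, hv⟩, ?_⟩
  rintro h v ⟨e, he, hv⟩
  exact h e he v hv

/-- Perfect matchings can be tested at the vertices `p.foot` and at the vertices `p.apex` of tiles
at which no glueing takes place. -/
theorem IsStrip.isPerfectMatching_iff (hT : T.IsStrip) {A : Set ℕ} (hA : T.IsConvex A)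
    {P : Set T.Edge} :
    IsPerfectMatching (T.subgraph (T.edgesOf A)) P ↔ P ⊆ T.edgesOf A ∧
      (∀ i ∈ A, ∀ p : Side, ∃! e, e ∈ P ∧
        ((e = T.edge (i, p) ∨ ∃ b, T.Glue (i, p) b ∧ b.1 ∈ A ∧ e = T.edge (b.1, b.2.reflect)) ∨
        (e = T.edge (i, p.cofoot) ∨
          ∃ b, T.Glue (i, p.cofoot) b ∧ b.1 ∈ A ∧ e = T.edge (b.1, b.2.reflect)))) ∧
      (∀ i ∈ A, ∀ p : Side, (∀ b, T.Glue (i, p) b → b.1 ∉ A) →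
        (∀ b, T.Glue (i, p.reflect) b → b.1 ∉ A) →
        ∃! e, e ∈ P ∧ (e = T.edge (i, p) ∨ e = T.edge (i, p.reflect))) := by
  rw [isPerfectMatching_subgraph]
  refine and_congr_right fun hP => ⟨fun h => ⟨fun i hi p => ?_, fun i hi p h₁ h₂ => ?_⟩, ?_⟩
  · simp only [← hT.mem_ends_foot hi]
    exact h _ ⟨i, hi, p, rfl⟩ _ (mem_ends.2 (Or.inr rfl))
  · simp only [← hT.mem_ends_apex hA hi h₁ h₂]
    exact h _ ⟨i, hi, p, rfl⟩ _ (mem_ends.2 (Or.inl rfl))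
  · rintro ⟨hf, ha⟩ e ⟨i, hi, p, rfl⟩ v hv
    have foot : ∀ j ∈ A, ∀ q : Side, v = T.vertex (j, q.foot) →
        ∃! e', e' ∈ P ∧ e' ∈ T.edgesOf A ∧ v ∈ T.ends e' := by
      rintro j hj q rfl
      simp only [hT.mem_ends_foot hj]
      exact hf j hj q
    rw [mem_ends] at hv
    rcases hv with rfl | rfl
    · by_cases h₁ : ∃ b, T.Glue (i, p) b ∧ b.1 ∈ A
      · obtain ⟨b, hb, hbA⟩ := h₁
        exact foot _ hbA b.2 (vertex_eq_of_glue hb)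
      by_cases h₂ : ∃ b, T.Glue (i, p.reflect) b ∧ b.1 ∈ A
      · obtain ⟨b, hb, hbA⟩ := h₂
        refine foot _ hbA b.2 ?_
        rw [← vertex_eq_of_glue hb, Side.apex_reflect]
      push Not at h₁ h₂
      simp only [hT.mem_ends_apex hA hi h₁ h₂]
      exact ha i hi p h₁ h₂
    · exact foot i hi p rfl

/-- A selection chooses on every tile one of the two pairs of opposite sides. -/
structure IsSelection (σ : ℕ × Side → Prop) : Prop where
  reflect : ∀ i x, σ (i, x.reflect) ↔ ¬ σ (i, x)
  cofoot : ∀ i x, σ (i, x.cofoot) ↔ ¬ σ (i, x)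

/-- A selection is admissible on the tiles in `A` if of any two sides of these tiles that are glued,
at least one is selected. -/
def Admissible (T : TileComplex) (A : Set ℕ) (σ : ℕ × Side → Prop) : Prop :=
  ∀ a b, T.Glue a b → a.1 ∈ A → b.1 ∈ A → σ a ∨ σ b

/-- The edges of the tiles in `A` that are selected in all tiles in `A` which contain them. -/
def matching (T : TileComplex) (A : Set ℕ) (σ : ℕ × Side → Prop) : Set T.Edge :=
  {e | e ∈ T.edgesOf A ∧ ∀ i ∈ A, ∀ x, T.edge (i, x) = e → σ (i, x)}

theorem IsStrip.mem_matching (hT : T.IsStrip) {A : Set ℕ} {σ : ℕ × Side → Prop} {i : ℕ}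
    (hi : i ∈ A) (x : Side) :
    T.edge (i, x) ∈ T.matching A σ ↔ σ (i, x) ∧ ∀ b, T.Glue (i, x) b → b.1 ∈ A → σ b := by
  constructor
  · rintro ⟨-, h⟩
    exact ⟨h i hi x rfl, fun b hb hbA => h b.1 hbA b.2 (edge_eq_of_glue hb).symm⟩
  · rintro ⟨h₁, h₂⟩
    refine ⟨⟨i, hi, x, rfl⟩, fun j hj y he => ?_⟩
    rcases hT.edge_eq_iff.1 he with h | h
    · rwa [h]
    · exact h₂ _ h.symm hj

theorem IsStrip.mem_matching_of_not_glue (hT : T.IsStrip) {A : Set ℕ} {σ : ℕ × Side → Prop} {i : ℕ}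
    (hi : i ∈ A) {x : Side} (h : ∀ b, ¬ T.Glue (i, x) b) :
    T.edge (i, x) ∈ T.matching A σ ↔ σ (i, x) := by
  rw [hT.mem_matching hi]
  exact ⟨fun h => h.1, fun h' => ⟨h', fun b hb => absurd hb (h b)⟩⟩

theorem IsStrip.mem_matching_of_glue (hT : T.IsStrip) {A : Set ℕ} {σ : ℕ × Side → Prop} {i : ℕ}
    (hi : i ∈ A) {x : Side} {b : ℕ × Side} (h : T.Glue (i, x) b) (hb : b.1 ∈ A) :
    T.edge (i, x) ∈ T.matching A σ ↔ σ (i, x) ∧ σ b := by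
  rw [hT.mem_matching hi]
  refine and_congr_right fun _ => ⟨fun h' => h' b h hb, fun h' c hc _ => ?_⟩
  rwa [hT.unique hc h]

/-- The edges at a vertex of a strip, in their cyclic order, are `E₀, …, E_k`, where `E_{j-1}` and
`E_j` lie in a common tile, which selects exactly one of them. As `E_1, …, E_{k-1}` are selected at
least once each, exactly one edge is selected by all of its tiles. -/
theorem IsStrip.isPerfectMatching_matching (hT : T.IsStrip) {A : Set ℕ} (hA : T.IsConvex A)
    {σ : ℕ × Side → Prop} (hσ : IsSelection σ) (hadm : T.Admissible A σ) :
    IsPerfectMatching (T.subgraph (T.edgesOf A)) (T.matching A σ) := by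
  rw [hT.isPerfectMatching_iff hA]
  refine ⟨fun e he => he.1, fun i hi p => ?_, fun i hi p h₁ h₂ => ?_⟩
  · have key : ∀ q : Side, σ (i, q) → ∃! e, e ∈ T.matching A σ ∧
        ((e = T.edge (i, q) ∨ ∃ b, T.Glue (i, q) b ∧ b.1 ∈ A ∧ e = T.edge (b.1, b.2.reflect)) ∨
        (e = T.edge (i, q.cofoot) ∨
          ∃ b, T.Glue (i, q.cofoot) b ∧ b.1 ∈ A ∧ e = T.edge (b.1, b.2.reflect))) := by
      intro q hq
      have hq' : ¬ σ (i, q.cofoot) := by rw [hσ.cofoot]; exact not_not.2 hq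
      have hn : ∀ e, e ∈ T.matching A σ → ¬ (e = T.edge (i, q.cofoot) ∨
          ∃ b, T.Glue (i, q.cofoot) b ∧ b.1 ∈ A ∧ e = T.edge (b.1, b.2.reflect)) := by
        rintro e he (rfl | ⟨b, hb, hbA, rfl⟩)
        · exact hq' (he.2 i hi _ rfl)
        · have h1 := he.2 _ hbA _ rfl
          rw [hσ.reflect] at h1
          exact (hadm _ _ hb hi hbA).elim hq' h1
      by_cases hg : ∃ b, T.Glue (i, q) b ∧ b.1 ∈ A
      · obtain ⟨b, hb, hbA⟩ := hg
        have hbr : T.edge (b.1, b.2.reflect) ∈ T.matching A σ ↔ ¬ σ b := by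
          rw [hT.mem_matching_of_not_glue hbA fun c => hT.reflect hb.symm, hσ.reflect]
        by_cases hσb : σ b
        · refine ⟨T.edge (i, q), ⟨(hT.mem_matching_of_glue hi hb hbA).2 ⟨hq, hσb⟩,
            Or.inl (Or.inl rfl)⟩, ?_⟩
          rintro e ⟨he, (rfl | ⟨c, hc, hcA, rfl⟩) | h⟩
          · rfl
          · rw [hT.unique hc hb, hbr] at he
            exact absurd hσb he
          · exact absurd h (hn e he)
        · refine ⟨_, ⟨hbr.2 hσb, Or.inl (Or.inr ⟨b, hb, hbA, rfl⟩)⟩, ?_⟩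
          rintro e ⟨he, (rfl | ⟨c, hc, hcA, rfl⟩) | h⟩
          · exact absurd ((hT.mem_matching_of_glue hi hb hbA).1 he).2 hσb
          · rw [hT.unique hc hb]
          · exact absurd h (hn e he)
      · push Not at hg
        refine ⟨T.edge (i, q), ⟨(hT.mem_matching hi q).2 ⟨hq, fun b hb hbA => absurd hbA (hg b hb)⟩,
            Or.inl (Or.inl rfl)⟩, ?_⟩
        rintro e ⟨he, (rfl | ⟨c, hc, hcA, rfl⟩) | h⟩
        · rfl
        · exact absurd hcA (hg c hc)
        · exact absurd h (hn e he)
    by_cases hp : σ (i, p)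
    · exact key p hp
    · have := key p.cofoot ((hσ.cofoot i p).2 hp)
      rw [Side.cofoot_cofoot] at this
      simpa only [or_comm] using this
  · have key : ∀ q : Side, (∀ b, T.Glue (i, q) b → b.1 ∉ A) → σ (i, q) →
        ∃! e, e ∈ T.matching A σ ∧ (e = T.edge (i, q) ∨ e = T.edge (i, q.reflect)) := by
      intro q hg hq
      refine ⟨T.edge (i, q), ⟨(hT.mem_matching hi q).2 ⟨hq, fun b hb hbA => absurd hbA (hg b hb)⟩,
            Or.inl rfl⟩, ?_⟩
      rintro e ⟨he, rfl | rfl⟩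
      · rfl
      · exact absurd hq ((hσ.reflect _ _).1 (he.2 i hi _ rfl))
    by_cases hp : σ (i, p)
    · exact key p h₁ hp
    · have := key p.reflect h₂ ((hσ.reflect i p).2 hp)
      rw [Side.reflect_reflect] at this
      simpa only [or_comm] using this

end TileComplex

namespace TileComplex

variable {T : TileComplex}

/-- At a vertex `p.foot` of a tile in `A` there is exactly one edge of a perfect matching. -/
theorem IsStrip.exactly_one_foot (hT : T.IsStrip) {A : Set ℕ} (hA : T.IsConvex A)
    {P : Set T.Edge} (hP : IsPerfectMatching (T.subgraph (T.edgesOf A)) P) {i : ℕ} (hi : i ∈ A)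
    (p : Side) {E E' X X' : Prop} (hE : E ↔ T.edge (i, p) ∈ P)
    (hE' : E' ↔ T.edge (i, p.cofoot) ∈ P)
    (hX : X ↔ ∃ b, T.Glue (i, p) b ∧ b.1 ∈ A ∧ T.edge (b.1, b.2.reflect) ∈ P)
    (hX' : X' ↔ ∃ b, T.Glue (i, p.cofoot) b ∧ b.1 ∈ A ∧ T.edge (b.1, b.2.reflect) ∈ P) :
    (E ∨ E' ∨ X ∨ X') ∧ ¬ (E ∧ E') ∧ ¬ (E ∧ X) ∧ ¬ (E ∧ X') ∧ ¬ (E' ∧ X) ∧ ¬ (E' ∧ X') ∧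
      ¬ (X ∧ X') := by
  obtain ⟨e, he, hu⟩ := ((hT.isPerfectMatching_iff hA).1 hP).2.1 i hi p
  simp only [and_imp] at hu
  -- two edges of `P` at the vertex coincide
  have eq {e₁ e₂ : T.Edge} (h₁ : e₁ ∈ P) h₁' (h₂ : e₂ ∈ P) h₂' : e₁ = e₂ :=
    (hu e₁ h₁ h₁').trans (hu e₂ h₂ h₂').symm
  rw [hE, hE', hX, hX']
  have near_far {q q' : Side} {b : ℕ × Side} (hb : T.Glue (i, q') b)
      (h : T.edge (i, q) = T.edge (b.1, b.2.reflect)) : False := by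
    rcases hT.edge_eq_iff.1 h with h | h
    · exact hT.ne hb (Prod.mk.inj h).1
    · exact hT.reflect hb.symm h.symm
  refine ⟨?_, ?_, ?_, ?_, ?_, ?_, ?_⟩
  · obtain ⟨heP, (rfl | ⟨b, hb, hbA, rfl⟩) | (rfl | ⟨b, hb, hbA, rfl⟩)⟩ := he
    · exact Or.inl heP
    · exact Or.inr (Or.inr (Or.inl ⟨b, hb, hbA, heP⟩))
    · exact Or.inr (Or.inl heP)
    · exact Or.inr (Or.inr (Or.inr ⟨b, hb, hbA, heP⟩))
  · rintro ⟨h, h'⟩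
    rcases hT.edge_eq_iff.1 (eq h (Or.inl (Or.inl rfl)) h' (Or.inr (Or.inl rfl))) with h | h
    · exact Side.cofoot_ne p (Prod.mk.inj h).2.symm
    · exact hT.ne h rfl
  · rintro ⟨h, b, hb, hbA, h'⟩
    exact near_far hb (eq h (Or.inl (Or.inl rfl)) h' (Or.inl (Or.inr ⟨b, hb, hbA, rfl⟩)))
  · rintro ⟨h, b, hb, hbA, h'⟩
    exact near_far hb (eq h (Or.inl (Or.inl rfl)) h' (Or.inr (Or.inr ⟨b, hb, hbA, rfl⟩)))
  · rintro ⟨h, b, hb, hbA, h'⟩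
    exact near_far hb (eq h (Or.inr (Or.inl rfl)) h' (Or.inl (Or.inr ⟨b, hb, hbA, rfl⟩)))
  · rintro ⟨h, b, hb, hbA, h'⟩
    exact near_far hb (eq h (Or.inr (Or.inl rfl)) h' (Or.inr (Or.inr ⟨b, hb, hbA, rfl⟩)))
  · rintro ⟨⟨c, hc, hcA, h⟩, b, hb, hbA, h'⟩
    rcases hT.edge_eq_iff.1 (eq h (Or.inl (Or.inr ⟨c, hc, hcA, rfl⟩)) h'
      (Or.inr (Or.inr ⟨b, hb, hbA, rfl⟩))) with h | h
    · obtain ⟨h1, h2⟩ := Prod.mk.inj h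
      have h3 : c = b := Prod.ext h1 (Side.reflect_injective h2)
      subst h3
      exact Side.cofoot_ne p (Prod.mk.inj (hT.unique hc.symm hb.symm)).2.symm
    · exact hT.reflect hc.symm h

theorem IsStrip.exactly_one_apex (hT : T.IsStrip) {A : Set ℕ} (hA : T.IsConvex A)
    {P : Set T.Edge} (hP : IsPerfectMatching (T.subgraph (T.edgesOf A)) P) {i : ℕ} (hi : i ∈ A)
    (p : Side) (h₁ : ∀ b, T.Glue (i, p) b → b.1 ∉ A)
    (h₂ : ∀ b, T.Glue (i, p.reflect) b → b.1 ∉ A) :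
    T.edge (i, p) ∈ P ↔ T.edge (i, p.reflect) ∉ P := by
  obtain ⟨e, he, hu⟩ := ((hT.isPerfectMatching_iff hA).1 hP).2.2 i hi p h₁ h₂
  simp only [and_imp] at hu
  constructor
  · intro h h'
    have h'' := (hu _ h (Or.inl rfl)).trans (hu _ h' (Or.inr rfl)).symm
    rcases hT.edge_eq_iff.1 h'' with h | h
    · exact Side.reflect_ne p (Prod.mk.inj h).2.symm
    · exact hT.ne h rfl
  · intro h
    obtain ⟨heP, rfl | rfl⟩ := he
    · exact heP
    · exact absurd heP h

/-! ### Chains of tiles -/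

/-- The south and the north side are horizontal. -/
def _root_.SnakeCalculus.Side.IsHorizontal (x : Side) : Prop := x = .south ∨ x = .north

/-- The horizontal sides of the tiles in `o` and the vertical sides of all other tiles form a
selection. -/
theorem isSelection_horizontal (o : ℕ → Prop) :
    IsSelection fun a => (a.2.IsHorizontal ↔ o a.1) := by
  constructor <;> intro i x <;> cases x <;>
    simp [Side.IsHorizontal, Side.reflect, Side.cofoot]

/-- The tiles of `T` are `τ 1, …, τ n`, and the glueings are those of the side `out k` of the tile
`τ k` with the side `inn (k + 1)` of `τ (k + 1)`. One of the sides `inn k` and `out k` is a south or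
west side, and the other one is a north or east side. -/
structure IsChain (T : TileComplex) (n : ℕ) (τ : ℕ → ℕ) (inn out : ℕ → Side) : Prop where
  tiles_eq : T.tiles = τ '' Ioc 0 n
  inj : ∀ {k l}, 1 ≤ k → k ≤ n → 1 ≤ l → l ≤ n → τ k = τ l → k = l
  level_ne : ∀ {k}, 1 ≤ k → k ≤ n → (out k).level ≠ (inn k).level
  glue_iff : ∀ {a b}, T.Glue a b ↔ ∃ k, 1 ≤ k ∧ k < n ∧
    ((a = (τ k, out k) ∧ b = (τ (k + 1), inn (k + 1))) ∨
      (b = (τ k, out k) ∧ a = (τ (k + 1), inn (k + 1))))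

namespace IsChain

variable {n : ℕ} {τ : ℕ → ℕ} {inn out : ℕ → Side}

theorem glue (hC : T.IsChain n τ inn out) {k : ℕ} (h₁ : 1 ≤ k) (h₂ : k < n) :
    T.Glue (τ k, out k) (τ (k + 1), inn (k + 1)) :=
  hC.glue_iff.2 ⟨k, h₁, h₂, Or.inl ⟨rfl, rfl⟩⟩

/-- The glueings of the `k`-th tile. -/
theorem glue_tile_iff (hC : T.IsChain n τ inn out) {k : ℕ} (h₁ : 1 ≤ k) (h₂ : k ≤ n) {z : Side}
    {b : ℕ × Side} :
    T.Glue (τ k, z) b ↔ (k < n ∧ z = out k ∧ b = (τ (k + 1), inn (k + 1))) ∨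
      (1 < k ∧ z = inn k ∧ b = (τ (k - 1), out (k - 1))) := by
  rw [hC.glue_iff]
  constructor
  · rintro ⟨l, hl₁, hl₂, ⟨ha, rfl⟩ | ⟨rfl, ha⟩⟩
    · simp only [Prod.mk.injEq] at ha
      obtain rfl := hC.inj h₁ h₂ hl₁ hl₂.le ha.1
      exact Or.inl ⟨hl₂, ha.2, rfl⟩
    · simp only [Prod.mk.injEq] at ha
      obtain rfl := hC.inj h₁ h₂ (by omega) hl₂ ha.1
      exact Or.inr ⟨by omega, ha.2, by simp⟩
  · rintro (⟨h, rfl, rfl⟩ | ⟨h, rfl, rfl⟩)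
    · exact ⟨k, h₁, h, Or.inl ⟨rfl, rfl⟩⟩
    · exact ⟨k - 1, by omega, by omega, Or.inr ⟨rfl, by rw [Nat.sub_add_cancel h₁]⟩⟩

theorem exists_of_glue (hC : T.IsChain n τ inn out) {i : ℕ} {x : Side} {b : ℕ × Side}
    (h : T.Glue (i, x) b) : ∃ k, 1 ≤ k ∧ k ≤ n ∧ i = τ k := by
  obtain ⟨l, hl₁, hl₂, ⟨ha, rfl⟩ | ⟨rfl, ha⟩⟩ := hC.glue_iff.1 h
  · exact ⟨l, hl₁, hl₂.le, (Prod.mk.inj ha).1⟩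
  · exact ⟨l + 1, by omega, hl₂, (Prod.mk.inj ha).1⟩

theorem isStrip (hC : T.IsChain n τ inn out) : T.IsStrip := by
  refine ⟨?_, ?_, ?_⟩
  · rintro ⟨i, x⟩ b c hb hc
    obtain ⟨k, h₁, h₂, rfl⟩ := hC.exists_of_glue hb
    rw [hC.glue_tile_iff h₁ h₂] at hb hc
    have := hC.level_ne h₁ h₂
    rcases hb with ⟨-, rfl, rfl⟩ | ⟨-, rfl, rfl⟩ <;> rcases hc with ⟨-, h, rfl⟩ | ⟨-, h, rfl⟩
    · rfl
    · exact absurd (by rw [h]) this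
    · exact absurd (by rw [h]) this
    · rfl
  · rintro ⟨i, x⟩ b c hb hc
    obtain ⟨k, h₁, h₂, rfl⟩ := hC.exists_of_glue hb
    simp only at hc
    rw [hC.glue_tile_iff h₁ h₂] at hb hc
    have := hC.level_ne h₁ h₂
    rcases hb with ⟨-, rfl, rfl⟩ | ⟨-, rfl, rfl⟩ <;> rcases hc with ⟨-, h, rfl⟩ | ⟨-, h, rfl⟩
    · exact Side.reflect_ne _ h
    · exact this (by rw [← h, Side.level_reflect])
    · exact this (by rw [← h, Side.level_reflect])
    · exact Side.reflect_ne _ h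
  · rintro ⟨i, x⟩ b hb
    obtain ⟨k, h₁, h₂, rfl⟩ := hC.exists_of_glue hb
    rw [hC.glue_tile_iff h₁ h₂] at hb
    rcases hb with ⟨h, -, rfl⟩ | ⟨h, -, rfl⟩ <;> intro h'
    · have := hC.inj h₁ h₂ (by omega) h h'
      omega
    · have := hC.inj h₁ h₂ (by omega) (by omega) h'
      omega

theorem mem_image_iff (hC : T.IsChain n τ inn out) {a b k : ℕ} (hb : b ≤ n) (h₁ : 1 ≤ k)
    (h₂ : k ≤ n) : τ k ∈ τ '' Ioc a b ↔ a < k ∧ k ≤ b := by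
  constructor
  · rintro ⟨l, hl, h⟩
    obtain rfl := hC.inj (by have := hl.1; omega) (hl.2.trans hb) h₁ h₂ h
    exact hl
  · exact fun h => ⟨k, h, rfl⟩

theorem isConvex (hC : T.IsChain n τ inn out) {a b : ℕ} (hb : b ≤ n) :
    T.IsConvex (τ '' Ioc a b) := by
  intro j hj x y c d hc hd hcA hdA
  obtain ⟨k, h₁, h₂, rfl⟩ := hC.exists_of_glue hc
  rw [hC.glue_tile_iff h₁ h₂] at hc hd
  rw [hC.mem_image_iff hb h₁ h₂] at hj
  rcases hc with ⟨h, -, rfl⟩ | ⟨h, -, rfl⟩ <;> rcases hd with ⟨h', -, rfl⟩ | ⟨h', -, rfl⟩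
  · rfl
  · simp only at hcA hdA
    rw [hC.mem_image_iff hb (by omega) (by omega)] at hcA hdA
    omega
  · simp only at hcA hdA
    rw [hC.mem_image_iff hb (by omega) (by omega)] at hcA hdA
    omega
  · rfl

theorem not_glue_inn (hC : T.IsChain n τ inn out) {k : ℕ} (h₁ : 1 ≤ k) (h₂ : k ≤ n)
    {b : ℕ × Side} : ¬ T.Glue (τ k, (inn k).reflect) b := by
  rw [hC.glue_tile_iff h₁ h₂]
  rintro (⟨-, h, -⟩ | ⟨-, h, -⟩)
  · exact hC.level_ne h₁ h₂ (by rw [← h, Side.level_reflect])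
  · exact Side.reflect_ne _ h

theorem not_glue_out (hC : T.IsChain n τ inn out) {k : ℕ} (h₁ : 1 ≤ k) (h₂ : k ≤ n)
    {b : ℕ × Side} : ¬ T.Glue (τ k, (out k).reflect) b := by
  rw [hC.glue_tile_iff h₁ h₂]
  rintro (⟨-, h, -⟩ | ⟨-, h, -⟩)
  · exact Side.reflect_ne _ h
  · exact hC.level_ne h₁ h₂ (by rw [← h, Side.level_reflect])

theorem not_glue_inn_first (hC : T.IsChain n τ inn out) {a b k : ℕ} (hb : b ≤ n) (ha : a + 1 = k)
    (hk : k ≤ b) {c : ℕ × Side} (hc : T.Glue (τ k, inn k) c) : c.1 ∉ τ '' Ioc a b := by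
  rcases (hC.glue_tile_iff (by omega) (by omega)).1 hc with ⟨-, h', -⟩ | ⟨h1, -, rfl⟩
  · exact absurd (by rw [h']) (hC.level_ne (k := k) (by omega) (by omega))
  · simp only
    rw [hC.mem_image_iff hb (by omega) (by omega)]
    omega

theorem not_glue_out_last (hC : T.IsChain n τ inn out) {a k : ℕ} (hk : 1 ≤ k) (hb : k ≤ n)
    {c : ℕ × Side} (hc : T.Glue (τ k, out k) c) : c.1 ∉ τ '' Ioc a k := by
  rcases (hC.glue_tile_iff hk hb).1 hc with ⟨h1, -, rfl⟩ | ⟨-, h', -⟩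
  · simp only
    rw [hC.mem_image_iff hb (by omega) (by omega)]
    omega
  · exact absurd (by rw [h']) (hC.level_ne (k := k) (by omega) (by omega))

theorem beyond_inn (hC : T.IsChain n τ inn out) {a b k : ℕ} {P : Set T.Edge} (hb : b ≤ n)
    (ha : a + 1 < k) (hk : k ≤ b) :
    T.edge (τ (k - 1), (out (k - 1)).reflect) ∈ P ↔
      ∃ c, T.Glue (τ k, inn k) c ∧ c.1 ∈ τ '' Ioc a b ∧ T.edge (c.1, c.2.reflect) ∈ P := by
  have hl := hC.level_ne (k := k) (by omega) (by omega)
  constructor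
  · intro h
    refine ⟨_, (hC.glue_tile_iff (by omega) (by omega)).2 (Or.inr ⟨by omega, rfl, rfl⟩), ?_, h⟩
    exact ⟨k - 1, ⟨by omega, by omega⟩, rfl⟩
  · rintro ⟨c, hc, -, h⟩
    rcases (hC.glue_tile_iff (by omega) (by omega)).1 hc with ⟨-, h', -⟩ | ⟨-, -, rfl⟩
    · exact absurd (by rw [h']) hl
    · exact h

theorem beyond_inn_first (hC : T.IsChain n τ inn out) {a b k : ℕ} {P : Set T.Edge} (hb : b ≤ n)
    (ha : a + 1 = k) (hk : k ≤ b) :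
    False ↔
      ∃ c, T.Glue (τ k, inn k) c ∧ c.1 ∈ τ '' Ioc a b ∧ T.edge (c.1, c.2.reflect) ∈ P := by
  rw [false_iff]
  rintro ⟨c, hc, hcA, -⟩
  exact hC.not_glue_inn_first hb ha hk hc hcA

theorem beyond_out (hC : T.IsChain n τ inn out) {a b k : ℕ} {P : Set T.Edge} (hb : b ≤ n)
    (ha : a < k) (hk : k < b) :
    T.edge (τ (k + 1), (inn (k + 1)).reflect) ∈ P ↔
      ∃ c, T.Glue (τ k, out k) c ∧ c.1 ∈ τ '' Ioc a b ∧ T.edge (c.1, c.2.reflect) ∈ P := by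
  have hl := hC.level_ne (k := k) (by omega) (by omega)
  constructor
  · intro h
    refine ⟨_, (hC.glue_tile_iff (by omega) (by omega)).2 (Or.inl ⟨by omega, rfl, rfl⟩), ?_, h⟩
    exact ⟨k + 1, ⟨by omega, by omega⟩, rfl⟩
  · rintro ⟨c, hc, -, h⟩
    rcases (hC.glue_tile_iff (by omega) (by omega)).1 hc with ⟨-, -, rfl⟩ | ⟨-, h', -⟩
    · exact h
    · exact absurd (by rw [h']) hl

theorem beyond_boundary (hC : T.IsChain n τ inn out) {A : Set ℕ} {k : ℕ} {z : Side}
    {P : Set T.Edge} (h₁ : 1 ≤ k) (h₂ : k ≤ n) (hz : z = (inn k).reflect ∨ z = (out k).reflect) :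
    False ↔ ∃ c, T.Glue (τ k, z) c ∧ c.1 ∈ A ∧ T.edge (c.1, c.2.reflect) ∈ P := by
  rw [false_iff]
  rintro ⟨c, hc, -, -⟩
  rcases hz with rfl | rfl
  · exact hC.not_glue_inn h₁ h₂ hc
  · exact hC.not_glue_out h₁ h₂ hc

/-- Every perfect matching of a segment of a chain comes from an admissible selection. The
selection on a tile is read off from the side next to `inn k`, and it is compared with the matching
by induction along the chain. -/
theorem exists_selection (hC : T.IsChain n τ inn out) {a b : ℕ} (hb : b ≤ n) {P : Set T.Edge}
    (hP : IsPerfectMatching (T.subgraph (T.edgesOf (τ '' Ioc a b))) P) :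
    ∃ σ, IsSelection σ ∧ T.Admissible (τ '' Ioc a b) σ ∧ P = T.matching (τ '' Ioc a b) σ := by
  have hT := hC.isStrip
  have hA := hC.isConvex (a := a) hb
  have mem {k : ℕ} (h : a < k) (h' : k ≤ b) : τ k ∈ τ '' Ioc a b := ⟨k, ⟨h, h'⟩, rfl⟩
  obtain ⟨E, hE⟩ : ∃ E : ℕ → Side → Prop, ∀ k z, E k z ↔ T.edge (τ k, z) ∈ P :=
    ⟨fun k z => T.edge (τ k, z) ∈ P, fun _ _ => Iff.rfl⟩
  let o : ℕ → Prop := fun i => ∃ k, a < k ∧ k ≤ b ∧ τ k = i ∧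
    ((inn k).reflect.IsHorizontal ↔ E k (inn k).reflect)
  have ho {k : ℕ} (h : a < k) (h' : k ≤ b) : o (τ k) ↔
      ((inn k).reflect.IsHorizontal ↔ E k (inn k).reflect) := by
    constructor
    · rintro ⟨l, hl, hl', he, h''⟩
      obtain rfl := hC.inj (by omega) (by omega) (by omega) (by omega) he
      exact h''
    · exact fun h'' => ⟨k, h, h', rfl, h''⟩
  obtain ⟨σ, hσ⟩ : ∃ σ : ℕ × Side → Prop, σ = fun a => (a.2.IsHorizontal ↔ o a.1) := ⟨_, rfl⟩
  have hsel : IsSelection σ := hσ ▸ isSelection_horizontal o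
  have hm {k : ℕ} (h : a < k) (h' : k ≤ b) : σ (τ k, (inn k).reflect) ↔ E k (inn k).reflect := by
    simp only [hσ, ho h h']
    by_cases h₁ : (inn k).reflect.IsHorizontal <;> simp [h₁]
  clear_value o
  have hx {k : ℕ} : σ (τ k, inn k) ↔ ¬ σ (τ k, (inn k).reflect) := by
    rw [hsel.reflect, not_not]
  have hn {k : ℕ} : σ (τ k, (out k).reflect) ↔ ¬ σ (τ k, out k) := hsel.reflect _ _
  have hy {k : ℕ} (h : a < k) (h' : k ≤ b) :
      (out k = (inn k).cofoot ∧ (out k).reflect = (inn k).reflect.cofoot ∧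
        (σ (τ k, out k) ↔ ¬ σ (τ k, inn k))) ∨
      (out k = (inn k).reflect.cofoot ∧ (out k).reflect = (inn k).cofoot ∧
        (σ (τ k, out k) ↔ σ (τ k, inn k))) := by
    rcases Side.eq_cofoot_or_of_level_ne (hC.level_ne (k := k) (by omega) (by omega)) with h | h
    · left
      rw [h]
      exact ⟨rfl, Side.reflect_cofoot _, hsel.cofoot _ _⟩
    · right
      rw [h]
      exact ⟨rfl, by rw [Side.reflect_cofoot, Side.reflect_reflect],
        by rw [hsel.cofoot, hsel.reflect, not_not]⟩
  have main : ∀ k, a < k → k ≤ b → (E k (out k).reflect ↔ σ (τ k, (out k).reflect)) ∧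
      (a + 1 = k → (E k (inn k) ↔ σ (τ k, inn k))) ∧
      (a + 1 < k → (σ (τ (k - 1), out (k - 1)) ∨ σ (τ k, inn k)) ∧
        (E k (inn k) ↔ σ (τ (k - 1), out (k - 1)) ∧ σ (τ k, inn k)) ∧
        (E (k - 1) (out (k - 1)).reflect ↔ σ (τ (k - 1), (out (k - 1)).reflect))) := by
    intro k hk
    induction k, hk using Nat.le_induction with
    | base =>
      intro hkb
      have hk₁ : 1 ≤ a + 1 := by omega
      have hap := hT.exactly_one_apex hA hP (mem (k := a + 1) (by omega) hkb) (inn (a + 1))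
        (fun c hc => hC.not_glue_inn_first hb rfl hkb hc)
        (fun c hc => absurd hc (hC.not_glue_inn hk₁ (by omega)))
      rw [← hE, ← hE] at hap
      have hm' := hm (k := a + 1) (by omega) hkb
      rcases hy (k := a + 1) (by omega) hkb with ⟨h1, h2, h3⟩ | ⟨h1, h2, h3⟩
      · have hf := hT.exactly_one_foot hA hP (mem (k := a + 1) (by omega) hkb) (inn (a + 1)).reflect
          (hE _ _) (hE _ _) (hC.beyond_boundary hk₁ (by omega) (Or.inl rfl))
          (hC.beyond_boundary hk₁ (by omega) (Or.inr h2.symm))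
        rw [← h2] at hf
        refine ⟨?_, fun _ => ?_, fun h => absurd h (by omega)⟩
        · rw [hn, h3, hx]; clear * - hap hf hm'; grind
        · rw [hx]; clear * - hap hf hm'; grind
      · have hf := hT.exactly_one_foot hA hP (mem (k := a + 1) (by omega) hkb) (inn (a + 1))
          (hE _ _) (hE _ _) (hC.beyond_inn_first hb rfl hkb)
          (hC.beyond_boundary hk₁ (by omega) (Or.inr h2.symm))
        rw [← h2] at hf
        refine ⟨?_, fun _ => ?_, fun h => absurd h (by omega)⟩
        · rw [hn, h3, hx]; clear * - hap hf hm'; grind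
        · rw [hx]; clear * - hap hf hm'; grind
    | succ k hk ih =>
      intro hkb
      obtain ⟨ihn, ih₁, ih₂⟩ := ih (by omega)
      have hk₁ : 1 ≤ k := by omega
      have hak : a < k := hk
      have he : E (k + 1) (inn (k + 1)) ↔ E k (out k) := by
        rw [hE, hE, edge_eq_of_glue (hC.glue hk₁ (by omega))]
      have hm' := hm (k := k + 1) (by omega) hkb
      -- the edges at the vertex `(out k).foot`
      have hv : (σ (τ k, out k) ∨ σ (τ (k + 1), inn (k + 1))) ∧
          (E k (out k) ↔ σ (τ k, out k) ∧ σ (τ (k + 1), inn (k + 1))) := by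
        have hm'' := hm hak (by omega)
        have hfy := (hE (k + 1) (inn (k + 1)).reflect).trans (hC.beyond_out (P := P) hb hak hkb)
        rw [hx (k := k + 1)]
        rcases hy hak (by omega) with ⟨h1, h2, h3⟩ | ⟨h1, h2, h3⟩
        · have hco : (out k).cofoot = inn k := by rw [h1, Side.cofoot_cofoot]
          rw [h3, hx]
          rcases Nat.eq_or_lt_of_le hk with h | h
          · have hf := hT.exactly_one_foot hA hP (mem hak (by omega)) (out k)
              (X' := False) (hE _ _) (hE _ _) hfy
              (by rw [hco]; exact hC.beyond_inn_first hb h (by omega))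
            rw [hco] at hf
            have := ih₁ h
            rw [hx] at this
            clear * - this hf hm' hm''
            grind
          · have hf := hT.exactly_one_foot hA hP (mem hak (by omega)) (out k)
              (X' := E (k - 1) (out (k - 1)).reflect) (hE _ _) (hE _ _) hfy
              (by rw [hco]; exact (hE _ _).trans (hC.beyond_inn hb h (by omega)))
            rw [hco] at hf
            obtain ⟨h4, h5, h6⟩ := ih₂ h
            rw [hn] at h6
            rw [hx] at h4 h5
            clear * - h4 h5 h6 hf hm' hm'' ihn
            grind
        · have hco : (out k).cofoot = (inn k).reflect := by rw [h1, Side.cofoot_cofoot]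
          have hf := hT.exactly_one_foot hA hP (mem hak (by omega)) (out k)
              (X' := False) (hE _ _) (hE _ _) hfy
              (by rw [hco]; exact hC.beyond_boundary hk₁ (by omega) (Or.inl rfl))
          rw [hco] at hf
          rw [h3, hx]
          clear * - hf hm' hm''
          grind
      refine ⟨?_, fun h => absurd h (by omega), fun _ => ⟨hv.1, he.trans hv.2, ihn⟩⟩
      rcases hy (k := k + 1) (by omega) hkb with ⟨h1, h2, h3⟩ | ⟨h1, h2, h3⟩
      · have hf := hT.exactly_one_foot hA hP (mem (k := k + 1) (by omega) hkb) (inn (k + 1)).reflect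
          (hE _ _) (hE _ _) (hC.beyond_boundary (by omega) (by omega) (Or.inl rfl))
          (hC.beyond_boundary (by omega) (by omega) (Or.inr h2.symm))
        rw [← h2] at hf
        rw [hn, h3, hx]
        clear * - hf hm'
        grind
      · have hf := hT.exactly_one_foot hA hP (mem (k := k + 1) (by omega) hkb) (inn (k + 1))
          (hE _ _) (hE _ _) ((hE _ _).trans (hC.beyond_inn (P := P) hb (by omega) hkb))
          (hC.beyond_boundary (by omega) (by omega) (Or.inr h2.symm))
        rw [← h2] at hf
        simp only [Nat.add_sub_cancel] at hf
        rw [hn] at ihn ⊢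
        rw [h3, hx]
        rw [hx (k := k + 1)] at hv
        clear * - hf hm' hv ihn he
        grind
  have hadm : T.Admissible (τ '' Ioc a b) σ := by
    rintro c d hcd hc hd
    obtain ⟨k, h₁, h₂, ⟨rfl, rfl⟩ | ⟨rfl, rfl⟩⟩ := hC.glue_iff.1 hcd <;>
    · simp only [hC.mem_image_iff hb h₁ h₂.le,
        hC.mem_image_iff hb (by omega : 1 ≤ k + 1) h₂] at hc hd
      have := ((main (k + 1) (by omega) (by omega)).2.2 (by omega)).1
      simp only [Nat.add_sub_cancel] at this
      tauto
  refine ⟨σ, hsel, hadm, ?_⟩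
  have hsub := ((hT.isPerfectMatching_iff hA).1 hP).1
  have key : ∀ k, a < k → k ≤ b → ∀ z, T.edge (τ k, z) ∈ P ↔
      T.edge (τ k, z) ∈ T.matching (τ '' Ioc a b) σ := by
    intro k hk hkb
    have key_inn : T.edge (τ k, inn k) ∈ P ↔
        T.edge (τ k, inn k) ∈ T.matching (τ '' Ioc a b) σ := by
      obtain ⟨-, h₁, h₂⟩ := main k hk hkb
      rw [← hE]
      rcases Nat.eq_or_lt_of_le (Nat.succ_le_of_lt hk) with h | h
      · rw [hT.mem_matching (mem hk hkb)]
        exact (h₁ h).trans ⟨fun h' => ⟨h', fun c hc hcA =>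
          absurd hcA (hC.not_glue_inn_first hb h hkb hc)⟩, fun h => h.1⟩
      · have hg : T.Glue (τ k, inn k) (τ (k - 1), out (k - 1)) :=
          (hC.glue_tile_iff (by omega) (by omega)).2 (Or.inr ⟨by omega, rfl, rfl⟩)
        rw [hT.mem_matching_of_glue (mem hk hkb) hg (mem (by omega) (by omega))]
        exact (h₂ h).2.1.trans and_comm
    intro z
    by_cases hz : z.level = (inn k).level
    · rcases Side.eq_or_eq_reflect_of_level hz with rfl | rfl
      · exact key_inn
      · rw [hT.mem_matching_of_not_glue (mem hk hkb) fun c => hC.not_glue_inn (by omega) (by omega)]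
        rw [hm hk hkb, hE]
    · have hz' : z.level = (out k).level := by
        have := hC.level_ne (k := k) (by omega) (by omega)
        revert hz this
        generalize inn k = x
        generalize out k = y
        cases x <;> cases y <;> cases z <;> decide
      have hN := (main k hk hkb).1
      rcases Side.eq_or_eq_reflect_of_level hz' with rfl | rfl
      · rcases Nat.eq_or_lt_of_le hkb with rfl | h
        · have hno : ∀ c, T.Glue (τ k, out k) c → c.1 ∉ τ '' Ioc a k :=
            fun c hc => hC.not_glue_out_last (by omega) hb hc
          have hap := hT.exactly_one_apex hA hP (mem hk hkb) (out k) hno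
            (fun c hc => absurd hc (hC.not_glue_out (by omega) (by omega)))
          rw [hT.mem_matching (mem hk hkb), hap, ← hE]
          rw [hn] at hN
          rw [hN, not_not]
          exact ⟨fun h => ⟨h, fun c hc hcA => absurd hcA (hno c hc)⟩, fun h => h.1⟩
        · have hg := hC.glue (k := k) (by omega) (by omega)
          obtain ⟨-, h5, -⟩ := (main (k + 1) (by omega) h).2.2 (by omega)
          rw [hT.mem_matching_of_glue (mem hk hkb) hg (mem (by omega) h), edge_eq_of_glue hg, ← hE]
          exact h5
      · rw [hT.mem_matching_of_not_glue (mem hk hkb) fun c => hC.not_glue_out (by omega) (by omega)]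
        rw [← hE]
        exact hN
  ext e
  constructor
  · intro he
    obtain ⟨_, ⟨k, hk, rfl⟩, z, rfl⟩ := hsub he
    exact (key k hk.1 hk.2 z).1 he
  · intro he
    obtain ⟨_, ⟨k, hk, rfl⟩, z, rfl⟩ := he.1
    exact (key k hk.1 hk.2 z).2 he

end IsChain

end TileComplex

/-! ### The snake graphs and the band graph of the resolution -/

namespace TileComplex

variable {T : TileComplex}

/-- The perfect matchings of a chain are the matchings given by its admissible selections. -/
theorem IsChain.isPerfectMatching_iff {n : ℕ} {τ : ℕ → ℕ} {inn out : ℕ → Side}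
    (hC : T.IsChain n τ inn out) {P : Set T.Edge} :
    IsPerfectMatching T.graph P ↔
      ∃ σ, IsSelection σ ∧ T.Admissible T.tiles σ ∧ P = T.matching T.tiles σ := by
  rw [graph, hC.tiles_eq]
  refine ⟨hC.exists_selection le_rfl, ?_⟩
  rintro ⟨σ, h₁, h₂, rfl⟩
  exact hC.isStrip.isPerfectMatching_matching (hC.isConvex le_rfl) h₁ h₂

end TileComplex

namespace SnakeGraph

variable (G : SnakeGraph)

@[simp] theorem level_outSide (i : ℕ) : (G.outSide i).level = 1 := by
  unfold outSide; cases G.step i <;> rfl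

@[simp] theorem level_inSide (i : ℕ) : (G.inSide i).level = 0 := by
  unfold inSide; cases G.step i <;> rfl

theorem outSide_eq (i : ℕ) : G.outSide i = (G.inSide i).reflect.cofoot := by
  unfold outSide inSide; cases G.step i <;> rfl

theorem complex_glued {a b : ℕ × Side} : G.complex.glued a b ↔
    ∃ i, 1 ≤ i ∧ i < G.d ∧ a = (i, G.outSide i) ∧ b = (i + 1, G.inSide i) := Iff.rfl

theorem isChain : G.complex.IsChain G.d id (fun k => G.inSide (k - 1)) G.outSide where
  tiles_eq := by
    rw [image_id]
    ext i
    exact Iff.rfl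
  inj _ _ _ _ h := h
  level_ne _ _ := by simp
  glue_iff := by
    intro a b
    simp only [TileComplex.Glue, complex_glued, id_eq, Nat.add_sub_cancel]
    constructor
    · rintro (⟨i, h₁, h₂, h⟩ | ⟨i, h₁, h₂, h⟩)
      · exact ⟨i, h₁, h₂, Or.inl h⟩
      · exact ⟨i, h₁, h₂, Or.inr h⟩
    · rintro ⟨i, h₁, h₂, h | h⟩
      · exact Or.inl ⟨i, h₁, h₂, h⟩
      · exact Or.inr ⟨i, h₁, h₂, h⟩

theorem glue {i : ℕ} (h₁ : 1 ≤ i) (h₂ : i < G.d) :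
    G.complex.Glue (i, G.outSide i) (i + 1, G.inSide i) := Or.inl ⟨i, h₁, h₂, rfl, rfl⟩

theorem intEdge_eq {i : ℕ} (h₁ : 1 ≤ i) (h₂ : i < G.d) :
    G.intEdge i = G.edge (i + 1) (G.inSide i) := TileComplex.edge_eq_of_glue (G.glue h₁ h₂)

end SnakeGraph

namespace TileComplex.IsSignFunction

variable {T : TileComplex} {f : T.Edge → Bool} (hf : T.IsSignFunction f)

include hf

theorem reflect {i : ℕ} (hi : i ∈ T.tiles) (x : Side) :
    f (T.edge (i, x.reflect)) = !f (T.edge (i, x)) := by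
  obtain ⟨h₁, h₂, h₃⟩ := hf i hi
  cases x <;> simp only [Side.reflect] <;>
    revert h₁ h₂ h₃ <;> generalize f (T.edge (i, .north)) = n <;>
    generalize f (T.edge (i, .south)) = s <;> generalize f (T.edge (i, .west)) = w <;>
    generalize f (T.edge (i, .east)) = e <;> revert n s w e <;> decide

theorem cofoot {i : ℕ} (hi : i ∈ T.tiles) (x : Side) :
    f (T.edge (i, x.cofoot)) = f (T.edge (i, x)) := by
  obtain ⟨h₁, h₂, -⟩ := hf i hi
  cases x <;> simp only [Side.cofoot, h₁, h₂]

end TileComplex.IsSignFunction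

namespace SelfOverlap

variable {G : SnakeGraph} {f : G.Edge → Bool} (O : SelfOverlap G f)

@[simp] theorem ρ_ρ (x : Side) : O.ρ (O.ρ x) = x := by
  rcases O.ρ_eq with h | h <;> rw [h]
  · rfl
  · exact Side.reflect_reflect x

theorem ρ_reflect (x : Side) : O.ρ x.reflect = (O.ρ x).reflect := by
  rcases O.ρ_eq with h | h <;> rw [h]
  rfl

theorem ρ_cofoot (x : Side) : O.ρ x.cofoot = (O.ρ x).cofoot := by
  rcases O.ρ_eq with h | h <;> rw [h]
  · rfl
  · exact Side.reflect_cofoot x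

@[simp] theorem level_ρ (x : Side) : (O.ρ x).level = x.level := by
  rcases O.ρ_eq with h | h <;> rw [h]
  · rfl
  · exact Side.level_reflect x

theorem bounds : 1 ≤ O.s ∧ O.s ≤ O.t ∧ O.s < O.s' ∧ O.t' = O.t + (O.s' - O.s) ∧ O.t' ≤ G.d :=
  ⟨O.one_le_s, O.s_le_t, O.s_lt_s', O.t'_eq, O.t'_le_d⟩

/-- The south or west side of `G_s` that corresponds to the edge `e_{s'-1}`. -/
def startSide : Side := O.ρ (G.inSide (O.s' - 1))

@[simp] theorem level_startSide : O.startSide.level = 0 := by simp [startSide]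

@[simp] theorem ρ_startSide : O.ρ O.startSide = G.inSide (O.s' - 1) := O.ρ_ρ _

/-- The properties of a crossing self-overlap on which the resolution depends: the overlap does not
extend, and its two ends `e_{s'-1}` and `e_t` have the same sign. -/
structure Regular : Prop where
  sign : G.complex.IsSignFunction f
  lt : O.t + 1 < O.s'
  start : 1 < O.s → G.inSide (O.s - 1) = O.startSide.reflect
  finish : O.t' < G.d → O.ρ (G.outSide O.t') = (G.outSide O.t).reflect
  sign_start : f (G.edge O.s O.startSide) = f (G.edge O.t (G.outSide O.t))

variable {O}

/-- The two edges of a tile in which it meets its neighbours have different signs if and only if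
the three tiles lie in a straight line. -/
theorem sign_straight (hf : G.complex.IsSignFunction f) {i : ℕ} (h₁ : 1 < i) (h₂ : i < G.d) :
    G.step (i - 1) = G.step i ↔ f (G.intEdge (i - 1)) ≠ f (G.intEdge i) := by
  have hi : i ∈ G.complex.tiles := ⟨h₁.le, h₂.le⟩
  rw [G.intEdge_eq (by omega) (by omega), SnakeGraph.intEdge, Nat.sub_add_cancel h₁.le]
  have h1 := hf.cofoot hi (G.inSide (i - 1))
  have h2 := hf.reflect hi (G.inSide (i - 1))
  have h3 := hf.cofoot hi (G.inSide (i - 1)).reflect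
  simp only [SnakeGraph.edge]
  revert h1 h2 h3
  unfold SnakeGraph.outSide SnakeGraph.inSide
  cases G.step (i - 1) <;> cases G.step i <;> simp [Side.cofoot, Side.reflect] <;> grind

theorem regular (hf : G.complex.IsSignFunction f) (hcross : O.IsCrossing) (hst : O.t + 1 < O.s') :
    O.Regular := by
  obtain ⟨b₁, b₂, b₃, b₄, b₅⟩ := O.bounds
  have hs' : f (G.edge O.s O.startSide) = f (G.intEdge (O.s' - 1)) := by
    have h := O.sign_eq O.s le_rfl b₂ O.startSide
    rw [← h, ρ_startSide, G.intEdge_eq (by omega) (by omega), Nat.add_sub_cancel' b₃.le,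
      Nat.sub_add_cancel (by omega)]
  refine ⟨hf, hst, fun hs => ?_, fun ht => ?_, hs'.trans hcross.2.symm⟩
  · rcases Side.eq_or_eq_reflect_of_level (x := G.inSide (O.s - 1)) (y := O.startSide) (by simp)
      with h | h
    swap
    · exact h
    exfalso
    rcases Nat.eq_or_lt_of_le b₂ with hst' | hst'
    · have h1 : f (G.intEdge (O.s - 1)) = f (G.intEdge O.t) := by
        rw [G.intEdge_eq (by omega) (by omega), h, Nat.sub_add_cancel b₁, hs', hcross.2]
      have h2 : O.t' < G.d ∧ f (G.intEdge (O.s' - 1)) ≠ f (G.intEdge O.t') := by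
        rcases hcross.1 with h | h | h
        · omega
        · exact absurd h1 h.2
        · exact h
      have hts : O.t' = O.s' := by omega
      rcases O.maximal_single hst' with h3 | h3
      · omega
      · rw [sign_straight hf hs (by omega), sign_straight hf (by omega) (by omega), hst'] at h3
        rw [hts] at h2
        rw [hst'] at h1
        exact h3.2 h2.2 h1
    · have := O.maximal hst' (O.s - 1) O.t (by omega) (by omega) le_rfl (by omega) ?_
      · omega
      · intro i hi₁ hi₂
        rcases Nat.eq_or_lt_of_le hi₁ with rfl | hi₁
        · have h4 : O.s - 1 + (O.s' - O.s) = O.s' - 1 := by omega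
          rw [h4, G.outSide_eq, G.outSide_eq, O.ρ_cofoot, O.ρ_reflect, h, ρ_startSide]
        · exact O.isIso i (by omega) hi₂
  · rcases Side.eq_or_eq_reflect_of_level (x := O.ρ (G.outSide O.t')) (y := G.outSide O.t)
      (by simp) with h | h
    swap
    · exact h
    exfalso
    have h' : O.ρ (G.outSide O.t) = G.outSide O.t' := by rw [← h, O.ρ_ρ]
    rcases Nat.eq_or_lt_of_le b₂ with hst' | hst'
    · have h1 : f (G.intEdge O.t') = f (G.intEdge O.t) := by
        have := O.sign_eq O.t b₂ le_rfl (G.outSide O.t)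
        rw [h', ← b₄] at this
        exact this
      have h2 : 1 < O.s ∧ f (G.intEdge (O.s - 1)) ≠ f (G.intEdge O.t) := by
        rcases hcross.1 with h | h | h
        · omega
        · exact h
        · exact absurd (hcross.2.symm.trans h1.symm) h.2
      have hts : O.t' = O.s' := by omega
      rcases O.maximal_single hst' with h3 | h3
      · omega
      · rw [sign_straight hf h2.1 (by omega), sign_straight hf (by omega) (by omega), hst'] at h3
        rw [hst'] at h2
        rw [hts] at h1
        exact h3.1 h2.2 (hcross.2.symm.trans h1.symm)
    · have := O.maximal hst' O.s (O.t + 1) b₁ le_rfl (by omega) (by omega) ?_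
      · omega
      · intro i hi₁ hi₂
        rcases Nat.eq_or_lt_of_le (Nat.le_of_lt_succ hi₂) with rfl | hi₂
        · rw [h', b₄]
        · exact O.isIso i (by omega) hi₂

end SelfOverlap

namespace TileComplex

variable {T : TileComplex}

/-! ### Cutting and reglueing -/

theorem Glue.of_cut {a b x y : ℕ × Side} (h : (T.cut a b).Glue x y) : T.Glue x y :=
  h.imp And.left And.left

theorem glue_cut_or {a b x y : ℕ × Side} (h : T.Glue x y) :
    (T.cut a b).Glue x y ∨ (x = a ∧ y = b) ∨ (x = b ∧ y = a) := by
  rcases h with h | h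
  · by_cases h' : x = a ∧ y = b
    · exact Or.inr (Or.inl h')
    · exact Or.inl (Or.inl ⟨h, h'⟩)
  · by_cases h' : y = a ∧ x = b
    · exact Or.inr (Or.inr h'.symm)
    · exact Or.inl (Or.inr ⟨h, h'⟩)

theorem IsStrip.not_glue_cut (hT : T.IsStrip) {a b c y : ℕ × Side} (hab : T.glued a b)
    (hba : ¬ T.glued b a) (hc : c = a ∨ c = b) : ¬ (T.cut a b).Glue c y := by
  have hne : T.Glue a b := Or.inl hab
  rcases hc with rfl | rfl
  · intro h
    obtain rfl := hT.unique hne h.of_cut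
    rcases h with h | h
    · exact h.2 ⟨rfl, rfl⟩
    · exact hba h.1
  · intro h
    obtain rfl := hT.unique hne.symm h.of_cut
    rcases h with h | h
    · exact hba h.1
    · exact h.2 ⟨rfl, rfl⟩

/-- If one of the two copies `c` of the edge along which `T` has been cut is selected, then the
matching of `T` arises from that of the cut graph by removing `c` and reglueing. -/
theorem IsStrip.reglue_matching (hT : T.IsStrip) {a b c : ℕ × Side} (hab : T.glued a b)
    (hba : ¬ T.glued b a) (hcut : (T.cut a b).IsStrip) (hmem : a.1 ∈ T.tiles ∧ b.1 ∈ T.tiles)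
    (hc : c = a ∨ c = b) {σ : ℕ × Side → Prop} (hσ : σ c) :
    T.reglue a b '' ((T.cut a b).matching T.tiles σ \ {(T.cut a b).edge c}) =
      T.matching T.tiles σ := by
  ext e
  constructor
  · rintro ⟨_, ⟨h, hne⟩, rfl⟩
    obtain ⟨⟨i, hi, x, rfl⟩, -⟩ := id h
    change T.edge (i, x) ∈ _
    rw [hcut.mem_matching hi] at h
    rw [hT.mem_matching hi]
    refine ⟨h.1, fun y hy hyA => ?_⟩
    rcases glue_cut_or (a := a) (b := b) hy with h' | h' | h'
    · exact h.2 y h' hyA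
    · rcases hc with rfl | rfl
      · exact absurd (by rw [h'.1]; rfl) hne
      · rw [h'.2]; exact hσ
    · rcases hc with rfl | rfl
      · rw [h'.2]; exact hσ
      · exact absurd (by rw [h'.1]; rfl) hne
  · intro h
    obtain ⟨⟨i, hi, x, rfl⟩, -⟩ := id h
    by_cases hec : T.edge (i, x) = T.edge c
    · obtain ⟨c', hc', hg, hcA, hcA'⟩ : ∃ c', (c' = a ∨ c' = b) ∧ T.Glue c c' ∧ c.1 ∈ T.tiles ∧
          c'.1 ∈ T.tiles := by
        rcases hc with rfl | rfl
        · exact ⟨b, Or.inr rfl, Or.inl hab, hmem⟩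
        · exact ⟨a, Or.inl rfl, Or.inr hab, hmem.symm⟩
      rw [hec] at h ⊢
      obtain ⟨j, z⟩ := c
      rw [hT.mem_matching hcA] at h
      obtain ⟨j', z'⟩ := c'
      refine ⟨(T.cut a b).edge (j', z'), ⟨?_, ?_⟩, (edge_eq_of_glue hg).symm⟩
      · rw [hcut.mem_matching hcA']
        exact ⟨h.2 _ hg hcA', fun y hy => absurd hy (hT.not_glue_cut hab hba hc')⟩
      · rw [mem_singleton_iff, hcut.edge_eq_iff]
        rintro (h' | h')
        · exact hT.ne hg (Prod.mk.inj h').1.symm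
        · exact hT.not_glue_cut hab hba hc' h'
    · refine ⟨(T.cut a b).edge (i, x), ⟨?_, fun h' => hec ?_⟩, rfl⟩
      · rw [hT.mem_matching hi] at h
        rw [hcut.mem_matching hi]
        exact ⟨h.1, fun y hy => h.2 y hy.of_cut⟩
      · exact congrArg (T.reglue a b) (mem_singleton_iff.1 h')

end TileComplex

namespace SelfOverlap

variable {G : SnakeGraph} {f : G.Edge → Bool} {O : SelfOverlap G f}

/-! ### The snake graph `G₃` -/

theorem mem_tiles3 {i : ℕ} :
    i ∈ O.G3.tiles ↔ (1 ≤ i ∧ i ≤ O.t) ∨ (O.t' < i ∧ i ≤ G.d) := by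
  obtain ⟨b₁, b₂, b₃, b₄, b₅⟩ := O.bounds
  simp only [G3, outer, overlap, mem_union, mem_Icc]
  omega

theorem G3_glued (hR : O.Regular) {a b : ℕ × Side} : O.G3.glued a b ↔
    (∃ i, 1 ≤ i ∧ (i < O.t ∨ (O.t' < i ∧ i < G.d)) ∧ a = (i, G.outSide i) ∧
      b = (i + 1, G.inSide i)) ∨
    (O.t' < G.d ∧ a = (O.t, O.ρ (G.outSide O.t')) ∧ b = (O.t' + 1, G.inSide O.t')) := by
  obtain ⟨b₁, b₂, b₃, b₄, b₅⟩ := O.bounds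
  have hlt := hR.lt
  refine or_congr_left ⟨?_, ?_⟩
  · rintro ⟨⟨i, h₁, h₂, rfl, rfl⟩, ha, hb⟩
    simp only [outer, overlap, mem_union, mem_Icc] at ha hb
    exact ⟨i, h₁, by omega, rfl, rfl⟩
  · rintro ⟨i, h₁, h₂, rfl, rfl⟩
    simp only [SnakeGraph.gluedIn, outer, overlap, mem_union, mem_Icc]
    exact ⟨⟨i, h₁, by omega, rfl, rfl⟩, by omega, by omega⟩

theorem isChain3 (hR : O.Regular) : O.G3.IsChain (O.t + (G.d - O.t'))
    (fun k => if k ≤ O.t then k else k + (O.t' - O.t))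
    (fun k => G.inSide ((if k ≤ O.t then k else k + (O.t' - O.t)) - 1))
    (fun k => if k = O.t then O.ρ (G.outSide O.t')
      else G.outSide (if k ≤ O.t then k else k + (O.t' - O.t))) where
  tiles_eq := by
    obtain ⟨b₁, b₂, b₃, b₄, b₅⟩ := O.bounds
    ext i
    rw [mem_tiles3, mem_image]
    constructor
    · rintro (h | h)
      · exact ⟨i, ⟨by omega, by omega⟩, if_pos h.2⟩
      · exact ⟨i - (O.t' - O.t), ⟨by omega, by omega⟩, by rw [if_neg (by omega)]; omega⟩
    · rintro ⟨k, ⟨h₁, h₂⟩, rfl⟩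
      split_ifs <;> omega
  inj := by
    intro k l _ _ _ _ h
    have := O.t'_eq
    split_ifs at h <;> omega
  level_ne := by
    intro k _ _
    simp only [SnakeGraph.level_inSide]
    split_ifs <;> simp
  glue_iff := by
    obtain ⟨b₁, b₂, b₃, b₄, b₅⟩ := O.bounds
    have key : ∀ a b, O.G3.glued a b ↔ ∃ k, 1 ≤ k ∧ k < O.t + (G.d - O.t') ∧
        a = (if k ≤ O.t then k else k + (O.t' - O.t), if k = O.t then O.ρ (G.outSide O.t')
          else G.outSide (if k ≤ O.t then k else k + (O.t' - O.t))) ∧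
        b = (if k + 1 ≤ O.t then k + 1 else k + 1 + (O.t' - O.t),
          G.inSide ((if k + 1 ≤ O.t then k + 1 else k + 1 + (O.t' - O.t)) - 1)) := by
      intro a b
      rw [G3_glued hR]
      constructor
      · rintro (⟨i, h₁, h₂ | h₂, rfl, rfl⟩ | ⟨h, rfl, rfl⟩)
        · refine ⟨i, h₁, by omega, ?_, ?_⟩
          · rw [if_pos (by omega), if_neg (by omega)]
          · rw [if_pos (by omega), Nat.add_sub_cancel]
        · refine ⟨i - (O.t' - O.t), by omega, by omega, ?_, ?_⟩
          · rw [if_neg (by omega), if_neg (by omega), Nat.sub_add_cancel (by omega)]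
          · rw [if_neg (by omega),
              show i - (O.t' - O.t) + 1 + (O.t' - O.t) = i + 1 by omega, Nat.add_sub_cancel]
        · refine ⟨O.t, by omega, by omega, ?_, ?_⟩
          · rw [if_pos le_rfl, if_pos rfl]
          · rw [if_neg (by omega), show O.t + 1 + (O.t' - O.t) = O.t' + 1 by omega,
              Nat.add_sub_cancel]
      · rintro ⟨k, h₁, h₂, rfl, rfl⟩
        rcases lt_trichotomy k O.t with h | rfl | h
        · left
          refine ⟨k, h₁, Or.inl h, ?_, ?_⟩
          · rw [if_pos (by omega), if_neg (by omega)]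
          · rw [if_pos (by omega), Nat.add_sub_cancel]
        · right
          refine ⟨by omega, ?_, ?_⟩
          · rw [if_pos le_rfl, if_pos rfl]
          · rw [if_neg (by omega), show O.t + 1 + (O.t' - O.t) = O.t' + 1 by omega,
              Nat.add_sub_cancel]
        · left
          refine ⟨k + (O.t' - O.t), by omega, Or.inr (by omega), ?_, ?_⟩
          · rw [if_neg (by omega), if_neg (by omega)]
          · rw [if_neg (by omega),
              show k + 1 + (O.t' - O.t) = k + (O.t' - O.t) + 1 by omega, Nat.add_sub_cancel]
    intro a b
    simp only [TileComplex.Glue, key]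
    grind

/-! ### The snake graph `G₅₆'` -/

theorem mem_tiles56 {i : ℕ} : i ∈ O.G56'.tiles ↔
    (1 ≤ i ∧ i < O.s) ∨ (O.t < i ∧ i < O.s') ∨ (O.t' < i ∧ i ≤ G.d) := by
  obtain ⟨b₁, b₂, b₃, b₄, b₅⟩ := O.bounds
  simp only [G56', outer, middle, mem_union, mem_Icc]
  omega

theorem G56'_glued (hR : O.Regular) {a b : ℕ × Side} : O.G56'.glued a b ↔
    (∃ i, 1 ≤ i ∧ (i + 1 < O.s ∨ (O.t < i ∧ i + 1 < O.s') ∨ (O.t' < i ∧ i < G.d)) ∧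
      a = (i, G.outSide i) ∧ b = (i + 1, G.inSide i)) ∨
    (1 < O.s ∧ a = (O.s - 1, (G.outSide (O.s - 1)).reflect) ∧
      b = (O.s' - 1, (G.outSide (O.s' - 1)).reflect)) ∨
    (O.t' < G.d ∧ a = (O.t + 1, (G.inSide O.t).reflect) ∧
      b = (O.t' + 1, (G.inSide O.t').reflect)) := by
  obtain ⟨b₁, b₂, b₃, b₄, b₅⟩ := O.bounds
  have hlt := hR.lt
  refine or_congr_left ⟨?_, ?_⟩
  · rintro ⟨⟨i, h₁, h₂, rfl, rfl⟩, ha, hb⟩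
    simp only [outer, middle, mem_union, mem_Icc] at ha hb
    exact ⟨i, h₁, by omega, rfl, rfl⟩
  · rintro ⟨i, h₁, h₂, rfl, rfl⟩
    simp only [SnakeGraph.gluedIn, outer, middle, mem_union, mem_Icc]
    exact ⟨⟨i, h₁, by omega, rfl, rfl⟩, by omega, by omega⟩

variable (O) in
/-- The side of the `k`-th tile of `G₅₆'` at which the previous tile is glued. For the first tile
it is a side of the corresponding kind. -/
def inn56 (k : ℕ) : Side :=
  if k < O.s then G.inSide (k - 1)
  else if k = O.s then (G.outSide (O.s' - 1)).reflect
  else if k < O.s + (O.s' - 1 - O.t) then G.outSide (O.s' - 1 - (k - O.s))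
  else if k = O.s + (O.s' - 1 - O.t) then (G.inSide O.t').reflect
  else G.inSide (O.t' + (k - (O.s + (O.s' - 1 - O.t))))

variable (O) in
/-- The side of the `k`-th tile of `G₅₆'` at which the next tile is glued. For the last tile it is a
side of the corresponding kind. -/
def out56 (k : ℕ) : Side :=
  if k + 1 < O.s then G.outSide k
  else if k < O.s then (G.outSide (O.s - 1)).reflect
  else if k + 1 < O.s + (O.s' - 1 - O.t) then G.inSide (O.s' - 1 - (k - O.s) - 1)
  else if k < O.s + (O.s' - 1 - O.t) then (G.inSide O.t).reflect
  else G.outSide (O.t' + 1 + (k - (O.s + (O.s' - 1 - O.t))))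

theorem isChain56 (hR : O.Regular) : O.G56'.IsChain O.n56 O.tile56 O.inn56 O.out56 where
  tiles_eq := by
    obtain ⟨b₁, b₂, b₃, b₄, b₅⟩ := O.bounds
    have hlt := hR.lt
    ext i
    rw [mem_tiles56, mem_image]
    constructor
    · rintro (h | h | h)
      · exact ⟨i, ⟨by omega, by unfold n56; omega⟩, by unfold tile56; rw [if_pos h.2]⟩
      · refine ⟨O.s + (O.s' - 1 - i), ⟨by omega, by unfold n56; omega⟩, ?_⟩
        unfold tile56
        rw [if_neg (by omega), if_pos (by omega)]
        omega
      · refine ⟨O.s + (O.s' - 1 - O.t) + (i - O.t' - 1), ⟨by omega, by unfold n56; omega⟩, ?_⟩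
        unfold tile56
        rw [if_neg (by omega), if_neg (by omega)]
        omega
    · rintro ⟨k, ⟨h₁, h₂⟩, rfl⟩
      unfold n56 at h₂
      unfold tile56
      split_ifs <;> omega
  inj := by
    intro k l h₁ h₂ h₃ h₄ h
    obtain ⟨b₁, b₂, b₃, b₄, b₅⟩ := O.bounds
    have hlt := hR.lt
    unfold n56 at h₂ h₄
    unfold tile56 at h
    split_ifs at h <;> omega
  level_ne := by
    intro k h₁ h₂
    obtain ⟨b₁, b₂, b₃, b₄, b₅⟩ := O.bounds
    have hlt := hR.lt
    unfold inn56 out56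
    split_ifs <;> first | omega | simp
  glue_iff := by
    obtain ⟨b₁, b₂, b₃, b₄, b₅⟩ := O.bounds
    have hlt := hR.lt
    intro a b
    -- the glueing after the `k`-th tile, for `k` in the five parts of the sequence of tiles
    have e₁ {k : ℕ} (h : k + 1 < O.s) : (O.tile56 k, O.out56 k) = (k, G.outSide k) ∧
        (O.tile56 (k + 1), O.inn56 (k + 1)) = (k + 1, G.inSide k) := by
      unfold tile56 out56 inn56
      rw [if_pos (by omega), if_pos h, if_pos h, if_pos h, Nat.add_sub_cancel]
      exact ⟨rfl, rfl⟩
    have e₂ {k : ℕ} (h : k + 1 = O.s) : (O.tile56 k, O.out56 k) =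
        (O.s - 1, (G.outSide (O.s - 1)).reflect) ∧
        (O.tile56 (k + 1), O.inn56 (k + 1)) = (O.s' - 1, (G.outSide (O.s' - 1)).reflect) := by
      unfold tile56 out56 inn56
      rw [if_pos (by omega), if_neg (by omega), if_pos (by omega), if_neg (by omega),
        if_pos (by omega), if_neg (by omega), if_pos h, h]
      exact ⟨by congr 1; omega, by congr 1; omega⟩
    have e₃ {k : ℕ} (h : O.s ≤ k) (h' : k + 1 < O.s + (O.s' - 1 - O.t)) :
        (O.tile56 k, O.out56 k) = (O.s' - 2 - (k - O.s) + 1, G.inSide (O.s' - 2 - (k - O.s))) ∧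
        (O.tile56 (k + 1), O.inn56 (k + 1)) =
          (O.s' - 2 - (k - O.s), G.outSide (O.s' - 2 - (k - O.s))) := by
      unfold tile56 out56 inn56
      rw [if_neg (by omega), if_pos (by omega), if_neg (by omega), if_neg (by omega), if_pos h',
        if_neg (by omega), if_pos h', if_neg (by omega), if_neg (by omega), if_pos h']
      rw [show O.s' - 1 - (k - O.s) = O.s' - 2 - (k - O.s) + 1 by omega,
        show O.s' - 1 - (k + 1 - O.s) = O.s' - 2 - (k - O.s) by omega, Nat.add_sub_cancel]
      exact ⟨rfl, rfl⟩
    have e₄ {k : ℕ} (h' : k + 1 = O.s + (O.s' - 1 - O.t)) :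
        (O.tile56 k, O.out56 k) = (O.t + 1, (G.inSide O.t).reflect) ∧
        (O.tile56 (k + 1), O.inn56 (k + 1)) = (O.t' + 1, (G.inSide O.t').reflect) := by
      unfold tile56 out56 inn56
      rw [if_neg (by omega), if_pos (by omega), if_neg (by omega), if_neg (by omega),
        if_neg (by omega), if_pos (by omega), if_neg (by omega), if_neg (by omega),
        if_neg (by omega), if_neg (by omega), if_neg (by omega), if_pos h']
      exact ⟨by congr 1; omega, by congr 1; omega⟩
    have e₅ {k : ℕ} (h' : O.s + (O.s' - 1 - O.t) ≤ k) :
        (O.tile56 k, O.out56 k) = (O.t' + 1 + (k - (O.s + (O.s' - 1 - O.t))),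
          G.outSide (O.t' + 1 + (k - (O.s + (O.s' - 1 - O.t))))) ∧
        (O.tile56 (k + 1), O.inn56 (k + 1)) = (O.t' + 1 + (k - (O.s + (O.s' - 1 - O.t))) + 1,
          G.inSide (O.t' + 1 + (k - (O.s + (O.s' - 1 - O.t))))) := by
      unfold tile56 out56 inn56
      rw [if_neg (by omega), if_neg (by omega), if_neg (by omega), if_neg (by omega),
        if_neg (by omega), if_neg (by omega), if_neg (by omega), if_neg (by omega),
        if_neg (by omega), if_neg (by omega), if_neg (by omega), if_neg (by omega)]
      refine ⟨rfl, ?_⟩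
      rw [show O.t' + (k + 1 - (O.s + (O.s' - 1 - O.t))) =
        O.t' + 1 + (k - (O.s + (O.s' - 1 - O.t))) by omega]
      congr 1; omega
    have key : (∃ k, 1 ≤ k ∧ k < O.n56 ∧ ((a = (O.tile56 k, O.out56 k) ∧
          b = (O.tile56 (k + 1), O.inn56 (k + 1))) ∨ (b = (O.tile56 k, O.out56 k) ∧
          a = (O.tile56 (k + 1), O.inn56 (k + 1))))) ↔ ∃ p q, O.G56'.glued p q ∧
        ((a = p ∧ b = q) ∨ (b = p ∧ a = q)) := by
      simp only [G56'_glued hR]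
      unfold n56
      constructor
      · rintro ⟨k, h₁, h₂, h⟩
        by_cases c₁ : k + 1 < O.s
        · rw [(e₁ c₁).1, (e₁ c₁).2] at h
          exact ⟨_, _, Or.inl ⟨k, h₁, by omega, rfl, rfl⟩, h⟩
        by_cases c₂ : k + 1 = O.s
        · rw [(e₂ c₂).1, (e₂ c₂).2] at h
          exact ⟨_, _, Or.inr (Or.inl ⟨by omega, rfl, rfl⟩), h⟩
        by_cases c₃ : k + 1 < O.s + (O.s' - 1 - O.t)
        · rw [(e₃ (by omega) c₃).1, (e₃ (by omega) c₃).2] at h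
          exact ⟨_, _, Or.inl ⟨O.s' - 2 - (k - O.s), by omega, by omega, rfl, rfl⟩,
            h.symm.imp And.symm And.symm⟩
        by_cases c₄ : k + 1 = O.s + (O.s' - 1 - O.t)
        · rw [(e₄ c₄).1, (e₄ c₄).2] at h
          exact ⟨_, _, Or.inr (Or.inr ⟨by omega, rfl, rfl⟩), h⟩
        · rw [(e₅ (by omega)).1, (e₅ (by omega)).2] at h
          exact ⟨_, _, Or.inl ⟨_, by omega, by omega, rfl, rfl⟩, h⟩
      · rintro ⟨p, q, ⟨i, h₁, h₂ | h₂ | h₂, rfl, rfl⟩ | ⟨h', rfl, rfl⟩ | ⟨h', rfl, rfl⟩, h⟩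
        · refine ⟨i, h₁, by omega, ?_⟩
          rwa [(e₁ h₂).1, (e₁ h₂).2]
        · refine ⟨O.s + (O.s' - 2 - i), by omega, by omega, ?_⟩
          rw [(e₃ (by omega) (by omega)).1, (e₃ (by omega) (by omega)).2,
            show O.s' - 2 - (O.s + (O.s' - 2 - i) - O.s) = i by omega]
          exact h.symm.imp And.symm And.symm
        · refine ⟨O.s + (O.s' - 1 - O.t) + (i - O.t' - 1), by omega, by omega, ?_⟩
          rw [(e₅ (by omega)).1, (e₅ (by omega)).2,
            show O.t' + 1 + (O.s + (O.s' - 1 - O.t) + (i - O.t' - 1) - (O.s + (O.s' - 1 - O.t))) = i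
            by omega]
          exact h
        · refine ⟨O.s - 1, by omega, by omega, ?_⟩
          rwa [(e₂ (by omega)).1, (e₂ (by omega)).2]
        · refine ⟨O.s + (O.s' - 1 - O.t) - 1, by omega, by omega, ?_⟩
          rwa [(e₄ (by omega)).1, (e₄ (by omega)).2]
    rw [key]
    constructor
    · rintro (h | h)
      · exact ⟨a, b, h, Or.inl ⟨rfl, rfl⟩⟩
      · exact ⟨b, a, h, Or.inr ⟨rfl, rfl⟩⟩
    · rintro ⟨p, q, h, ⟨rfl, rfl⟩ | ⟨rfl, rfl⟩⟩
      · exact Or.inl h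
      · exact Or.inr h

end SelfOverlap

namespace SelfOverlap

variable {G : SnakeGraph} {f : G.Edge → Bool} {O : SelfOverlap G f}

/-! ### The band graph `G₄°` -/

theorem mem_tiles4 (hR : O.Regular) {i : ℕ} : i ∈ O.G4.tiles ↔ O.s ≤ i ∧ i < O.s' := by
  obtain ⟨b₁, b₂, b₃, b₄, b₅⟩ := O.bounds
  have hlt := hR.lt
  simp only [G4, middle, overlap, mem_union, mem_Icc]
  omega

theorem sign_startSide : f (G.edge O.s O.startSide) = f (G.intEdge (O.s' - 1)) := by
  obtain ⟨b₁, b₂, b₃, b₄, b₅⟩ := O.bounds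
  have h := O.sign_eq O.s le_rfl b₂ O.startSide
  rw [← h, ρ_startSide, G.intEdge_eq (by omega) (by omega), Nat.add_sub_cancel' b₃.le,
    Nat.sub_add_cancel (by omega)]

/-- The glueing at the north or east side of `G_i`, in cyclic order. -/
theorem G4_glued (hR : O.Regular) {a b : ℕ × Side} : O.G4.glued a b ↔
    ∃ i, O.s ≤ i ∧ i < O.s' ∧ a = (i, G.outSide i) ∧
      b = if i + 1 < O.s' then (i + 1, G.inSide i) else (O.s, O.startSide) := by
  obtain ⟨b₁, b₂, b₃, b₄, b₅⟩ := O.bounds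
  have hlt := hR.lt
  constructor
  · rintro (⟨⟨i, h₁, h₂, rfl, rfl⟩, ha, hb⟩ | ⟨rfl, x, hx, hf, rfl⟩)
    · simp only [overlap, middle, mem_union, mem_Icc] at ha hb
      exact ⟨i, by omega, by omega, rfl, by rw [if_pos (by omega)]⟩
    · refine ⟨O.s' - 1, by omega, by omega, rfl, ?_⟩
      rw [if_neg (by omega)]
      have hl : x.level = O.startSide.level := by
        rw [level_startSide]
        rcases hx with rfl | rfl <;> rfl
      rcases Side.eq_or_eq_reflect_of_level hl with rfl | rfl
      · rfl
      · have := hR.sign.reflect (i := O.s) ⟨b₁, by omega⟩ O.startSide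
        have h' := sign_startSide (O := O)
        rw [hf, h'] at this
        simp at this
  · rintro ⟨i, h₁, h₂, rfl, rfl⟩
    split_ifs with h
    · left
      simp only [SnakeGraph.gluedIn, overlap, middle, mem_union, mem_Icc]
      exact ⟨⟨i, by omega, by omega, rfl, rfl⟩, by omega, by omega⟩
    · right
      obtain rfl : i = O.s' - 1 := by omega
      refine ⟨rfl, O.startSide, ?_, sign_startSide, rfl⟩
      have := O.level_startSide
      revert this
      generalize O.startSide = x
      cases x <;> simp [Side.IsSW, Side.level]

theorem not_G4_glued_swap (hR : O.Regular) {a b : ℕ × Side} (h : O.G4.glued a b) :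
    ¬ O.G4.glued b a := by
  rw [G4_glued hR] at h ⊢
  obtain ⟨i, -, -, rfl, -⟩ := h
  rintro ⟨j, -, -, -, h⟩
  have := congrArg (fun x => x.2.level) h
  split_ifs at this <;> simp at this

theorem isStrip4 (hR : O.Regular) : O.G4.IsStrip := by
  obtain ⟨b₁, b₂, b₃, b₄, b₅⟩ := O.bounds
  have hlt := hR.lt
  have level {a b} (h : O.G4.glued a b) : a.2.level = 1 ∧ b.2.level = 0 := by
    obtain ⟨i, h₁, h₂, rfl, rfl⟩ := (G4_glued hR).1 h
    split_ifs <;> simp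
  have fst {a b c d} (h : O.G4.glued a b) (h' : O.G4.glued c d) :
      (a.1 = c.1 → a = c ∧ b = d) ∧ (b.1 = d.1 → a = c ∧ b = d) := by
    obtain ⟨i, h₁, h₂, rfl, rfl⟩ := (G4_glued hR).1 h
    obtain ⟨j, h₃, h₄, rfl, rfl⟩ := (G4_glued hR).1 h'
    constructor
    · rintro rfl
      exact ⟨rfl, rfl⟩
    · split_ifs <;> intro h <;> simp only at h
      · obtain rfl : i = j := by omega
        exact ⟨rfl, rfl⟩
      · omega
      · omega
      · obtain rfl : i = j := by omega
        exact ⟨rfl, rfl⟩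
  refine ⟨?_, ?_, ?_⟩
  · rintro a b c (h | h) (h' | h')
    · exact ((fst h h').1 rfl).2
    · exact absurd ((level h).1.symm.trans (level h').2) one_ne_zero
    · exact absurd ((level h').1.symm.trans (level h).2) one_ne_zero
    · exact ((fst h h').2 rfl).1
  · rintro a b c (h | h) (h' | h')
    · have := ((fst h h').1 rfl).1
      exact Side.reflect_ne a.2 (congrArg Prod.snd this).symm
    · have h1 := (level h).1
      have h2 := (level h').2
      simp only [Side.level_reflect] at h2
      omega
    · have h1 := (level h).2
      have h2 := (level h').1
      simp only [Side.level_reflect] at h2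
      omega
    · have := ((fst h h').2 rfl).2
      exact Side.reflect_ne a.2 (congrArg Prod.snd this).symm
  · have ne {a b} (h : O.G4.glued a b) : a.1 ≠ b.1 := by
      obtain ⟨i, h₁, h₂, rfl, rfl⟩ := (G4_glued hR).1 h
      split_ifs
      · simp
      · simp only [ne_eq]; omega
    rintro a b (h | h)
    · exact ne h
    · exact (ne h).symm

/-- Cutting the band graph gives a chain that begins with the tile after the cut. -/
theorem isChain_cut4 (hR : O.Regular) {a b : ℕ × Side} (hab : O.G4.glued a b) :
    (O.G4.cut a b).IsChain (O.s' - O.s)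
      (fun k => if a.1 + k < O.s' then a.1 + k else a.1 + k - (O.s' - O.s))
      (fun k => if a.1 + k < O.s' then G.inSide (a.1 + k - 1)
        else if a.1 + k = O.s' then O.startSide else G.inSide (a.1 + k - (O.s' - O.s) - 1))
      (fun k => G.outSide (if a.1 + k < O.s' then a.1 + k else a.1 + k - (O.s' - O.s))) where
  tiles_eq := by
    obtain ⟨i, h₁, h₂, rfl, -⟩ := (G4_glued hR).1 hab
    change O.G4.tiles = _
    ext j
    rw [mem_tiles4 hR, mem_image]
    constructor
    · intro h
      by_cases hij : i < j
      · exact ⟨j - i, ⟨by omega, by omega⟩, by simp only; rw [if_pos (by omega)]; omega⟩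
      · exact ⟨j + (O.s' - O.s) - i, ⟨by omega, by omega⟩, by
          simp only; rw [if_neg (by omega)]; omega⟩
    · rintro ⟨k, ⟨h₃, h₄⟩, rfl⟩
      simp only
      split_ifs <;> omega
  inj := by
    obtain ⟨i, h₁, h₂, rfl, -⟩ := (G4_glued hR).1 hab
    intro k l h₁ h₂ h₃ h₄ h
    simp only at h
    split_ifs at h <;> omega
  level_ne := by
    intro k _ _
    simp only [SnakeGraph.level_outSide]
    split_ifs <;> simp
  glue_iff := by
    obtain ⟨b₁, b₂, b₃, b₄, b₅⟩ := O.bounds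
    have hlt := hR.lt
    obtain ⟨i, h₁, h₂, rfl, hb⟩ := (G4_glued hR).1 hab
    have key : ∀ c d, (O.G4.cut (i, G.outSide i) b).glued c d ↔ ∃ k, 1 ≤ k ∧ k < O.s' - O.s ∧
        c = (if i + k < O.s' then i + k else i + k - (O.s' - O.s),
          G.outSide (if i + k < O.s' then i + k else i + k - (O.s' - O.s))) ∧
        d = (if i + (k + 1) < O.s' then i + (k + 1) else i + (k + 1) - (O.s' - O.s),
          if i + (k + 1) < O.s' then G.inSide (i + (k + 1) - 1)
          else if i + (k + 1) = O.s' then O.startSide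
          else G.inSide (i + (k + 1) - (O.s' - O.s) - 1)) := by
      intro c d
      change (O.G4.glued c d ∧ _) ↔ _
      rw [G4_glued hR]
      constructor
      · rintro ⟨⟨j, h₃, h₄, rfl, rfl⟩, hne⟩
        have hij : j ≠ i := by
          rintro rfl
          exact hne ⟨rfl, hb.symm⟩
        by_cases hij' : i < j
        · refine ⟨j - i, by omega, by omega, ?_, ?_⟩
          · rw [if_pos (by omega), Nat.add_sub_cancel' hij'.le]
          · split_ifs <;> first | omega | skip
            · rw [show i + (j - i + 1) = j + 1 by omega, Nat.add_sub_cancel]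
            · congr 1; omega
        · refine ⟨j + (O.s' - O.s) - i, by omega, by omega, ?_, ?_⟩
          · rw [if_neg (by omega), show i + (j + (O.s' - O.s) - i) - (O.s' - O.s) = j by omega]
          · rw [if_pos (by omega), if_neg (by omega), if_neg (by omega), if_neg (by omega),
              show i + (j + (O.s' - O.s) - i + 1) - (O.s' - O.s) = j + 1 by omega,
              Nat.add_sub_cancel]
      · rintro ⟨k, h₃, h₄, rfl, rfl⟩
        by_cases c₁ : i + (k + 1) < O.s'
        · refine ⟨⟨i + k, by omega, by omega, ?_, ?_⟩, fun h => ?_⟩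
          · rw [if_pos (by omega)]
          · rw [if_pos c₁, if_pos c₁, if_pos (by omega)]
            rfl
          · have := (Prod.mk.inj h.1).1
            rw [if_pos (by omega)] at this
            omega
        by_cases c₂ : i + (k + 1) = O.s'
        · refine ⟨⟨i + k, by omega, by omega, ?_, ?_⟩, fun h => ?_⟩
          · rw [if_pos (by omega)]
          · rw [if_neg c₁, if_neg c₁, if_pos c₂, if_neg (by omega)]
            congr 1; omega
          · have := (Prod.mk.inj h.1).1
            rw [if_pos (by omega)] at this
            omega
        · refine ⟨⟨i + k - (O.s' - O.s), by omega, by omega, ?_, ?_⟩, fun h => ?_⟩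
          · rw [if_neg (by omega)]
          · rw [if_neg c₁, if_neg c₁, if_neg c₂, if_pos (by omega),
              show i + (k + 1) - (O.s' - O.s) = i + k - (O.s' - O.s) + 1 by omega,
              Nat.add_sub_cancel]
          · have := (Prod.mk.inj h.1).1
            rw [if_neg (by omega)] at this
            omega
    intro c d
    simp only [TileComplex.Glue, key]
    grind

/-- The good perfect matchings of the band graph are the matchings given by its admissible
selections. -/
theorem isGoodMatching_iff (hR : O.Regular) {P : Set O.G4.Edge} : O.G4.IsGoodMatching P ↔
    ∃ σ, TileComplex.IsSelection σ ∧ O.G4.Admissible O.G4.tiles σ ∧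
      P = O.G4.matching O.G4.tiles σ := by
  obtain ⟨b₁, b₂, b₃, b₄, b₅⟩ := O.bounds
  have hlt := hR.lt
  have hT := isStrip4 hR
  have hmem {a b} (h : O.G4.glued a b) : a.1 ∈ O.G4.tiles ∧ b.1 ∈ O.G4.tiles := by
    obtain ⟨i, h₁, h₂, rfl, rfl⟩ := (G4_glued hR).1 h
    rw [mem_tiles4 hR, mem_tiles4 hR]
    split_ifs <;> simp only <;> omega
  constructor
  · rintro ⟨-, a, b, hab, Q, hQ, c, hc, hcQ, rfl⟩
    have hC := isChain_cut4 hR hab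
    obtain ⟨σ, hσ, hadm, rfl⟩ := hC.isPerfectMatching_iff.1 hQ
    have hcA : c.1 ∈ O.G4.tiles := by
      rcases hc with rfl | rfl
      · exact (hmem hab).1
      · exact (hmem hab).2
    have hσc : σ c := ((hC.isStrip.mem_matching hcA c.2).1 hcQ).1
    refine ⟨σ, hσ, ?_, hT.reglue_matching hab (not_G4_glued_swap hR hab) hC.isStrip (hmem hab) hc
      hσc⟩
    intro x y hxy hx hy
    rcases TileComplex.glue_cut_or (a := a) (b := b) hxy with h | ⟨rfl, rfl⟩ | ⟨rfl, rfl⟩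
    · exact hadm x y h hx hy
    · rcases hc with rfl | rfl
      · exact Or.inl hσc
      · exact Or.inr hσc
    · rcases hc with rfl | rfl
      · exact Or.inr hσc
      · exact Or.inl hσc
  · rintro ⟨σ, hσ, hadm, rfl⟩
    have hconv : O.G4.IsConvex O.G4.tiles := by
      rintro j hj x y a b (h | h) - - -
      · exact absurd (hmem h).1 hj
      · exact absurd (hmem h).2 hj
    refine ⟨hT.isPerfectMatching_matching hconv hσ hadm, ?_⟩
    have hab : O.G4.glued (O.s, G.outSide O.s) (O.s + 1, G.inSide O.s) :=
      (G4_glued hR).2 ⟨O.s, le_rfl, b₃, rfl, by rw [if_pos (by omega)]⟩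
    have hC := isChain_cut4 hR hab
    refine ⟨_, _, hab, _, hC.isPerfectMatching_iff.2 ⟨σ, hσ, fun x y h => hadm x y h.of_cut, rfl⟩,
      ?_⟩
    obtain ⟨c, hc, hσc⟩ : ∃ c, (c = (O.s, G.outSide O.s) ∨ c = (O.s + 1, G.inSide O.s)) ∧ σ c := by
      rcases hadm _ _ (Or.inl hab) (hmem hab).1 (hmem hab).2 with h | h
      · exact ⟨_, Or.inl rfl, h⟩
      · exact ⟨_, Or.inr rfl, h⟩
    have hcA : c.1 ∈ O.G4.tiles := by
      rcases hc with rfl | rfl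
      · exact (hmem hab).1
      · exact (hmem hab).2
    refine ⟨c, hc, ?_, ?_⟩
    · exact (hC.isStrip.mem_matching hcA c.2).2
        ⟨hσc, fun y hy => absurd hy (hT.not_glue_cut hab (not_G4_glued_swap hR hab) hc)⟩
    · exact (hT.reglue_matching hab (not_G4_glued_swap hR hab) hC.isStrip (hmem hab) hc hσc).symm

end SelfOverlap

open TileComplex

/-! ### The edges of the overlap -/

theorem SnakeGraph.mem_matching (G : SnakeGraph) {σ : ℕ × Side → Prop} {i : ℕ} (h₁ : 1 ≤ i)
    (h₂ : i ≤ G.d) (x : Side) : G.edge i x ∈ G.complex.matching G.complex.tiles σ ↔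
      σ (i, x) ∧ (i < G.d → x = G.outSide i → σ (i + 1, G.inSide i)) ∧
        (1 < i → x = G.inSide (i - 1) → σ (i - 1, G.outSide (i - 1))) := by
  have hC := G.isChain
  rw [hC.isStrip.mem_matching (show i ∈ G.complex.tiles from ⟨h₁, h₂⟩)]
  refine and_congr_right fun _ => ⟨fun h => ⟨fun hi hx => ?_, fun hi hx => ?_⟩, ?_⟩
  · exact h _ ((hC.glue_tile_iff h₁ h₂).2 (Or.inl ⟨hi, hx, rfl⟩)) ⟨by simp, hi⟩
  · exact h _ ((hC.glue_tile_iff h₁ h₂).2 (Or.inr ⟨hi, hx, rfl⟩))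
      ⟨by simp only; omega, by simp only; omega⟩
  · rintro ⟨h, h'⟩ b hb -
    rcases (hC.glue_tile_iff h₁ h₂).1 hb with ⟨hi, hx, rfl⟩ | ⟨hi, hx, rfl⟩
    · exact h hi hx
    · exact h' hi hx

theorem SnakeGraph.admissible_iff (G : SnakeGraph) {σ : ℕ × Side → Prop} :
    G.complex.Admissible G.complex.tiles σ ↔
      ∀ i, 1 ≤ i → i < G.d → σ (i, G.outSide i) ∨ σ (i + 1, G.inSide i) := by
  constructor
  · intro h i h₁ h₂
    exact h _ _ (G.glue h₁ h₂) ⟨h₁, h₂.le⟩ ⟨by simp, h₂⟩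
  · rintro h a b (⟨i, h₁, h₂, rfl, rfl⟩ | ⟨i, h₁, h₂, rfl, rfl⟩) - -
    · exact h i h₁ h₂
    · exact (h i h₁ h₂).symm

namespace SelfOverlap

variable {G : SnakeGraph} {f : G.Edge → Bool} {O : SelfOverlap G f}

theorem ρ_outSide {i : ℕ} (h₁ : O.s ≤ i) (h₂ : i < O.t) :
    O.ρ (G.outSide i) = G.outSide (i + (O.s' - O.s)) := O.isIso i h₁ h₂

theorem ρ_inSide {i : ℕ} (h₁ : O.s ≤ i) (h₂ : i < O.t) :
    O.ρ (G.inSide i) = G.inSide (i + (O.s' - O.s)) := by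
  have h := ρ_outSide h₁ h₂
  rw [G.outSide_eq, G.outSide_eq, O.ρ_cofoot, O.ρ_reflect] at h
  have h' := congrArg (fun x => x.cofoot.reflect) h
  simpa using h'

theorem ρ_injective {x y : Side} (h : O.ρ x = O.ρ y) : x = y := by
  rw [← O.ρ_ρ x, h, O.ρ_ρ]

variable (O)

/-- The selection on `G[s, t]` that corresponds to a selection on `G[s', t']`. -/
def shift (σ : ℕ × Side → Prop) : ℕ × Side → Prop := fun a => σ (a.1 + (O.s' - O.s), O.ρ a.2)

/-- The side `x` of the tile `G_i` of the overlap is selected, and if it is an interior edge of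
`G[s, t]`, it is also selected in the neighbouring tile. -/
def Core (τ : ℕ × Side → Prop) (i : ℕ) (x : Side) : Prop :=
  τ (i, x) ∧ (i < O.t → x = G.outSide i → τ (i + 1, G.inSide i)) ∧
    (O.s < i → x = G.inSide (i - 1) → τ (i - 1, G.outSide (i - 1)))

/-- The condition at the edge `e_{s-1}`, if `x` is this side of `G_s`. -/
def AtA (A : Prop) (i : ℕ) (x : Side) : Prop := i = O.s → x = O.startSide.reflect → 1 < O.s → A

/-- The condition at the edge `e_{s'-1}`, if `x` corresponds to this side of `G_{s'}`. -/
def AtB (B : Prop) (i : ℕ) (x : Side) : Prop := i = O.s → x = O.startSide → B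

/-- The condition at the edge `e_t`, if `x` is this side of `G_t`. -/
def AtC (C : Prop) (i : ℕ) (x : Side) : Prop := i = O.t → x = G.outSide O.t → C

/-- The condition at the edge `e_{t'}`, if `x` corresponds to this side of `G_{t'}`. -/
def AtD (D : Prop) (i : ℕ) (x : Side) : Prop :=
  i = O.t → x = (G.outSide O.t).reflect → O.t' < G.d → D

variable {O}

/-- On `G[s, t]` the matching of a selection is determined by the selection on `G[s, t]` and by the
values on the other sides of the edges `e_{s-1}` and `e_t`. -/
theorem mem_matching_left (hR : O.Regular) {σ : ℕ × Side → Prop} {i : ℕ} (h₁ : O.s ≤ i)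
    (h₂ : i ≤ O.t) (x : Side) : G.edge i x ∈ G.complex.matching G.complex.tiles σ ↔
      O.Core σ i x ∧ O.AtA (σ (O.s - 1, G.outSide (O.s - 1))) i x ∧
        O.AtC (σ (O.t + 1, G.inSide O.t)) i x := by
  obtain ⟨b₁, b₂, b₃, b₄, b₅⟩ := O.bounds
  have hlt := hR.lt
  have hst := hR.start
  rw [G.mem_matching (by omega) (by omega)]
  unfold Core AtA AtC
  constructor
  · rintro ⟨h, h', h''⟩
    refine ⟨⟨h, fun _ => h' (by omega), fun _ => h'' (by omega)⟩, ?_, ?_⟩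
    · rintro rfl hx hs
      exact h'' hs (by rw [hst hs, hx])
    · rintro rfl hx
      exact h' (by omega) hx
  · rintro ⟨⟨h, h', h''⟩, hA, hC⟩
    refine ⟨h, fun _ hx => ?_, fun hi hx => ?_⟩
    · rcases Nat.eq_or_lt_of_le h₂ with rfl | h₂
      · exact hC rfl hx
      · exact h' h₂ hx
    · rcases Nat.eq_or_lt_of_le h₁ with rfl | h₁
      · exact hA rfl (by rw [hx, hst hi]) hi
      · exact h'' h₁ hx

/-- On `G[s', t']`, identified with `G[s, t]`, the matching of a selection is determined by the shifted
selection and by the values on the other sides of the edges `e_{s'-1}` and `e_{t'}`. -/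
theorem mem_matching_right (hR : O.Regular) {σ : ℕ × Side → Prop} {i : ℕ} (h₁ : O.s ≤ i)
    (h₂ : i ≤ O.t) (x : Side) : O.image i x ∈ G.complex.matching G.complex.tiles σ ↔
      O.Core (O.shift σ) i x ∧ O.AtB (σ (O.s' - 1, G.outSide (O.s' - 1))) i x ∧
        O.AtD (σ (O.t' + 1, G.inSide O.t')) i x := by
  obtain ⟨b₁, b₂, b₃, b₄, b₅⟩ := O.bounds
  have hlt := hR.lt
  have hfin := hR.finish
  rw [image, G.mem_matching (by omega) (by omega)]
  unfold Core AtB AtD shift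
  simp only
  have hs' : O.s + (O.s' - O.s) = O.s' := by omega
  have c₁ (h : i < O.t) : O.ρ x = G.outSide (i + (O.s' - O.s)) ↔ x = G.outSide i := by
    rw [← ρ_outSide h₁ h]
    exact ⟨ρ_injective, fun h => by rw [h]⟩
  have c₂ (h : O.s < i) : O.ρ x = G.inSide (i + (O.s' - O.s) - 1) ↔ x = G.inSide (i - 1) := by
    rw [show i + (O.s' - O.s) - 1 = i - 1 + (O.s' - O.s) by omega,
      ← ρ_inSide (by omega) (by omega)]
    exact ⟨ρ_injective, fun h => by rw [h]⟩
  have c₃ : O.ρ x = G.inSide (O.s' - 1) ↔ x = O.startSide := by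
    rw [← ρ_startSide]
    exact ⟨ρ_injective, fun h => by rw [h]⟩
  have c₄ (h : O.t' < G.d) : O.ρ x = G.outSide O.t' ↔ x = (G.outSide O.t).reflect := by
    rw [← hfin h]
    exact ⟨fun h => by rw [← h, O.ρ_ρ], fun h => by rw [h, O.ρ_ρ]⟩
  have d₁ (h : i < O.t) : (i + 1 + (O.s' - O.s), O.ρ (G.inSide i)) =
      (i + (O.s' - O.s) + 1, G.inSide (i + (O.s' - O.s))) := by
    rw [ρ_inSide h₁ h]
    congr 1; omega
  have d₂ (h : O.s < i) : (i - 1 + (O.s' - O.s), O.ρ (G.outSide (i - 1))) =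
      (i + (O.s' - O.s) - 1, G.outSide (i + (O.s' - O.s) - 1)) := by
    rw [ρ_outSide (by omega) (by omega),
      show i + (O.s' - O.s) - 1 = i - 1 + (O.s' - O.s) by omega]
  constructor
  · rintro ⟨h, h', h''⟩
    refine ⟨⟨h, fun hi hx => ?_, fun hi hx => ?_⟩, ?_, ?_⟩
    · rw [d₁ hi]
      exact h' (by omega) ((c₁ hi).2 hx)
    · rw [d₂ hi]
      exact h'' (by omega) ((c₂ hi).2 hx)
    · rintro rfl hx
      rw [hs'] at h''
      exact h'' (by omega) (c₃.2 hx)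
    · rintro rfl hx ht
      rw [← b₄] at h'
      exact h' ht ((c₄ ht).2 hx)
  · rintro ⟨⟨h, h', h''⟩, hB, hD⟩
    refine ⟨h, fun hi hx => ?_, fun hi hx => ?_⟩
    · rcases Nat.eq_or_lt_of_le h₂ with rfl | h₂
      · rw [← b₄] at hi hx ⊢
        exact hD rfl ((c₄ hi).1 hx) hi
      · rw [← d₁ h₂]
        exact h' h₂ ((c₁ h₂).1 hx)
    · rcases Nat.eq_or_lt_of_le h₁ with rfl | h₁
      · rw [hs'] at hx ⊢
        exact hB rfl (c₃.1 hx)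
      · rw [← d₂ h₁]
        exact h'' h₁ ((c₂ h₁).1 hx)

theorem glue3_int (hR : O.Regular) {i : ℕ} (h₁ : 1 ≤ i) (h₂ : i < O.t ∨ (O.t' < i ∧ i < G.d)) :
    O.G3.Glue (i, G.outSide i) (i + 1, G.inSide i) :=
  Or.inl ((G3_glued hR).2 (Or.inl ⟨i, h₁, h₂, rfl, rfl⟩))

theorem glue3_new (hR : O.Regular) (h : O.t' < G.d) :
    O.G3.Glue (O.t, (G.outSide O.t).reflect) (O.t' + 1, G.inSide O.t') :=
  Or.inl ((G3_glued hR).2 (Or.inr ⟨h, by rw [hR.finish h], rfl⟩))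

theorem admissible3_iff (hR : O.Regular) {σ : ℕ × Side → Prop} :
    O.G3.Admissible O.G3.tiles σ ↔
      (∀ i, 1 ≤ i → (i < O.t ∨ (O.t' < i ∧ i < G.d)) →
        σ (i, G.outSide i) ∨ σ (i + 1, G.inSide i)) ∧
      (O.t' < G.d → σ (O.t, (G.outSide O.t).reflect) ∨ σ (O.t' + 1, G.inSide O.t')) := by
  obtain ⟨b₁, b₂, b₃, b₄, b₅⟩ := O.bounds
  constructor
  · intro h
    refine ⟨fun i h₁ h₂ => h _ _ (glue3_int hR h₁ h₂) ?_ ?_,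
      fun hd => h _ _ (glue3_new hR hd) ?_ ?_⟩ <;> rw [mem_tiles3] <;> simp only <;> omega
  · rintro ⟨h, h'⟩ a b hab - -
    have key : ∀ a b, O.G3.glued a b → σ a ∨ σ b := by
      intro a b hab
      rcases (G3_glued hR).1 hab with ⟨i, h₁, h₂, rfl, rfl⟩ | ⟨hd, rfl, rfl⟩
      · exact h i h₁ h₂
      · rw [hR.finish hd]
        exact h' hd
    exact hab.elim (key a b) fun h => (key b a h).symm

theorem admissible4_iff (hR : O.Regular) {σ : ℕ × Side → Prop} :
    O.G4.Admissible O.G4.tiles σ ↔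
      (∀ i, O.s ≤ i → i + 1 < O.s' → σ (i, G.outSide i) ∨ σ (i + 1, G.inSide i)) ∧
      (σ (O.s' - 1, G.outSide (O.s' - 1)) ∨ σ (O.s, O.startSide)) := by
  obtain ⟨b₁, b₂, b₃, b₄, b₅⟩ := O.bounds
  constructor
  · intro h
    constructor
    · intro i h₁ h₂
      refine h _ _ (Or.inl ((G4_glued hR).2 ⟨i, h₁, by omega, rfl, by rw [if_pos h₂]⟩)) ?_ ?_ <;>
        rw [mem_tiles4 hR] <;> simp only <;> omega
    · refine h _ _ (Or.inl ((G4_glued hR).2 ⟨O.s' - 1, by omega, by omega, rfl,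
        by rw [if_neg (by omega)]⟩)) ?_ ?_ <;> rw [mem_tiles4 hR] <;> simp only <;> omega
  · rintro ⟨h, h'⟩ a b hab - -
    have key : ∀ a b, O.G4.glued a b → σ a ∨ σ b := by
      intro a b hab
      obtain ⟨i, h₁, h₂, rfl, rfl⟩ := (G4_glued hR).1 hab
      split_ifs with hi
      · exact h i h₁ hi
      · obtain rfl : i = O.s' - 1 := by omega
        exact h'
    exact hab.elim (key a b) fun h => (key b a h).symm

/-- The glueings of a tile of `G₃`. -/
theorem glue3_tile_iff (hR : O.Regular) {i : ℕ} {x : Side} {b : ℕ × Side} :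
    O.G3.Glue (i, x) b ↔
      (1 ≤ i ∧ (i < O.t ∨ (O.t' < i ∧ i < G.d)) ∧ x = G.outSide i ∧ b = (i + 1, G.inSide i)) ∨
      (1 < i ∧ (i ≤ O.t ∨ (O.t' + 1 < i ∧ i ≤ G.d)) ∧ x = G.inSide (i - 1) ∧
        b = (i - 1, G.outSide (i - 1))) ∨
      (O.t' < G.d ∧ i = O.t ∧ x = (G.outSide O.t).reflect ∧ b = (O.t' + 1, G.inSide O.t')) ∨
      (O.t' < G.d ∧ i = O.t' + 1 ∧ x = G.inSide O.t' ∧ b = (O.t, (G.outSide O.t).reflect)) := by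
  have hfin := hR.finish
  rw [TileComplex.Glue, G3_glued hR, G3_glued hR]
  constructor
  · rintro ((⟨i, h₁, h₂, ha, rfl⟩ | ⟨h, ha, rfl⟩) | (⟨i, h₁, h₂, rfl, ha⟩ | ⟨h, rfl, ha⟩)) <;>
      obtain ⟨rfl, rfl⟩ := Prod.mk.inj ha
    · exact Or.inl ⟨h₁, h₂, rfl, rfl⟩
    · exact Or.inr (Or.inr (Or.inl ⟨h, rfl, hfin h, rfl⟩))
    · exact Or.inr (Or.inl ⟨by omega, by omega, by simp, by simp⟩)
    · exact Or.inr (Or.inr (Or.inr ⟨h, rfl, rfl, by rw [hfin h]⟩))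
  · rintro (⟨h₁, h₂, rfl, rfl⟩ | ⟨h₁, h₂, rfl, rfl⟩ | ⟨h, rfl, rfl, rfl⟩ | ⟨h, rfl, rfl, rfl⟩)
    · exact Or.inl (Or.inl ⟨i, h₁, h₂, rfl, rfl⟩)
    · exact Or.inr (Or.inl ⟨i - 1, by omega, by omega, rfl, by rw [Nat.sub_add_cancel h₁.le]⟩)
    · exact Or.inl (Or.inr ⟨h, by rw [hfin h], rfl⟩)
    · exact Or.inr (Or.inr ⟨h, by rw [hfin h], rfl⟩)

/-- The glueings of a tile of `G₄°`. -/
theorem glue4_tile_iff (hR : O.Regular) {i : ℕ} {x : Side} {b : ℕ × Side} :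
    O.G4.Glue (i, x) b ↔
      (O.s ≤ i ∧ i + 1 < O.s' ∧ x = G.outSide i ∧ b = (i + 1, G.inSide i)) ∨
      (O.s < i ∧ i < O.s' ∧ x = G.inSide (i - 1) ∧ b = (i - 1, G.outSide (i - 1))) ∨
      (i = O.s' - 1 ∧ x = G.outSide (O.s' - 1) ∧ b = (O.s, O.startSide)) ∨
      (i = O.s ∧ x = O.startSide ∧ b = (O.s' - 1, G.outSide (O.s' - 1))) := by
  obtain ⟨b₁, b₂, b₃, b₄, b₅⟩ := O.bounds
  rw [TileComplex.Glue, G4_glued hR, G4_glued hR]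
  constructor
  · rintro (⟨j, h₁, h₂, ha, rfl⟩ | ⟨j, h₁, h₂, rfl, ha⟩)
    · obtain ⟨rfl, rfl⟩ := Prod.mk.inj ha
      split_ifs with h
      · exact Or.inl ⟨h₁, h, rfl, rfl⟩
      · obtain rfl : i = O.s' - 1 := by omega
        exact Or.inr (Or.inr (Or.inl ⟨rfl, rfl, rfl⟩))
    · split_ifs at ha with h <;> obtain ⟨rfl, rfl⟩ := Prod.mk.inj ha
      · exact Or.inr (Or.inl ⟨by omega, h, by simp, by simp⟩)
      · obtain rfl : j = O.s' - 1 := by omega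
        exact Or.inr (Or.inr (Or.inr ⟨rfl, rfl, rfl⟩))
  · rintro (⟨h₁, h₂, rfl, rfl⟩ | ⟨h₁, h₂, rfl, rfl⟩ | ⟨rfl, rfl, rfl⟩ | ⟨rfl, rfl, rfl⟩)
    · exact Or.inl ⟨i, h₁, by omega, rfl, by rw [if_pos h₂]⟩
    · exact Or.inr ⟨i - 1, by omega, by omega, rfl, by
        rw [if_pos (by omega), Nat.sub_add_cancel (by omega)]⟩
    · exact Or.inl ⟨_, by omega, by omega, rfl, by rw [if_neg (by omega)]⟩
    · exact Or.inr ⟨_, by omega, by omega, rfl, by rw [if_neg (by omega)]⟩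

/-- On the overlap in `G₃`, the conditions are those at `e_{s-1}` and at the new glueing edge. -/
theorem mem_matching3 (hR : O.Regular) {σ : ℕ × Side → Prop} {i : ℕ} (h₁ : O.s ≤ i)
    (h₂ : i ≤ O.t) (x : Side) : O.G3.edge (i, x) ∈ O.G3.matching O.G3.tiles σ ↔
      O.Core σ i x ∧ O.AtA (σ (O.s - 1, G.outSide (O.s - 1))) i x ∧
        O.AtD (σ (O.t' + 1, G.inSide O.t')) i x := by
  obtain ⟨b₁, b₂, b₃, b₄, b₅⟩ := O.bounds
  have hst := hR.start
  have hi : i ∈ O.G3.tiles := mem_tiles3.2 (by omega)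
  rw [(isChain3 hR).isStrip.mem_matching hi]
  have mem {j : ℕ} {z : Side} (hj : 1 ≤ j ∧ (j ≤ O.t ∨ O.t' < j ∧ j ≤ G.d)) :
    (j, z).1 ∈ O.G3.tiles := mem_tiles3.2 (by simp only; omega)
  unfold Core AtA AtD
  constructor
  · rintro ⟨h, h'⟩
    refine ⟨⟨h, fun hi hx => ?_, fun hi hx => ?_⟩, ?_, ?_⟩
    · exact h' _ ((glue3_tile_iff hR).2 (Or.inl ⟨by omega, Or.inl hi, hx, rfl⟩)) (mem (by omega))
    · exact h' _ ((glue3_tile_iff hR).2 (Or.inr (Or.inl ⟨by omega, Or.inl h₂, hx, rfl⟩)))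
        (mem (by omega))
    · rintro rfl hx hs
      exact h' _ ((glue3_tile_iff hR).2 (Or.inr (Or.inl ⟨hs, Or.inl h₂, by rw [hst hs, hx], rfl⟩)))
        (mem (by omega))
    · rintro rfl hx ht
      exact h' _ ((glue3_tile_iff hR).2 (Or.inr (Or.inr (Or.inl ⟨ht, rfl, hx, rfl⟩))))
        (mem (by omega))
  · rintro ⟨⟨h, h', h''⟩, hA, hD⟩
    refine ⟨h, fun b hb _ => ?_⟩
    rcases (glue3_tile_iff hR).1 hb with ⟨-, h3, hx, rfl⟩ | ⟨h3, -, hx, rfl⟩ | ⟨h3, h4, hx, rfl⟩ |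
      ⟨-, h3, -, -⟩
    · exact h' (by omega) hx
    · rcases Nat.eq_or_lt_of_le h₁ with rfl | h₁
      · exact hA rfl (by rw [hx, hst h3]) h3
      · exact h'' h₁ hx
    · exact hD h4 hx h3
    · omega

/-- On the overlap in `G₄°`, the conditions are those at the edge `b = b'` of the band and at `e_t`. -/
theorem mem_matching4 (hR : O.Regular) {σ : ℕ × Side → Prop} {i : ℕ} (h₁ : O.s ≤ i)
    (h₂ : i ≤ O.t) (x : Side) : O.G4.edge (i, x) ∈ O.G4.matching O.G4.tiles σ ↔
      O.Core σ i x ∧ O.AtB (σ (O.s' - 1, G.outSide (O.s' - 1))) i x ∧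
        O.AtC (σ (O.t + 1, G.inSide O.t)) i x := by
  obtain ⟨b₁, b₂, b₃, b₄, b₅⟩ := O.bounds
  have hlt := hR.lt
  have mem {j : ℕ} {z : Side} (hj : O.s ≤ j ∧ j < O.s') : (j, z).1 ∈ O.G4.tiles :=
    (mem_tiles4 hR).2 hj
  rw [(isStrip4 hR).mem_matching (mem (z := x) ⟨h₁, by omega⟩)]
  unfold Core AtB AtC
  constructor
  · rintro ⟨h, h'⟩
    refine ⟨⟨h, fun hi hx => ?_, fun hi hx => ?_⟩, ?_, ?_⟩
    · exact h' _ ((glue4_tile_iff hR).2 (Or.inl ⟨h₁, by omega, hx, rfl⟩)) (mem (by omega))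
    · exact h' _ ((glue4_tile_iff hR).2 (Or.inr (Or.inl ⟨hi, by omega, hx, rfl⟩)))
        (mem (by omega))
    · rintro rfl hx
      exact h' _ ((glue4_tile_iff hR).2 (Or.inr (Or.inr (Or.inr ⟨rfl, hx, rfl⟩))))
        (mem (by omega))
    · rintro rfl hx
      exact h' _ ((glue4_tile_iff hR).2 (Or.inl ⟨h₁, hlt, hx, rfl⟩)) (mem (by omega))
  · rintro ⟨⟨h, h', h''⟩, hB, hC⟩
    refine ⟨h, fun b hb _ => ?_⟩
    rcases (glue4_tile_iff hR).1 hb with ⟨-, h3, hx, rfl⟩ | ⟨h3, -, hx, rfl⟩ | ⟨h3, -, -⟩ |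
      ⟨h3, hx, rfl⟩
    · rcases Nat.eq_or_lt_of_le h₂ with rfl | h₂
      · exact hC rfl hx
      · exact h' h₂ hx
    · exact h'' h3 hx
    · omega
    · exact hB h3 hx

/-- Let `w` agree with `p` on the first `m` tiles of the overlap and with `q` on the others. If `p`
and `q` agree on the `m`-th tile, then an edge of the overlap that is before position `m` is treated
by `w` as by `p`, and an edge after position `m` as by `q`. The conditions `L` and `R` concern
the two ends of the overlap. -/
theorem core_splice {m i : ℕ} {x : Side} {p q w : ℕ × Side → Prop} (h₁ : O.s ≤ i)
    (h₂ : i ≤ O.t) (hw : ∀ j, O.s ≤ j → j ≤ O.t → ∀ z, w (j, z) ↔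
      if j < O.s + m then p (j, z) else q (j, z))
    (hpq : ∀ j, O.s ≤ j → j ≤ O.t → j + 1 = O.s + m → ∀ z, p (j, z) ↔ q (j, z))
    {L₁ L₂ R₁ R₂ : Prop} (hL : m = 0 ∨ ¬ (i = O.s ∧ x.level = 0) → L₁ ∧ L₂)
    (hR : m = O.t - O.s + 2 ∨ ¬ (i = O.t ∧ x.level = 1) → R₁ ∧ R₂) (hm : m ≤ O.t - O.s + 2) :
    ((O.Before m i x ∧ O.Core p i x ∧ L₁ ∧ R₁) ∨ (¬ O.Before m i x ∧ O.Core q i x ∧ L₂ ∧ R₂)) ↔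
      O.Core w i x ∧ L₁ ∧ R₂ := by
  have hx : x.level = 0 ∨ x.level = 1 := by cases x <;> simp [Side.level]
  have hwp : ∀ j, O.s ≤ j → j ≤ O.t → j < O.s + m → ∀ z, (w (j, z) ↔ p (j, z)) := by
    intro j h h' hj z
    rw [hw j h h', if_pos hj]
  have hwq : ∀ j, O.s ≤ j → j ≤ O.t → O.s + m ≤ j + 1 → ∀ z, (w (j, z) ↔ q (j, z)) := by
    intro j h h' hj z
    rw [hw j h h']
    split_ifs with h''
    · exact hpq j h h' (by omega) z
    · rfl
  by_cases hB : O.Before m i x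
  · simp only [hB, true_and, not_true, false_and, or_false]
    unfold Before at hB
    have hc : O.Core w i x ↔ O.Core p i x := by
      unfold Core
      rw [hwp i h₁ h₂ (by omega)]
      refine and_congr_right fun _ => and_congr ?_ ?_
      · refine forall_congr' fun hi => forall_congr' fun hx' => hwp _ (by omega) hi ?_ _
        have : x.level = 1 := by rw [hx']; simp
        omega
      · refine forall_congr' fun hi => forall_congr' fun hx' =>
          hwp _ (by omega) (by omega) (by omega) _
    rw [hc]
    have hR' : R₁ ∧ R₂ := hR (by omega)
    tauto
  · simp only [hB, false_and, not_false_eq_true, true_and, false_or]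
    unfold Before at hB
    have hc : O.Core w i x ↔ O.Core q i x := by
      unfold Core
      rw [hwq i h₁ h₂ (by omega)]
      refine and_congr_right fun _ => and_congr ?_ ?_
      · refine forall_congr' fun hi => forall_congr' fun hx' =>
          hwq _ (by omega) hi (by omega) _
      · refine forall_congr' fun hi => forall_congr' fun hx' =>
          hwq _ (by omega) (by omega) ?_ _
        have : x.level = 0 := by rw [hx']; simp
        omega
    rw [hc]
    have hL' : L₁ ∧ L₂ := hL (by omega)
    tauto

end SelfOverlap

/-! ### Membership in switched edge sets -/

theorem TileComplex.subset_edgesOf_ext {T : TileComplex} {A : Set ℕ} {P Q : Set T.Edge}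
    (hP : P ⊆ T.edgesOf A) (hQ : Q ⊆ T.edgesOf A)
    (h : ∀ i ∈ A, ∀ x, T.edge (i, x) ∈ P ↔ T.edge (i, x) ∈ Q) : P = Q := by
  ext e
  constructor
  · intro he
    obtain ⟨i, hi, x, rfl⟩ := hP he
    exact (h i hi x).1 he
  · intro he
    obtain ⟨i, hi, x, rfl⟩ := hQ he
    exact (h i hi x).2 he

theorem TileComplex.matching_congr {T : TileComplex} {A : Set ℕ} {σ τ : ℕ × Side → Prop}
    (h : ∀ i ∈ A, ∀ x, σ (i, x) ↔ τ (i, x)) : T.matching A σ = T.matching A τ := by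
  ext e
  refine and_congr_right fun _ => forall_congr' fun i => forall_congr' fun hi =>
    forall_congr' fun x => ?_
  rw [h i hi x]

theorem SnakeGraph.edge_step (G : SnakeGraph) {i : ℕ} (h₁ : 1 ≤ i) (h₂ : i < G.d) :
    G.edge (i + 1) (G.inSide i) = G.edge i (G.outSide i) :=
  (edge_eq_of_glue (G.glue h₁ h₂)).symm

theorem SnakeGraph.glue_tile_iff (G : SnakeGraph) {i : ℕ} (h₁ : 1 ≤ i) (h₂ : i ≤ G.d) {x : Side}
    {b : ℕ × Side} : G.complex.Glue (i, x) b ↔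
      (i < G.d ∧ x = G.outSide i ∧ b = (i + 1, G.inSide i)) ∨
      (1 < i ∧ x = G.inSide (i - 1) ∧ b = (i - 1, G.outSide (i - 1))) :=
  G.isChain.glue_tile_iff h₁ h₂

theorem SnakeGraph.edge_eq_iff (G : SnakeGraph) {i j : ℕ} {x y : Side} (h₁ : 1 ≤ i)
    (h₂ : i ≤ G.d) : G.edge i x = G.edge j y ↔ (i = j ∧ x = y) ∨
      (i < G.d ∧ x = G.outSide i ∧ j = i + 1 ∧ y = G.inSide i) ∨
      (1 < i ∧ x = G.inSide (i - 1) ∧ j = i - 1 ∧ y = G.outSide (i - 1)) := by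
  rw [SnakeGraph.edge, SnakeGraph.edge, G.isChain.isStrip.edge_eq_iff, G.glue_tile_iff h₁ h₂]
  simp only [Prod.mk.injEq]

namespace SelfOverlap

variable {G : SnakeGraph} {f : G.Edge → Bool} {O : SelfOverlap G f}

theorem before_step {m i : ℕ} (h : O.s ≤ i) :
    O.Before m (i + 1) (G.inSide i) ↔ O.Before m i (G.outSide i) := by
  simp only [Before, SnakeGraph.level_inSide, SnakeGraph.level_outSide]
  omega

theorem edge_step {i : ℕ} (h₁ : O.s ≤ i) (h₂ : i < O.t) :
    G.edge (i + 1) (G.inSide i) = G.edge i (G.outSide i) := by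
  obtain ⟨b₁, b₂, b₃, b₄, b₅⟩ := O.bounds
  exact G.edge_step (by omega) (by omega)

theorem image_step {i : ℕ} (h₁ : O.s ≤ i) (h₂ : i < O.t) :
    O.image (i + 1) (G.inSide i) = O.image i (G.outSide i) := by
  obtain ⟨b₁, b₂, b₃, b₄, b₅⟩ := O.bounds
  rw [image, image, ρ_inSide h₁ h₂, ρ_outSide h₁ h₂,
    show i + 1 + (O.s' - O.s) = i + (O.s' - O.s) + 1 by omega]
  exact G.edge_step (by omega) (by omega)

theorem glue3_overlap (hR : O.Regular) {i j : ℕ} {x y : Side} (hi : O.s ≤ i ∧ i ≤ O.t)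
    (hj : O.s ≤ j ∧ j ≤ O.t) (h : O.G3.Glue (i, x) (j, y)) :
    (i < O.t ∧ x = G.outSide i ∧ j = i + 1 ∧ y = G.inSide i) ∨
      (j < O.t ∧ y = G.outSide j ∧ i = j + 1 ∧ x = G.inSide j) := by
  obtain ⟨b₁, b₂, b₃, b₄, b₅⟩ := O.bounds
  rcases (glue3_tile_iff hR).1 h with ⟨-, h3, hx, hb⟩ | ⟨h3, -, hx, hb⟩ | ⟨h3, h4, hx, hb⟩ |
      ⟨-, h3, -, -⟩
  · obtain ⟨rfl, rfl⟩ := Prod.mk.inj hb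
    exact Or.inl ⟨by omega, hx, rfl, rfl⟩
  · obtain ⟨rfl, rfl⟩ := Prod.mk.inj hb
    exact Or.inr ⟨by omega, rfl, by omega, hx⟩
  · have := (Prod.mk.inj hb).1
    omega
  · omega

theorem glue4_overlap (hR : O.Regular) {i j : ℕ} {x y : Side} (hi : O.s ≤ i ∧ i ≤ O.t)
    (hj : O.s ≤ j ∧ j ≤ O.t) (h : O.G4.Glue (i, x) (j, y)) :
    (i < O.t ∧ x = G.outSide i ∧ j = i + 1 ∧ y = G.inSide i) ∨
      (j < O.t ∧ y = G.outSide j ∧ i = j + 1 ∧ x = G.inSide j) := by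
  obtain ⟨b₁, b₂, b₃, b₄, b₅⟩ := O.bounds
  have hlt := hR.lt
  rcases (glue4_tile_iff hR).1 h with ⟨-, h3, hx, hb⟩ | ⟨h3, -, hx, hb⟩ | ⟨h3, -, -⟩ |
      ⟨h3, hx, hb⟩
  · obtain ⟨rfl, rfl⟩ := Prod.mk.inj hb
    exact Or.inl ⟨by omega, hx, rfl, rfl⟩
  · obtain ⟨rfl, rfl⟩ := Prod.mk.inj hb
    exact Or.inr ⟨by omega, rfl, by omega, hx⟩
  · omega
  · have := (Prod.mk.inj hb).1
    omega

theorem mem_switch3 (hR : O.Regular) {m i : ℕ} {P : Set G.Edge} (h₁ : O.s ≤ i) (h₂ : i ≤ O.t)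
    (x : Side) : O.G3.edge (i, x) ∈ O.switch3 m P ↔
      (O.Before m i x ∧ G.edge i x ∈ P) ∨ (¬ O.Before m i x ∧ O.image i x ∈ P) := by
  constructor
  · rintro (⟨j, hj, y, he, h⟩ | ⟨he, -⟩)
    · rcases (isChain3 hR).isStrip.edge_eq_iff.1 he with hij | hij
      · obtain ⟨rfl, rfl⟩ := Prod.mk.inj hij
        exact h
      · rcases glue3_overlap hR ⟨h₁, h₂⟩ hj hij with ⟨h3, rfl, rfl, rfl⟩ | ⟨h3, rfl, rfl, rfl⟩
        · rwa [before_step h₁, edge_step h₁ h3, image_step h₁ h3] at h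
        · rwa [before_step hj.1, edge_step hj.1 h3, image_step hj.1 h3]
    · exact absurd ⟨i, ⟨h₁, h₂⟩, x, rfl⟩ he
  · exact fun h => Or.inl ⟨i, ⟨h₁, h₂⟩, x, rfl, h⟩

theorem mem_switch4 (hR : O.Regular) {m i : ℕ} {P : Set G.Edge} (h₁ : O.s ≤ i) (h₂ : i ≤ O.t)
    (x : Side) : O.G4.edge (i, x) ∈ O.switch4 m P ↔
      (O.Before m i x ∧ O.image i x ∈ P) ∨ (¬ O.Before m i x ∧ G.edge i x ∈ P) := by
  constructor
  · rintro (⟨j, hj, y, he, h⟩ | ⟨he, -⟩)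
    · rcases (isStrip4 hR).edge_eq_iff.1 he with hij | hij
      · obtain ⟨rfl, rfl⟩ := Prod.mk.inj hij
        exact h
      · rcases glue4_overlap hR ⟨h₁, h₂⟩ hj hij with ⟨h3, rfl, rfl, rfl⟩ | ⟨h3, rfl, rfl, rfl⟩
        · rwa [before_step h₁, edge_step h₁ h3, image_step h₁ h3] at h
        · rwa [before_step hj.1, edge_step hj.1 h3, image_step hj.1 h3]
    · exact absurd ⟨i, ⟨h₁, h₂⟩, x, rfl⟩ he
  · exact fun h => Or.inl ⟨i, ⟨h₁, h₂⟩, x, rfl, h⟩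

theorem outer_iff {i : ℕ} : i ∈ O.outer ↔ (1 ≤ i ∧ i < O.s) ∨ (O.t' < i ∧ i ≤ G.d) := by
  obtain ⟨b₁, b₂, b₃, b₄, b₅⟩ := O.bounds
  simp only [outer, mem_union, mem_Icc]
  omega

theorem middle_iff {i : ℕ} : i ∈ O.middle ↔ O.t < i ∧ i < O.s' := by
  obtain ⟨b₁, b₂, b₃, b₄, b₅⟩ := O.bounds
  simp only [middle, mem_Icc]
  omega

/-- The side `x` of the outer tile `G_i` is not glued to an overlap. -/
def OuterFree (O : SelfOverlap G f) (i : ℕ) (x : Side) : Prop :=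
  ¬ (i + 1 = O.s ∧ x = G.outSide i) ∧ ¬ (i = O.t' + 1 ∧ x = G.inSide O.t')

/-- The side `x` of the middle tile `G_i` is not glued to an overlap. -/
def MiddleFree (O : SelfOverlap G f) (i : ℕ) (x : Side) : Prop :=
  ¬ (i + 1 = O.s' ∧ x = G.outSide i) ∧ ¬ (i = O.t + 1 ∧ x = G.inSide O.t)

theorem glue3_outer_iff (hR : O.Regular) {i : ℕ} {x : Side} (hi : i ∈ O.outer)
    (hx : O.OuterFree i x) {b : ℕ × Side} : O.G3.Glue (i, x) b ↔ G.complex.Glue (i, x) b := by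
  obtain ⟨b₁, b₂, b₃, b₄, b₅⟩ := O.bounds
  rw [outer_iff] at hi
  rw [glue3_tile_iff hR, G.glue_tile_iff (by omega) (by omega)]
  obtain ⟨hx₁, hx₂⟩ := hx
  constructor
  · rintro (⟨h, h', h'', h3⟩ | ⟨h, h', h'', h3⟩ | ⟨h, h', h'', h3⟩ | ⟨h, h', h'', h3⟩)
    · exact Or.inl ⟨by omega, h'', h3⟩
    · exact Or.inr ⟨h, h'', h3⟩
    · omega
    · exact absurd ⟨h', h''⟩ hx₂
  · rintro (⟨h, h', h3⟩ | ⟨h, h', h3⟩)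
    · exact Or.inl ⟨by omega, by omega, h', h3⟩
    · by_cases hi' : i = O.t' + 1
      · subst hi'
        exact absurd ⟨rfl, h'⟩ hx₂
      · exact Or.inr (Or.inl ⟨h, by omega, h', h3⟩)

theorem glue4_middle_iff (hR : O.Regular) {i : ℕ} {x : Side} (hi : i ∈ O.middle)
    (hx : O.MiddleFree i x) {b : ℕ × Side} : O.G4.Glue (i, x) b ↔ G.complex.Glue (i, x) b := by
  obtain ⟨b₁, b₂, b₃, b₄, b₅⟩ := O.bounds
  rw [middle_iff] at hi
  rw [glue4_tile_iff hR, G.glue_tile_iff (by omega) (by omega)]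
  obtain ⟨hx₁, hx₂⟩ := hx
  constructor
  · rintro (⟨h, h', h'', h3⟩ | ⟨h, h', h'', h3⟩ | ⟨h', h'', h3⟩ | ⟨h', h'', h3⟩)
    · exact Or.inl ⟨by omega, h'', h3⟩
    · exact Or.inr ⟨by omega, h'', h3⟩
    · exact absurd ⟨by omega, by rw [h'', h']⟩ hx₁
    · omega
  · rintro (⟨h, h', h3⟩ | ⟨h, h', h3⟩)
    · exact Or.inl ⟨by omega, lt_of_le_of_ne (by omega) fun h4 => hx₁ ⟨h4, h'⟩, h', h3⟩
    · exact Or.inr (Or.inl ⟨by omega, by omega, h', h3⟩)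

theorem glue_outer (hR : O.Regular) {i j : ℕ} {x y : Side} (hi : i ∈ O.outer)
    (hx : O.OuterFree i x) (h : G.complex.Glue (i, x) (j, y)) :
    j ∈ O.outer ∧ O.OuterFree j y := by
  obtain ⟨b₁, b₂, b₃, b₄, b₅⟩ := O.bounds
  have hlt := hR.lt
  rw [outer_iff] at *
  rw [G.glue_tile_iff (by omega) (by omega)] at h
  obtain ⟨hx₁, hx₂⟩ := hx
  unfold OuterFree
  rcases h with ⟨h, h', h3⟩ | ⟨h, h', h3⟩ <;> obtain ⟨rfl, rfl⟩ := Prod.mk.inj h3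
  · have : ¬ i + 1 = O.s := fun h4 => hx₁ ⟨h4, h'⟩
    refine ⟨by omega, fun h => ?_, by omega⟩
    have h4 := congrArg Side.level h.2
    simp at h4
  · have : ¬ i = O.t' + 1 := by
      rintro rfl
      exact hx₂ ⟨rfl, h'⟩
    refine ⟨by omega, by omega, fun h => ?_⟩
    have h4 := congrArg Side.level h.2
    simp at h4

theorem glue_middle (hR : O.Regular) {i j : ℕ} {x y : Side} (hi : i ∈ O.middle)
    (hx : O.MiddleFree i x) (h : G.complex.Glue (i, x) (j, y)) :
    j ∈ O.middle ∧ O.MiddleFree j y := by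
  obtain ⟨b₁, b₂, b₃, b₄, b₅⟩ := O.bounds
  have hlt := hR.lt
  rw [middle_iff] at *
  rw [G.glue_tile_iff (by omega) (by omega)] at h
  obtain ⟨hx₁, hx₂⟩ := hx
  unfold MiddleFree
  rcases h with ⟨h, h', h3⟩ | ⟨h, h', h3⟩ <;> obtain ⟨rfl, rfl⟩ := Prod.mk.inj h3
  · have : ¬ i + 1 = O.s' := fun h4 => hx₁ ⟨h4, h'⟩
    refine ⟨by omega, fun h => ?_, by omega⟩
    have h4 := congrArg Side.level h.2
    simp at h4
  · have : ¬ i = O.t + 1 := by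
      rintro rfl
      exact hx₂ ⟨rfl, h'⟩
    refine ⟨by omega, by omega, fun h => ?_⟩
    have h4 := congrArg Side.level h.2
    simp at h4

theorem edge3_mem_overlap (hR : O.Regular) {i : ℕ} {x : Side} (hi : i ∈ O.outer) :
    O.G3.edge (i, x) ∈ O.G3.edgesOf O.overlap ↔ ¬ O.OuterFree i x := by
  obtain ⟨b₁, b₂, b₃, b₄, b₅⟩ := O.bounds
  have hlt := hR.lt
  constructor
  · rintro ⟨j, hj, y, he⟩ hx
    have hj' : O.s ≤ j ∧ j ≤ O.t := hj
    rcases (isChain3 hR).isStrip.edge_eq_iff.1 he with hij | hij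
    · obtain ⟨rfl, rfl⟩ := Prod.mk.inj hij
      rw [outer_iff] at hi
      omega
    · have := (glue_outer hR hi hx ((glue3_outer_iff hR hi hx).1 hij)).1
      rw [outer_iff] at this
      omega
  · intro h
    rw [outer_iff] at hi
    rw [OuterFree, not_and_or, not_not, not_not] at h
    rcases h with ⟨h, rfl⟩ | ⟨rfl, rfl⟩
    · exact ⟨i + 1, ⟨by omega, by omega⟩, _, edge_eq_of_glue (glue3_int hR (by omega) (by omega))⟩
    · exact ⟨O.t, ⟨by omega, by omega⟩, _, edge_eq_of_glue (glue3_new hR (by omega)).symm⟩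

theorem edge4_mem_overlap (hR : O.Regular) {i : ℕ} {x : Side} (hi : i ∈ O.middle) :
    O.G4.edge (i, x) ∈ O.G4.edgesOf O.overlap ↔ ¬ O.MiddleFree i x := by
  obtain ⟨b₁, b₂, b₃, b₄, b₅⟩ := O.bounds
  have hlt := hR.lt
  constructor
  · rintro ⟨j, hj, y, he⟩ hx
    have hj' : O.s ≤ j ∧ j ≤ O.t := hj
    rcases (isStrip4 hR).edge_eq_iff.1 he with hij | hij
    · obtain ⟨rfl, rfl⟩ := Prod.mk.inj hij
      rw [middle_iff] at hi
      omega
    · have := (glue_middle hR hi hx ((glue4_middle_iff hR hi hx).1 hij)).1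
      rw [middle_iff] at this
      omega
  · intro h
    rw [middle_iff] at hi
    rw [MiddleFree, not_and_or, not_not, not_not] at h
    rcases h with ⟨h, rfl⟩ | ⟨rfl, rfl⟩
    · refine ⟨O.s, ⟨by omega, by omega⟩, O.startSide,
        edge_eq_of_glue ((glue4_tile_iff hR).2 (Or.inr (Or.inr (Or.inl ⟨by omega, ?_, ?_⟩))))⟩
      · rw [show O.s' - 1 = i by omega]
      · rfl
    · exact ⟨O.t, ⟨by omega, by omega⟩, G.outSide O.t,
        edge_eq_of_glue ((glue4_tile_iff hR).2 (Or.inr (Or.inl ⟨by omega, by omega, rfl, rfl⟩)))⟩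

theorem mem_switch3_outer (hR : O.Regular) {m i : ℕ} {x : Side} {P : Set G.Edge}
    (hi : i ∈ O.outer) (hx : O.OuterFree i x) :
    O.G3.edge (i, x) ∈ O.switch3 m P ↔ G.edge i x ∈ P := by
  have hn := mt (edge3_mem_overlap hR hi).1 (not_not.2 hx)
  constructor
  · rintro (⟨j, hj, y, he, h⟩ | ⟨he, j, hj, y, he', h⟩)
    · exact absurd ⟨j, hj, y, he⟩ hn
    · rcases (isChain3 hR).isStrip.edge_eq_iff.1 he' with hij | hij
      · obtain ⟨rfl, rfl⟩ := Prod.mk.inj hij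
        exact h
      · rw [SnakeGraph.edge, edge_eq_of_glue ((glue3_outer_iff hR hi hx).1 hij)]
        exact h
  · exact fun h => Or.inr ⟨hn, i, hi, x, rfl, h⟩

theorem mem_switch4_middle (hR : O.Regular) {m i : ℕ} {x : Side} {P : Set G.Edge}
    (hi : i ∈ O.middle) (hx : O.MiddleFree i x) :
    O.G4.edge (i, x) ∈ O.switch4 m P ↔ G.edge i x ∈ P := by
  have hn := mt (edge4_mem_overlap hR hi).1 (not_not.2 hx)
  constructor
  · rintro (⟨j, hj, y, he, h⟩ | ⟨he, j, hj, y, he', h⟩)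
    · exact absurd ⟨j, hj, y, he⟩ hn
    · rcases (isStrip4 hR).edge_eq_iff.1 he' with hij | hij
      · obtain ⟨rfl, rfl⟩ := Prod.mk.inj hij
        exact h
      · rw [SnakeGraph.edge, edge_eq_of_glue ((glue4_middle_iff hR hi hx).1 hij)]
        exact h
  · exact fun h => Or.inr ⟨hn, i, hi, x, rfl, h⟩

theorem edge_mem_overlap_outer (hR : O.Regular) {i : ℕ} {x : Side} (hi : i ∈ O.outer)
    (hx : O.OuterFree i x) : G.edge i x ∉ G.complex.edgesOf (Icc O.s O.t ∪ Icc O.s' O.t') := by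
  obtain ⟨b₁, b₂, b₃, b₄, b₅⟩ := O.bounds
  have hlt := hR.lt
  rintro ⟨j, hj, y, he⟩
  have hj' : O.s ≤ j ∧ j ≤ O.t ∨ O.s' ≤ j ∧ j ≤ O.t' := hj
  rcases G.isChain.isStrip.edge_eq_iff.1 he with hij | hij
  · obtain ⟨rfl, rfl⟩ := Prod.mk.inj hij
    rw [outer_iff] at hi
    omega
  · have := (glue_outer hR hi hx hij).1
    rw [outer_iff] at this
    omega

theorem edge_mem_overlap_middle (hR : O.Regular) {i : ℕ} {x : Side} (hi : i ∈ O.middle)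
    (hx : O.MiddleFree i x) : G.edge i x ∉ G.complex.edgesOf (Icc O.s O.t ∪ Icc O.s' O.t') := by
  obtain ⟨b₁, b₂, b₃, b₄, b₅⟩ := O.bounds
  have hlt := hR.lt
  rintro ⟨j, hj, y, he⟩
  have hj' : O.s ≤ j ∧ j ≤ O.t ∨ O.s' ≤ j ∧ j ≤ O.t' := hj
  rcases G.isChain.isStrip.edge_eq_iff.1 he with hij | hij
  · obtain ⟨rfl, rfl⟩ := Prod.mk.inj hij
    rw [middle_iff] at hi
    omega
  · have := (glue_middle hR hi hx hij).1
    rw [middle_iff] at this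
    omega

theorem mem_switchBack_outer (hR : O.Regular) {m i : ℕ} {x : Side} {P3 : Set O.G3.Edge}
    {P4 : Set O.G4.Edge} (hi : i ∈ O.outer) (hx : O.OuterFree i x) :
    G.edge i x ∈ O.switchBack m P3 P4 ↔ O.G3.edge (i, x) ∈ P3 := by
  obtain ⟨b₁, b₂, b₃, b₄, b₅⟩ := O.bounds
  have hn := edge_mem_overlap_outer hR hi hx
  constructor
  · rintro ((⟨j, hj, y, he, h⟩ | ⟨j, hj, y, he, h⟩) | ⟨-, ⟨j, hj, y, he, h⟩ | ⟨j, hj, y, he, h⟩⟩)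
    · exact absurd ⟨j, Or.inl hj, y, he⟩ hn
    · refine absurd ⟨j + (O.s' - O.s), Or.inr ?_, _, he⟩ hn
      have hj' : O.s ≤ j ∧ j ≤ O.t := hj
      exact ⟨by omega, by omega⟩
    · rcases G.isChain.isStrip.edge_eq_iff.1 he with hij | hij
      · obtain ⟨rfl, rfl⟩ := Prod.mk.inj hij
        exact h
      · rw [edge_eq_of_glue ((glue3_outer_iff hR hi hx).2 hij)]
        exact h
    · exfalso
      rw [middle_iff] at hj
      rcases G.isChain.isStrip.edge_eq_iff.1 he with hij | hij
      · obtain ⟨rfl, rfl⟩ := Prod.mk.inj hij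
        rw [outer_iff] at hi
        omega
      · have := (glue_outer hR hi hx hij).1
        rw [outer_iff] at this
        omega
  · exact fun h => Or.inr ⟨hn, Or.inl ⟨i, hi, x, rfl, h⟩⟩

theorem mem_switchBack_middle (hR : O.Regular) {m i : ℕ} {x : Side} {P3 : Set O.G3.Edge}
    {P4 : Set O.G4.Edge} (hi : i ∈ O.middle) (hx : O.MiddleFree i x) :
    G.edge i x ∈ O.switchBack m P3 P4 ↔ O.G4.edge (i, x) ∈ P4 := by
  obtain ⟨b₁, b₂, b₃, b₄, b₅⟩ := O.bounds
  have hn := edge_mem_overlap_middle hR hi hx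
  constructor
  · rintro ((⟨j, hj, y, he, h⟩ | ⟨j, hj, y, he, h⟩) | ⟨-, ⟨j, hj, y, he, h⟩ | ⟨j, hj, y, he, h⟩⟩)
    · exact absurd ⟨j, Or.inl hj, y, he⟩ hn
    · refine absurd ⟨j + (O.s' - O.s), Or.inr ?_, _, he⟩ hn
      have hj' : O.s ≤ j ∧ j ≤ O.t := hj
      exact ⟨by omega, by omega⟩
    · exfalso
      rw [outer_iff] at hj
      rcases G.isChain.isStrip.edge_eq_iff.1 he with hij | hij
      · obtain ⟨rfl, rfl⟩ := Prod.mk.inj hij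
        rw [middle_iff] at hi
        omega
      · have := (glue_middle hR hi hx hij).1
        rw [middle_iff] at this
        omega
    · rcases G.isChain.isStrip.edge_eq_iff.1 he with hij | hij
      · obtain ⟨rfl, rfl⟩ := Prod.mk.inj hij
        exact h
      · rw [edge_eq_of_glue ((glue4_middle_iff hR hi hx).2 hij)]
        exact h
  · exact fun h => Or.inr ⟨hn, Or.inr ⟨i, hi, x, rfl, h⟩⟩

theorem edge3_step (hR : O.Regular) {i : ℕ} (h₁ : O.s ≤ i) (h₂ : i < O.t) :
    O.G3.edge (i + 1, G.inSide i) = O.G3.edge (i, G.outSide i) := by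
  obtain ⟨b₁, b₂, b₃, b₄, b₅⟩ := O.bounds
  exact (edge_eq_of_glue (glue3_int hR (by omega) (Or.inl h₂))).symm

theorem edge4_step (hR : O.Regular) {i : ℕ} (h₁ : O.s ≤ i) (h₂ : i < O.t) :
    O.G4.edge (i + 1, G.inSide i) = O.G4.edge (i, G.outSide i) := by
  have hlt := hR.lt
  exact (edge_eq_of_glue ((glue4_tile_iff hR).2 (Or.inl ⟨h₁, by omega, rfl, rfl⟩))).symm

theorem mem_switchBack_left (hR : O.Regular) {m i : ℕ} {P3 : Set O.G3.Edge}
    {P4 : Set O.G4.Edge} (h₁ : O.s ≤ i) (h₂ : i ≤ O.t) (x : Side) :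
    G.edge i x ∈ O.switchBack m P3 P4 ↔ (O.Before m i x ∧ O.G3.edge (i, x) ∈ P3) ∨
      (¬ O.Before m i x ∧ O.G4.edge (i, x) ∈ P4) := by
  obtain ⟨b₁, b₂, b₃, b₄, b₅⟩ := O.bounds
  have hlt := hR.lt
  constructor
  · rintro ((⟨j, hj, y, he, h⟩ | ⟨j, hj, y, he, h⟩) | ⟨hn, -⟩)
    · have hj' : O.s ≤ j ∧ j ≤ O.t := hj
      rcases (G.edge_eq_iff (by omega) (by omega)).1 he with ⟨rfl, rfl⟩ | ⟨h3, rfl, rfl, rfl⟩ |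
        ⟨h3, rfl, h4, rfl⟩
      · exact h
      · rwa [before_step h₁, edge3_step hR h₁ (by omega), edge4_step hR h₁ (by omega)] at h
      · obtain rfl : i = j + 1 := by omega
        simp only [Nat.add_sub_cancel] at h ⊢
        rwa [before_step hj.1, edge3_step hR hj.1 (by omega), edge4_step hR hj.1 (by omega)]
    · have hj' : O.s ≤ j ∧ j ≤ O.t := hj
      exfalso
      rcases (G.edge_eq_iff (by omega) (by omega)).1 he with ⟨h3, -⟩ | ⟨h3, -, h4, -⟩ |
        ⟨h3, -, h4, -⟩ <;> omega
    · exact absurd ⟨i, Or.inl ⟨h₁, h₂⟩, x, rfl⟩ hn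
  · exact fun h => Or.inl (Or.inl ⟨i, ⟨h₁, h₂⟩, x, rfl, h⟩)

theorem mem_switchBack_right (hR : O.Regular) {m i : ℕ} {P3 : Set O.G3.Edge}
    {P4 : Set O.G4.Edge} (h₁ : O.s ≤ i) (h₂ : i ≤ O.t) (x : Side) :
    O.image i x ∈ O.switchBack m P3 P4 ↔ (O.Before m i x ∧ O.G4.edge (i, x) ∈ P4) ∨
      (¬ O.Before m i x ∧ O.G3.edge (i, x) ∈ P3) := by
  obtain ⟨b₁, b₂, b₃, b₄, b₅⟩ := O.bounds
  have hlt := hR.lt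
  constructor
  · rintro ((⟨j, hj, y, he, h⟩ | ⟨j, hj, y, he, h⟩) | ⟨hn, -⟩)
    · have hj' : O.s ≤ j ∧ j ≤ O.t := hj
      exfalso
      rcases (G.edge_eq_iff (by omega) (by omega)).1 he with ⟨h3, -⟩ | ⟨h3, -, h4, -⟩ |
        ⟨h3, -, h4, -⟩ <;> omega
    · have hj' : O.s ≤ j ∧ j ≤ O.t := hj
      rcases (G.edge_eq_iff (by omega) (by omega)).1 he with ⟨h3, h4⟩ | ⟨h3, h5, h4, h6⟩ |
        ⟨h3, h5, h4, h6⟩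
      · obtain rfl : i = j := by omega
        rwa [ρ_injective h4]
      · obtain rfl : j = i + 1 := by omega
        rw [← ρ_outSide h₁ (by omega)] at h5
        rw [← ρ_inSide h₁ (by omega)] at h6
        rw [ρ_injective h5]
        rwa [ρ_injective h6, before_step h₁, edge3_step hR h₁ (by omega),
          edge4_step hR h₁ (by omega)] at h
      · obtain rfl : i = j + 1 := by omega
        rw [show j + 1 + (O.s' - O.s) - 1 = j + (O.s' - O.s) by omega] at h5 h6
        rw [← ρ_outSide hj.1 (by omega)] at h6
        rw [← ρ_inSide hj.1 (by omega)] at h5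
        rw [ρ_injective h5]
        rwa [before_step hj.1, edge3_step hR hj.1 (by omega), edge4_step hR hj.1 (by omega),
          ← ρ_injective h6]
    · exact absurd ⟨i + (O.s' - O.s), Or.inr ⟨by omega, by omega⟩, O.ρ x, rfl⟩ hn
  · exact fun h => Or.inl (Or.inr ⟨i, ⟨h₁, h₂⟩, x, rfl, h⟩)

end SelfOverlap

/-! ### Switching positions in terms of selections -/

/-- A selection is determined on a tile by its value on one side. -/
theorem TileComplex.IsSelection.congr {p q : ℕ × Side → Prop} (hp : IsSelection p)
    (hq : IsSelection q) {i j : ℕ} {x : Side} (h : p (i, x) ↔ q (j, x)) (y : Side) :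
    p (i, y) ↔ q (j, y) := by
  by_cases hl : y.level = x.level
  · rcases Side.eq_or_eq_reflect_of_level hl with rfl | rfl
    · exact h
    · rw [hp.reflect, hq.reflect, h]
  · rcases Side.eq_cofoot_or_of_level_ne hl with rfl | rfl
    · rw [hp.cofoot, hq.cofoot, h]
    · rw [hp.cofoot, hq.cofoot, hp.reflect, hq.reflect, h]

namespace SelfOverlap

variable {G : SnakeGraph} {f : G.Edge → Bool} {O : SelfOverlap G f}

theorem isSelection_shift {σ : ℕ × Side → Prop} (hσ : IsSelection σ) :
    IsSelection (O.shift σ) := by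
  constructor <;> intro i x <;> simp only [shift]
  · rw [O.ρ_reflect, hσ.reflect]
  · rw [O.ρ_cofoot, hσ.cofoot]

variable (O)

/-- Two selections `p` and `q` on the overlap meet at position `m`: they agree on the `m`-th tile,
or the condition `L` (respectively `R`) at the beginning (at the end) of the overlap holds. -/
structure Agree (m : ℕ) (p q : ℕ × Side → Prop) (L R : Prop) : Prop where
  start : m = 0 → L
  tile : ∀ i, O.s ≤ i → i ≤ O.t → i + 1 = O.s + m → ∀ x, p (i, x) ↔ q (i, x)
  finish : m = O.t - O.s + 2 → R

/-- The edges `e_{s-1}` and `e_{s'-1}` are selected by the tiles before them. -/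
def EndL (X Y : ℕ × Side → Prop) : Prop :=
  (1 < O.s → X (O.s - 1, G.outSide (O.s - 1))) ∧ Y (O.s' - 1, G.outSide (O.s' - 1))

/-- The edges `e_t` and `e_{t'}` are selected by the tiles after them. -/
def EndR (X Y : ℕ × Side → Prop) : Prop :=
  Y (O.t + 1, G.inSide O.t) ∧ (O.t' < G.d → X (O.t' + 1, G.inSide O.t'))

/-- The selections `X` on `G₃` and `Y` on `G₄°` arise from the selection `σ` on `G` by switching at
position `m`. -/
structure IsSplice (m : ℕ) (σ X Y : ℕ × Side → Prop) : Prop where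
  before : ∀ i, O.s ≤ i → i ≤ O.t → i < O.s + m → ∀ x,
    (X (i, x) ↔ σ (i, x)) ∧ (Y (i, x) ↔ O.shift σ (i, x))
  after : ∀ i, O.s ≤ i → i ≤ O.t → O.s + m ≤ i → ∀ x,
    (X (i, x) ↔ O.shift σ (i, x)) ∧ (Y (i, x) ↔ σ (i, x))
  outer : ∀ i ∈ O.outer, ∀ x, X (i, x) ↔ σ (i, x)
  middle : ∀ i ∈ O.middle, ∀ x, Y (i, x) ↔ σ (i, x)

/-- The interior glueings of the overlap are admissible. -/
def AdmOverlap (p : ℕ × Side → Prop) : Prop :=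
  ∀ i, O.s ≤ i → i < O.t → p (i, G.outSide i) ∨ p (i + 1, G.inSide i)

/-- The glueings between outer tiles are admissible. -/
def AdmOuter (p : ℕ × Side → Prop) : Prop :=
  ∀ i, 1 ≤ i → (i + 1 < O.s ∨ (O.t' < i ∧ i < G.d)) → p (i, G.outSide i) ∨ p (i + 1, G.inSide i)

/-- The glueings between middle tiles are admissible. -/
def AdmMiddle (p : ℕ × Side → Prop) : Prop :=
  ∀ i, O.t < i → i + 1 < O.s' → p (i, G.outSide i) ∨ p (i + 1, G.inSide i)

variable {O}

/-- Admissibility on `G`, split into the two copies of the overlap, the outer and the middle tiles, and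
the four edges in which the overlaps meet other tiles. -/
theorem admissible1_iff' (hR : O.Regular) {σ : ℕ × Side → Prop} :
    G.complex.Admissible G.complex.tiles σ ↔
      O.AdmOverlap σ ∧ O.AdmOverlap (O.shift σ) ∧ O.AdmOuter σ ∧ O.AdmMiddle σ ∧
      (1 < O.s → σ (O.s - 1, G.outSide (O.s - 1)) ∨ σ (O.s, O.startSide.reflect)) ∧
      (σ (O.s' - 1, G.outSide (O.s' - 1)) ∨ O.shift σ (O.s, O.startSide)) ∧
      (σ (O.t, G.outSide O.t) ∨ σ (O.t + 1, G.inSide O.t)) ∧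
      (O.t' < G.d → O.shift σ (O.t, (G.outSide O.t).reflect) ∨ σ (O.t' + 1, G.inSide O.t')) := by
  obtain ⟨b₁, b₂, b₃, b₄, b₅⟩ := O.bounds
  have hlt := hR.lt
  have hs' : O.s + (O.s' - O.s) = O.s' := by omega
  have e₁ : O.shift σ (O.s, O.startSide) ↔ σ (O.s', G.inSide (O.s' - 1)) := by
    simp only [shift, hs', ρ_startSide]
  have e₂ (h : O.t' < G.d) : O.shift σ (O.t, (G.outSide O.t).reflect) ↔
      σ (O.t', G.outSide O.t') := by
    simp only [shift, ← b₄, ← hR.finish h, ρ_ρ]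
  have e₃ {i : ℕ} (h₁ : O.s ≤ i) (h₂ : i < O.t) :
      (O.shift σ (i, G.outSide i) ∨ O.shift σ (i + 1, G.inSide i)) ↔
      (σ (i + (O.s' - O.s), G.outSide (i + (O.s' - O.s))) ∨
        σ (i + (O.s' - O.s) + 1, G.inSide (i + (O.s' - O.s)))) := by
    simp only [shift, ρ_outSide h₁ h₂, ρ_inSide h₁ h₂]
    rw [show i + 1 + (O.s' - O.s) = i + (O.s' - O.s) + 1 by omega]
  rw [G.admissible_iff]
  constructor
  · intro h
    refine ⟨fun i h₁ h₂ => h i (by omega) (by omega), fun i h₁ h₂ => (e₃ h₁ h₂).2 ?_,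
      fun i h₁ h₂ => h i h₁ (by omega), fun i h₁ h₂ => h i (by omega) (by omega), fun hs => ?_, ?_,
      h O.t (by omega) (by omega), fun ht => (or_congr_left (e₂ ht)).2 (h _ (by omega) ht)⟩
    · exact h _ (by omega) (by omega)
    · have := h (O.s - 1) (by omega) (by omega)
      rwa [hR.start hs, Nat.sub_add_cancel b₁] at this
    · have := h (O.s' - 1) (by omega) (by omega)
      rwa [Nat.sub_add_cancel (by omega), ← e₁] at this
  · rintro ⟨h₁, h₂, h₃, h₄, h₅, h₆, h₇, h₈⟩ i hi₁ hi₂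
    rcases lt_trichotomy (i + 1) O.s with h | h | h
    · exact h₃ i hi₁ (Or.inl h)
    · obtain rfl : i = O.s - 1 := by omega
      have := h₅ (by omega)
      rwa [Nat.sub_add_cancel b₁, hR.start (by omega)]
    · rcases lt_trichotomy i O.t with h' | rfl | h'
      · exact h₁ i (by omega) h'
      · exact h₇
      · rcases lt_trichotomy (i + 1) O.s' with h'' | h'' | h''
        · exact h₄ i h' h''
        · obtain rfl : i = O.s' - 1 := by omega
          rwa [Nat.sub_add_cancel (by omega), ← e₁]
        · rcases lt_trichotomy i O.t' with h3 | rfl | h3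
          · have := (e₃ (i := i - (O.s' - O.s)) (by omega) (by omega)).1
              (h₂ _ (by omega) (by omega))
            rwa [Nat.sub_add_cancel (by omega)] at this
          · rw [← e₂ hi₂]
            exact h₈ hi₂
          · exact h₃ i hi₁ (Or.inr ⟨h3, hi₂⟩)

theorem admissible3_iff' (hR : O.Regular) {σ : ℕ × Side → Prop} :
    O.G3.Admissible O.G3.tiles σ ↔ O.AdmOverlap σ ∧ O.AdmOuter σ ∧
      (1 < O.s → σ (O.s - 1, G.outSide (O.s - 1)) ∨ σ (O.s, O.startSide.reflect)) ∧
      (O.t' < G.d → σ (O.t, (G.outSide O.t).reflect) ∨ σ (O.t' + 1, G.inSide O.t')) := by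
  obtain ⟨b₁, b₂, b₃, b₄, b₅⟩ := O.bounds
  rw [admissible3_iff hR]
  constructor
  · rintro ⟨h, h'⟩
    refine ⟨fun i h₁ h₂ => h i (by omega) (by omega), fun i h₁ h₂ => h i h₁ (by omega), fun hs => ?_,
      h'⟩
    have := h (O.s - 1) (by omega) (by omega)
    rwa [hR.start hs, Nat.sub_add_cancel b₁] at this
  · rintro ⟨h₁, h₂, h₃, h₄⟩
    refine ⟨fun i hi₁ hi₂ => ?_, h₄⟩
    rcases lt_trichotomy (i + 1) O.s with h | h | h
    · exact h₂ i hi₁ (Or.inl h)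
    · obtain rfl : i = O.s - 1 := by omega
      have := h₃ (by omega)
      rwa [Nat.sub_add_cancel b₁, hR.start (by omega)]
    · by_cases h' : i < O.t
      · exact h₁ i (by omega) h'
      · exact h₂ i hi₁ (by omega)

theorem admissible4_iff' (hR : O.Regular) {σ : ℕ × Side → Prop} :
    O.G4.Admissible O.G4.tiles σ ↔ O.AdmOverlap σ ∧ O.AdmMiddle σ ∧
      (σ (O.s' - 1, G.outSide (O.s' - 1)) ∨ σ (O.s, O.startSide)) ∧
      (σ (O.t, G.outSide O.t) ∨ σ (O.t + 1, G.inSide O.t)) := by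
  obtain ⟨b₁, b₂, b₃, b₄, b₅⟩ := O.bounds
  have hlt := hR.lt
  rw [admissible4_iff hR]
  constructor
  · rintro ⟨h, h'⟩
    exact ⟨fun i h₁ h₂ => h i h₁ (by omega), fun i h₁ h₂ => h i (by omega) h₂, h',
      h _ b₂ hlt⟩
  · rintro ⟨h₁, h₂, h₃, h₄⟩
    refine ⟨fun i hi₁ hi₂ => ?_, h₃⟩
    rcases lt_trichotomy i O.t with h | rfl | h
    · exact h₁ i hi₁ h
    · exact h₄
    · exact h₂ i h hi₂

theorem mem_outer_start (h : 1 < O.s) : O.s - 1 ∈ O.outer := by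
  rw [outer_iff]; omega

theorem mem_outer_finish (h : O.t' < G.d) : O.t' + 1 ∈ O.outer := by
  rw [outer_iff]; omega

theorem mem_middle_start (hR : O.Regular) : O.t + 1 ∈ O.middle := by
  rw [middle_iff]
  exact ⟨by omega, hR.lt⟩

theorem mem_middle_finish (hR : O.Regular) : O.s' - 1 ∈ O.middle := by
  have := hR.lt
  rw [middle_iff]
  omega

namespace IsSplice

variable {m : ℕ} {σ X Y : ℕ × Side → Prop}

theorem endL_iff (hR : O.Regular) (h : O.IsSplice m σ X Y) : O.EndL X Y ↔ O.EndL σ σ := by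
  refine and_congr (forall_congr' fun hs => ?_) ?_
  · exact h.outer _ (mem_outer_start hs) _
  · exact h.middle _ (mem_middle_finish hR) _

theorem endR_iff (hR : O.Regular) (h : O.IsSplice m σ X Y) : O.EndR X Y ↔ O.EndR σ σ := by
  refine and_congr ?_ (forall_congr' fun hs => ?_)
  · exact h.middle _ (mem_middle_start hR) _
  · exact h.outer _ (mem_outer_finish hs) _

theorem agree_iff (hR : O.Regular) (h : O.IsSplice m σ X Y) {k : ℕ} :
    O.Agree k X Y (O.EndL X Y) (O.EndR X Y) ↔
      O.Agree k σ (O.shift σ) (O.EndL σ σ) (O.EndR σ σ) := by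
  have key : ∀ i, O.s ≤ i → i ≤ O.t → ∀ x, (X (i, x) ↔ Y (i, x)) ↔
      (σ (i, x) ↔ O.shift σ (i, x)) := by
    intro i h₁ h₂ x
    by_cases hi : i < O.s + m
    · rw [(h.before i h₁ h₂ hi x).1, (h.before i h₁ h₂ hi x).2]
    · rw [(h.after i h₁ h₂ (not_lt.1 hi) x).1, (h.after i h₁ h₂ (not_lt.1 hi) x).2]
      exact iff_comm
  rw [h.endL_iff hR, h.endR_iff hR]
  constructor
  · rintro ⟨h₁, h₂, h₃⟩
    exact ⟨h₁, fun i hi hi' him x => (key i hi hi' x).1 (h₂ i hi hi' him x), h₃⟩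
  · rintro ⟨h₁, h₂, h₃⟩
    exact ⟨h₁, fun i hi hi' him x => (key i hi hi' x).2 (h₂ i hi hi' him x), h₃⟩

/-- Also on the `m`-th tile, `X` and `Y` can be regarded as being after position `m`. -/
theorem after' (h : O.IsSplice m σ X Y) {L R : Prop} (ha : O.Agree m σ (O.shift σ) L R) {i : ℕ}
    (h₁ : O.s ≤ i) (h₂ : i ≤ O.t) (h₃ : O.s + m ≤ i + 1) (x : Side) :
    (X (i, x) ↔ O.shift σ (i, x)) ∧ (Y (i, x) ↔ σ (i, x)) := by
  by_cases hi : i < O.s + m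
  · have h4 := ha.tile i h₁ h₂ (by omega) x
    obtain ⟨h5, h6⟩ := h.before i h₁ h₂ hi x
    exact ⟨h5.trans h4, h6.trans h4.symm⟩
  · exact h.after i h₁ h₂ (not_lt.1 hi) x

/-- Switching where the selections meet preserves admissibility, since inside of the overlap the
glueings of the two copies are only exchanged, and those at its ends are controlled by `Agree`. -/
theorem admissible_iff (hR : O.Regular) (h : O.IsSplice m σ X Y)
    (hm : m ≤ O.t - O.s + 2) (ha : O.Agree m σ (O.shift σ) (O.EndL σ σ) (O.EndR σ σ)) :
    (O.G3.Admissible O.G3.tiles X ∧ O.G4.Admissible O.G4.tiles Y) ↔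
      G.complex.Admissible G.complex.tiles σ := by
  obtain ⟨b₁, b₂, b₃, b₄, b₅⟩ := O.bounds
  have hlt := hR.lt
  rw [admissible1_iff' hR, admissible3_iff' hR, admissible4_iff' hR]
  have h₁ : (O.AdmOverlap X ∧ O.AdmOverlap Y) ↔ (O.AdmOverlap σ ∧ O.AdmOverlap (O.shift σ)) := by
    have key : ∀ i, O.s ≤ i → i < O.t →
        (((X (i, G.outSide i) ∨ X (i + 1, G.inSide i)) ∧
          (Y (i, G.outSide i) ∨ Y (i + 1, G.inSide i))) ↔
        ((σ (i, G.outSide i) ∨ σ (i + 1, G.inSide i)) ∧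
          (O.shift σ (i, G.outSide i) ∨ O.shift σ (i + 1, G.inSide i)))) := by
      intro i hi₁ hi₂
      by_cases hi : i + 1 < O.s + m
      · rw [(h.before i hi₁ (by omega) (by omega) _).1, (h.before i hi₁ (by omega) (by omega) _).2,
          (h.before (i + 1) (by omega) (by omega) (by omega) _).1,
          (h.before (i + 1) (by omega) (by omega) (by omega) _).2]
      · rw [(h.after' ha hi₁ (by omega) (by omega) _).1, (h.after' ha hi₁ (by omega) (by omega) _).2,
          (h.after (i + 1) (by omega) (by omega) (by omega) _).1,
          (h.after (i + 1) (by omega) (by omega) (by omega) _).2, and_comm]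
    constructor
    · rintro ⟨hX, hY⟩
      exact ⟨fun i hi₁ hi₂ => ((key i hi₁ hi₂).1 ⟨hX i hi₁ hi₂, hY i hi₁ hi₂⟩).1,
        fun i hi₁ hi₂ => ((key i hi₁ hi₂).1 ⟨hX i hi₁ hi₂, hY i hi₁ hi₂⟩).2⟩
    · rintro ⟨hX, hY⟩
      exact ⟨fun i hi₁ hi₂ => ((key i hi₁ hi₂).2 ⟨hX i hi₁ hi₂, hY i hi₁ hi₂⟩).1,
        fun i hi₁ hi₂ => ((key i hi₁ hi₂).2 ⟨hX i hi₁ hi₂, hY i hi₁ hi₂⟩).2⟩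
  have h₂ : O.AdmOuter X ↔ O.AdmOuter σ := by
    refine forall_congr' fun i => forall_congr' fun hi₁ => forall_congr' fun hi₂ => ?_
    rw [h.outer i (by rw [outer_iff]; omega), h.outer (i + 1) (by rw [outer_iff]; omega)]
  have h₃ : O.AdmMiddle Y ↔ O.AdmMiddle σ := by
    refine forall_congr' fun i => forall_congr' fun hi₁ => forall_congr' fun hi₂ => ?_
    rw [h.middle i (by rw [middle_iff]; omega), h.middle (i + 1) (by rw [middle_iff]; omega)]
  have h₄ : (1 < O.s → X (O.s - 1, G.outSide (O.s - 1)) ∨ X (O.s, O.startSide.reflect)) ↔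
      (1 < O.s → σ (O.s - 1, G.outSide (O.s - 1)) ∨ σ (O.s, O.startSide.reflect)) := by
    refine forall_congr' fun hs => ?_
    rw [h.outer _ (mem_outer_start hs)]
    by_cases hm : m = 0
    · simp only [(ha.start hm).1 hs, true_or]
    · rw [(h.before _ le_rfl b₂ (by omega) _).1]
  have h₅ : (Y (O.s' - 1, G.outSide (O.s' - 1)) ∨ Y (O.s, O.startSide)) ↔
      (σ (O.s' - 1, G.outSide (O.s' - 1)) ∨ O.shift σ (O.s, O.startSide)) := by
    rw [h.middle _ (mem_middle_finish hR)]
    by_cases hm : m = 0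
    · simp only [(ha.start hm).2, true_or]
    · rw [(h.before _ le_rfl b₂ (by omega) _).2]
  have h₆ :
      ((Y (O.t, G.outSide O.t) ∨ Y (O.t + 1, G.inSide O.t)) ↔
      (σ (O.t, G.outSide O.t) ∨ σ (O.t + 1, G.inSide O.t))) := by
    rw [h.middle _ (mem_middle_start hR)]
    by_cases hm' : m = O.t - O.s + 2
    · simp only [(ha.finish hm').1, or_true]
    · rw [(h.after' ha b₂ le_rfl (by omega) _).2]
  have h₇ :
      ((O.t' < G.d → X (O.t, (G.outSide O.t).reflect) ∨ X (O.t' + 1, G.inSide O.t')) ↔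
      (O.t' < G.d → O.shift σ (O.t, (G.outSide O.t).reflect) ∨ σ (O.t' + 1, G.inSide O.t'))) := by
    refine forall_congr' fun hs => ?_
    rw [h.outer _ (mem_outer_finish hs)]
    by_cases hm' : m = O.t - O.s + 2
    · simp only [(ha.finish hm').2 hs, or_true]
    · rw [(h.after' ha b₂ le_rfl (by omega) _).1]
  rw [h₂, h₃, h₄, h₅, h₆, h₇]
  constructor
  · rintro ⟨⟨c₁, c₂, c₃, c₄⟩, c₅, c₆, c₇, c₈⟩
    obtain ⟨d₁, d₂⟩ := h₁.1 ⟨c₁, c₅⟩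
    exact ⟨d₁, d₂, c₂, c₆, c₃, c₇, c₈, c₄⟩
  · rintro ⟨d₁, d₂, c₂, c₆, c₃, c₇, c₈, c₄⟩
    obtain ⟨c₁, c₅⟩ := h₁.2 ⟨d₁, d₂⟩
    exact ⟨⟨c₁, c₂, c₃, c₄⟩, c₅, c₆, c₇, c₈⟩

/-- Outside of the overlaps, `X` and `Y` give the same edges as `σ`. -/
theorem matching_outer (hR : O.Regular) (h : O.IsSplice m σ X Y) {i : ℕ} {x : Side}
    (hi : i ∈ O.outer) (hx : O.OuterFree i x) : O.G3.edge (i, x) ∈ O.G3.matching O.G3.tiles X ↔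
      G.edge i x ∈ G.complex.matching G.complex.tiles σ := by
  have b := O.bounds
  have mem₁ {j : ℕ} (hj : j ∈ O.outer) : j ∈ G.complex.tiles := by
    rw [outer_iff] at hj
    exact ⟨by omega, by omega⟩
  have mem₃ {j : ℕ} (hj : j ∈ O.outer) : j ∈ O.G3.tiles := Or.inl hj
  rw [(isChain3 hR).isStrip.mem_matching (mem₃ hi), SnakeGraph.edge,
    G.isChain.isStrip.mem_matching (mem₁ hi), h.outer i hi]
  refine and_congr_right fun _ => forall_congr' fun b => ?_
  rw [glue3_outer_iff hR hi hx]
  refine forall_congr' fun hb => ?_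
  have hb' := (glue_outer hR hi hx hb).1
  simp only [mem₁ hb', mem₃ hb', h.outer b.1 hb' b.2, forall_const]

theorem matching_middle (hR : O.Regular) (h : O.IsSplice m σ X Y) {i : ℕ} {x : Side}
    (hi : i ∈ O.middle) (hx : O.MiddleFree i x) :
    O.G4.edge (i, x) ∈ O.G4.matching O.G4.tiles Y ↔
      G.edge i x ∈ G.complex.matching G.complex.tiles σ := by
  obtain ⟨b₁, b₂, b₃, b₄, b₅⟩ := O.bounds
  have mem₁ {j : ℕ} (hj : j ∈ O.middle) : j ∈ G.complex.tiles := by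
    rw [middle_iff] at hj
    exact ⟨by omega, by omega⟩
  have mem₄ {j : ℕ} (hj : j ∈ O.middle) : j ∈ O.G4.tiles := Or.inr hj
  rw [(isStrip4 hR).mem_matching (mem₄ hi), SnakeGraph.edge,
    G.isChain.isStrip.mem_matching (mem₁ hi), h.middle i hi]
  refine and_congr_right fun _ => forall_congr' fun b => ?_
  rw [glue4_middle_iff hR hi hx]
  refine forall_congr' fun hb => ?_
  have hb' := (glue_middle hR hi hx hb).1
  simp only [mem₁ hb', mem₄ hb', h.middle b.1 hb' b.2, forall_const]

theorem atA_atB {i : ℕ} {x : Side} (h : m = 0 → O.EndL σ σ)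
    (hx : m = 0 ∨ ¬ (i = O.s ∧ x.level = 0)) :
    O.AtA (σ (O.s - 1, G.outSide (O.s - 1))) i x ∧ O.AtB (σ (O.s' - 1, G.outSide (O.s' - 1))) i x := by
  rcases hx with hx | hx
  · exact ⟨fun _ _ => (h hx).1, fun _ _ => (h hx).2⟩
  · exact ⟨fun hi hx' => absurd ⟨hi, by rw [hx', Side.level_reflect, level_startSide]⟩ hx,
      fun hi hx' => absurd ⟨hi, by rw [hx', level_startSide]⟩ hx⟩

theorem atC_atD {i : ℕ} {x : Side} (h : m = O.t - O.s + 2 → O.EndR σ σ)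
    (hx : m = O.t - O.s + 2 ∨ ¬ (i = O.t ∧ x.level = 1)) :
    O.AtC (σ (O.t + 1, G.inSide O.t)) i x ∧ O.AtD (σ (O.t' + 1, G.inSide O.t')) i x := by
  rcases hx with hx | hx
  · exact ⟨fun _ _ => (h hx).1, fun _ _ => (h hx).2⟩
  · exact ⟨fun hi hx' => absurd ⟨hi, by rw [hx', SnakeGraph.level_outSide]⟩ hx,
      fun hi hx' => absurd ⟨hi, by rw [hx', Side.level_reflect, SnakeGraph.level_outSide]⟩ hx⟩

theorem atA_iff (h : O.IsSplice m σ X Y) {i : ℕ} {x : Side} :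
    O.AtA (X (O.s - 1, G.outSide (O.s - 1))) i x ↔ O.AtA (σ (O.s - 1, G.outSide (O.s - 1))) i x :=
  forall_congr' fun _ => forall_congr' fun _ => forall_congr' fun hs =>
    h.outer _ (mem_outer_start hs) _

theorem atD_iff (h : O.IsSplice m σ X Y) {i : ℕ} {x : Side} :
    O.AtD (X (O.t' + 1, G.inSide O.t')) i x ↔ O.AtD (σ (O.t' + 1, G.inSide O.t')) i x :=
  forall_congr' fun _ => forall_congr' fun _ => forall_congr' fun ht =>
    h.outer _ (mem_outer_finish ht) _

theorem atB_iff (hR : O.Regular) (h : O.IsSplice m σ X Y) {i : ℕ} {x : Side} :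
    O.AtB (Y (O.s' - 1, G.outSide (O.s' - 1))) i x ↔
      O.AtB (σ (O.s' - 1, G.outSide (O.s' - 1))) i x :=
  forall_congr' fun _ => forall_congr' fun _ => h.middle _ (mem_middle_finish hR) _

theorem atC_iff (hR : O.Regular) (h : O.IsSplice m σ X Y) {i : ℕ} {x : Side} :
    O.AtC (Y (O.t + 1, G.inSide O.t)) i x ↔ O.AtC (σ (O.t + 1, G.inSide O.t)) i x :=
  forall_congr' fun _ => forall_congr' fun _ => h.middle _ (mem_middle_start hR) _

theorem X_eq (h : O.IsSplice m σ X Y) (j : ℕ) (h₁ : O.s ≤ j) (h₂ : j ≤ O.t) (z : Side) :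
    X (j, z) ↔ if j < O.s + m then σ (j, z) else O.shift σ (j, z) := by
  split_ifs with hj
  · exact (h.before j h₁ h₂ hj z).1
  · exact (h.after j h₁ h₂ (not_lt.1 hj) z).1

theorem Y_eq (h : O.IsSplice m σ X Y) (j : ℕ) (h₁ : O.s ≤ j) (h₂ : j ≤ O.t) (z : Side) :
    Y (j, z) ↔ if j < O.s + m then O.shift σ (j, z) else σ (j, z) := by
  split_ifs with hj
  · exact (h.before j h₁ h₂ hj z).2
  · exact (h.after j h₁ h₂ (not_lt.1 hj) z).2

theorem σ_eq (h : O.IsSplice m σ X Y) (j : ℕ) (h₁ : O.s ≤ j) (h₂ : j ≤ O.t) (z : Side) :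
    σ (j, z) ↔ if j < O.s + m then X (j, z) else Y (j, z) := by
  split_ifs with hj
  · exact (h.before j h₁ h₂ hj z).1.symm
  · exact (h.after j h₁ h₂ (not_lt.1 hj) z).2.symm

theorem shift_eq (h : O.IsSplice m σ X Y) (j : ℕ) (h₁ : O.s ≤ j) (h₂ : j ≤ O.t) (z : Side) :
    O.shift σ (j, z) ↔ if j < O.s + m then Y (j, z) else X (j, z) := by
  split_ifs with hj
  · exact (h.before j h₁ h₂ hj z).2.symm
  · exact (h.after j h₁ h₂ (not_lt.1 hj) z).1.symm

theorem switch3_eq (hR : O.Regular) (h : O.IsSplice m σ X Y) (hm : m ≤ O.t - O.s + 2)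
    (ha : O.Agree m σ (O.shift σ) (O.EndL σ σ) (O.EndR σ σ)) :
    O.switch3 m (G.complex.matching G.complex.tiles σ) = O.G3.matching O.G3.tiles X := by
  have b := O.bounds
  have key : ∀ i, O.s ≤ i → i ≤ O.t → ∀ x,
      O.G3.edge (i, x) ∈ O.switch3 m (G.complex.matching G.complex.tiles σ) ↔
        O.G3.edge (i, x) ∈ O.G3.matching O.G3.tiles X := by
    intro i h₁ h₂ x
    rw [mem_switch3 hR h₁ h₂, mem_matching_left hR h₁ h₂, mem_matching_right hR h₁ h₂,
      mem_matching3 hR h₁ h₂, h.atA_iff, h.atD_iff]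
    exact core_splice h₁ h₂ h.X_eq ha.tile (atA_atB ha.start) (atC_atD ha.finish) hm
  refine subset_edgesOf_ext (A := O.G3.tiles) ?_ (fun e he => he.1) ?_
  · rintro e (⟨i, hi, x, rfl, -⟩ | ⟨-, i, hi, x, rfl, -⟩)
    · exact ⟨i, Or.inr hi, x, rfl⟩
    · exact ⟨i, Or.inl hi, x, rfl⟩
  · rintro i (hi | hi) x
    · by_cases hx : O.OuterFree i x
      · rw [mem_switch3_outer hR hi hx, h.matching_outer hR hi hx]
      · obtain ⟨j, hj, y, he⟩ := (edge3_mem_overlap hR hi).2 hx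
        rw [he]
        exact key j hj.1 hj.2 y
    · exact key i hi.1 hi.2 x

theorem switch4_eq (hR : O.Regular) (h : O.IsSplice m σ X Y) (hm : m ≤ O.t - O.s + 2)
    (ha : O.Agree m σ (O.shift σ) (O.EndL σ σ) (O.EndR σ σ)) :
    O.switch4 m (G.complex.matching G.complex.tiles σ) = O.G4.matching O.G4.tiles Y := by
  have b := O.bounds
  have key : ∀ i, O.s ≤ i → i ≤ O.t → ∀ x,
      O.G4.edge (i, x) ∈ O.switch4 m (G.complex.matching G.complex.tiles σ) ↔
        O.G4.edge (i, x) ∈ O.G4.matching O.G4.tiles Y := by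
    intro i h₁ h₂ x
    rw [mem_switch4 hR h₁ h₂, mem_matching_left hR h₁ h₂, mem_matching_right hR h₁ h₂,
      mem_matching4 hR h₁ h₂, h.atB_iff hR, h.atC_iff hR]
    exact core_splice h₁ h₂ h.Y_eq (fun j h₁ h₂ hj z => (ha.tile j h₁ h₂ hj z).symm)
      (fun hx => (atA_atB ha.start hx).symm) (fun hx => (atC_atD ha.finish hx).symm) hm
  refine subset_edgesOf_ext (A := O.G4.tiles) ?_ (fun e he => he.1) ?_
  · rintro e (⟨i, hi, x, rfl, -⟩ | ⟨-, i, hi, x, rfl, -⟩)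
    · exact ⟨i, Or.inl hi, x, rfl⟩
    · exact ⟨i, Or.inr hi, x, rfl⟩
  · rintro i (hi | hi) x
    · exact key i hi.1 hi.2 x
    · by_cases hx : O.MiddleFree i x
      · rw [mem_switch4_middle hR hi hx, h.matching_middle hR hi hx]
      · obtain ⟨j, hj, y, he⟩ := (edge4_mem_overlap hR hi).2 hx
        rw [he]
        exact key j hj.1 hj.2 y

theorem switchBack_eq (hR : O.Regular) (h : O.IsSplice m σ X Y) (hm : m ≤ O.t - O.s + 2)
    (ha : O.Agree m σ (O.shift σ) (O.EndL σ σ) (O.EndR σ σ)) :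
    O.switchBack m (O.G3.matching O.G3.tiles X) (O.G4.matching O.G4.tiles Y) =
      G.complex.matching G.complex.tiles σ := by
  obtain ⟨b₁, b₂, b₃, b₄, b₅⟩ := O.bounds
  have ha' := ((h.agree_iff hR).2 ha).tile
  have keyL : ∀ i, O.s ≤ i → i ≤ O.t → ∀ x,
      G.edge i x ∈ O.switchBack m (O.G3.matching O.G3.tiles X) (O.G4.matching O.G4.tiles Y) ↔
        G.edge i x ∈ G.complex.matching G.complex.tiles σ := by
    intro i h₁ h₂ x
    rw [mem_switchBack_left hR h₁ h₂, mem_matching_left hR h₁ h₂, mem_matching4 hR h₁ h₂,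
      mem_matching3 hR h₁ h₂, h.atA_iff, h.atD_iff, h.atB_iff hR, h.atC_iff hR]
    exact core_splice h₁ h₂ h.σ_eq ha' (atA_atB ha.start)
      (fun hx => (atC_atD ha.finish hx).symm) hm
  have keyR : ∀ i, O.s ≤ i → i ≤ O.t → ∀ x,
      O.image i x ∈ O.switchBack m (O.G3.matching O.G3.tiles X) (O.G4.matching O.G4.tiles Y) ↔
        O.image i x ∈ G.complex.matching G.complex.tiles σ := by
    intro i h₁ h₂ x
    rw [mem_switchBack_right hR h₁ h₂, mem_matching_right hR h₁ h₂, mem_matching4 hR h₁ h₂,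
      mem_matching3 hR h₁ h₂, h.atA_iff, h.atD_iff, h.atB_iff hR, h.atC_iff hR]
    exact core_splice h₁ h₂ h.shift_eq (fun j h₁ h₂ hj z => (ha' j h₁ h₂ hj z).symm)
      (fun hx => (atA_atB ha.start hx).symm) (atC_atD ha.finish) hm
  have keyR' : ∀ i, O.s' ≤ i → i ≤ O.t' → ∀ x,
      G.edge i x ∈ O.switchBack m (O.G3.matching O.G3.tiles X) (O.G4.matching O.G4.tiles Y) ↔
        G.edge i x ∈ G.complex.matching G.complex.tiles σ := by
    intro i h₁ h₂ x
    have := keyR (i - (O.s' - O.s)) (by omega) (by omega) (O.ρ x)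
    rwa [image, O.ρ_ρ, Nat.sub_add_cancel (by omega)] at this
  refine subset_edgesOf_ext (A := G.complex.tiles) ?_ (fun e he => he.1) ?_
  · have hlt := hR.lt
    rintro e ((⟨j, hj, y, rfl, -⟩ | ⟨j, hj, y, rfl, -⟩) | ⟨-, ⟨j, hj, y, rfl, -⟩ | ⟨j, hj, y, rfl, -⟩⟩)
    · have hj' : O.s ≤ j ∧ j ≤ O.t := hj
      exact ⟨j, ⟨by omega, by omega⟩, _, rfl⟩
    · have hj' : O.s ≤ j ∧ j ≤ O.t := hj
      exact ⟨_, ⟨by omega, by omega⟩, _, rfl⟩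
    · rw [outer_iff] at hj
      exact ⟨j, ⟨by omega, by omega⟩, _, rfl⟩
    · rw [middle_iff] at hj
      exact ⟨j, ⟨by omega, by omega⟩, _, rfl⟩
  · rintro i ⟨hi₁, hi₂⟩ x
    change G.edge i x ∈ O.switchBack m _ _ ↔ G.edge i x ∈ _
    by_cases h₁ : O.s ≤ i ∧ i ≤ O.t
    · exact keyL i h₁.1 h₁.2 x
    by_cases h₂ : O.s' ≤ i ∧ i ≤ O.t'
    · exact keyR' i h₂.1 h₂.2 x
    by_cases h₃ : i ∈ O.outer
    · by_cases hx : O.OuterFree i x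
      · rw [mem_switchBack_outer hR h₃ hx, h.matching_outer hR h₃ hx]
      · rw [OuterFree, not_and_or, not_not, not_not] at hx
        rw [outer_iff] at h₃
        rcases hx with ⟨hx, rfl⟩ | ⟨rfl, rfl⟩
        · rw [← G.edge_step (by omega) (by omega)]
          exact keyL _ (by omega) (by omega) _
        · rw [G.edge_step (by omega) (by omega)]
          exact keyR' _ (by omega) (by omega) _
    · have h₄ : i ∈ O.middle := by
        rw [middle_iff]
        rw [outer_iff] at h₃
        omega
      by_cases hx : O.MiddleFree i x
      · rw [mem_switchBack_middle hR h₄ hx, h.matching_middle hR h₄ hx]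
      · rw [MiddleFree, not_and_or, not_not, not_not] at hx
        rw [middle_iff] at h₄
        rcases hx with ⟨hx, rfl⟩ | ⟨rfl, rfl⟩
        · rw [← G.edge_step (by omega) (by omega)]
          exact keyR' _ (by omega) (by omega) _
        · rw [G.edge_step (by omega) (by omega)]
          exact keyL _ (by omega) (by omega) _

end IsSplice

end SelfOverlap

namespace SelfOverlap

variable {G : SnakeGraph} {f : G.Edge → Bool} {O : SelfOverlap G f}

/-- If an edge set on the overlap that is obtained by switching between `p` and `q` is given by a
selection `w`, then `p` and `q` meet at the position. On every tile there are a south or west side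
and a north or east side that are not glued to other tiles of the overlap and not subject to the
conditions at its ends. By means of these, `w` is compared with `p` and with `q`. -/
theorem agree_of_core {m : ℕ} {p q w : ℕ × Side → Prop} (hp : IsSelection p) (hq : IsSelection q)
    (hw : IsSelection w) {L₁ L₂ R₁ R₂ L' R' : Prop} {z : Side} (hz : z.level = 1)
    (H : ∀ i, O.s ≤ i → i ≤ O.t → ∀ x,
      (O.Core w i x ∧ (i = O.s → x = O.startSide.reflect → L') ∧ (i = O.t → x = z.reflect → R')) ↔
      (O.Before m i x ∧ O.Core p i x ∧ (i = O.s → x = O.startSide.reflect → L₁) ∧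
        (i = O.t → x = z → R₁)) ∨
      (¬ O.Before m i x ∧ O.Core q i x ∧ (i = O.s → x = O.startSide → L₂) ∧
        (i = O.t → x = z.reflect → R₂)))
    (hL : L' ↔ L₁) (hR : R' ↔ R₂) (aL₁ : L' ∨ w (O.s, O.startSide.reflect))
    (aL₂ : L₂ ∨ q (O.s, O.startSide)) (aR₁ : R₁ ∨ p (O.t, z)) (aR₂ : R' ∨ w (O.t, z.reflect)) :
    O.Agree m p q (L₁ ∧ L₂) (R₁ ∧ R₂) := by
  obtain ⟨b₁, b₂, b₃, b₄, b₅⟩ := O.bounds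
  have ne_of_level {x y : Side} (h : x.level ≠ y.level) : x ≠ y := fun h' => h (by rw [h'])
  -- comparison with `p` by means of a south or west side
  have left : ∀ i, O.s ≤ i → i ≤ O.t → i < O.s + m → ∀ y, w (i, y) ↔ p (i, y) := by
    intro i h₁ h₂ hi
    have key : ∀ x : Side, x.level = 0 → (O.s < i → x ≠ G.inSide (i - 1)) →
        (i = O.s → x = O.startSide) → (w (i, x) ↔ p (i, x)) := by
      intro x hx h3 h4
      have hB : O.Before m i x := by unfold Before; omega
      have c (r : ℕ × Side → Prop) : O.Core r i x ↔ r (i, x) :=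
        ⟨fun h => h.1, fun h => ⟨h, fun _ h' => absurd h' (ne_of_level (by simp [hx])),
          fun h' h'' => absurd h'' (h3 h')⟩⟩
      have e₁ (r : Prop) : (i = O.s → x = O.startSide.reflect → r) ↔ True := iff_true_intro fun h h' =>
        absurd h' (by rw [h4 h]; exact (Side.reflect_ne _).symm)
      have e₂ (r : Prop) : (i = O.t → x = z → r) ↔ True := iff_true_intro fun _ h' =>
        absurd h' (ne_of_level (by rw [hx, hz]; decide))
      have e₃ (r : Prop) : (i = O.t → x = z.reflect → r) ↔ True := iff_true_intro fun _ h' =>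
        absurd h' (ne_of_level (by rw [hx, Side.level_reflect, hz]; decide))
      have := H i h₁ h₂ x
      simpa only [c, e₁, e₂, e₃, hB, true_and, and_true, not_true, false_and, or_false] using this
    rcases Nat.eq_or_lt_of_le h₁ with h | h
    · refine hw.congr hp (key O.startSide O.level_startSide (fun h' => ?_) (fun _ => rfl))
      omega
    · exact hw.congr hp (key (G.inSide (i - 1)).reflect (by simp) (fun _ => Side.reflect_ne _)
        (fun h' => by omega))
  -- comparison with `q` by means of a north or east side
  have right : ∀ i, O.s ≤ i → i ≤ O.t → O.s + m ≤ i + 1 → ∀ y, w (i, y) ↔ q (i, y) := by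
    intro i h₁ h₂ hi
    have key : ∀ x : Side, x.level = 1 → (i < O.t → x ≠ G.outSide i) →
        (i = O.t → x = z) → (w (i, x) ↔ q (i, x)) := by
      intro x hx h3 h4
      have hB : ¬ O.Before m i x := by unfold Before; omega
      have c (r : ℕ × Side → Prop) : O.Core r i x ↔ r (i, x) :=
        ⟨fun h => h.1, fun h => ⟨h, fun h' h'' => absurd h'' (h3 h'),
          fun _ h' => absurd h' (ne_of_level (by simp [hx]))⟩⟩
      have e₁ (r : Prop) : (i = O.s → x = O.startSide.reflect → r) ↔ True := iff_true_intro fun _ h' =>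
        absurd h' (ne_of_level (by rw [hx, Side.level_reflect, level_startSide]; decide))
      have e₂ (r : Prop) : (i = O.s → x = O.startSide → r) ↔ True := iff_true_intro fun _ h' =>
        absurd h' (ne_of_level (by rw [hx, level_startSide]; decide))
      have e₃ (r : Prop) : (i = O.t → x = z.reflect → r) ↔ True := iff_true_intro fun h h' =>
        absurd h' (by rw [h4 h]; exact (Side.reflect_ne _).symm)
      have := H i h₁ h₂ x
      simpa only [c, e₁, e₂, e₃, hB, true_and, and_true, not_false_eq_true, false_and,
        false_or] using this
    rcases Nat.eq_or_lt_of_le h₂ with h | h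
    · exact hw.congr hq (key z hz (fun h' => by omega) (fun _ => rfl))
    · exact hw.congr hq (key (G.outSide i).reflect (by simp) (fun _ => Side.reflect_ne _)
        (fun h' => by omega))
  refine ⟨?_, fun i h₁ h₂ hi x => (left i h₁ h₂ (by omega) x).symm.trans
    (right i h₁ h₂ (by omega) x), ?_⟩
  · rintro rfl
    have hwq := right O.s le_rfl b₂ (by omega)
    have hB (x : Side) : ¬ O.Before 0 O.s x := by unfold Before; omega
    have c (r : ℕ × Side → Prop) (x : Side) (hx : x.level = 0) : O.Core r O.s x ↔ r (O.s, x) :=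
      ⟨fun h => h.1, fun h => ⟨h, fun _ h' => absurd h' (ne_of_level (by simp [hx])),
        fun h' => absurd h' (lt_irrefl _)⟩⟩
    have e₃ (r : Prop) (x : Side) (hx : x.level = 0) : (O.s = O.t → x = z.reflect → r) ↔
        True :=
      iff_true_intro fun _ h' => absurd h' (ne_of_level (by rw [hx, Side.level_reflect, hz]; decide))
    constructor
    · have h := H O.s le_rfl b₂ O.startSide.reflect
      have hl : O.startSide.reflect.level = 0 := by rw [Side.level_reflect, level_startSide]
      simp only [hB, c _ _ hl, e₃ _ _ hl, hwq, false_and, not_false_eq_true, true_and, and_true,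
        false_or, forall_const, (Side.reflect_ne O.startSide), IsEmpty.forall_iff] at h
      rw [← hL]
      rw [hwq] at aL₁
      exact aL₁.elim id fun h' => (h.2 h').2
    · have h := H O.s le_rfl b₂ O.startSide
      simp only [hB, c _ _ O.level_startSide, e₃ _ _ O.level_startSide, hwq, false_and,
        not_false_eq_true, true_and, and_true, false_or, forall_const,
        (Side.reflect_ne O.startSide).symm, IsEmpty.forall_iff] at h
      exact aL₂.elim id fun h' => (h.1 h').2
  · intro hm
    have hwp := left O.t b₂ le_rfl (by omega)
    have hB (x : Side) (hx : x.level = 1) : O.Before m O.t x := by unfold Before; omega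
    have c (r : ℕ × Side → Prop) (x : Side) (hx : x.level = 1) : O.Core r O.t x ↔ r (O.t, x) :=
      ⟨fun h => h.1, fun h => ⟨h, fun h' => absurd h' (lt_irrefl _),
        fun _ h' => absurd h' (ne_of_level (by simp [hx]))⟩⟩
    have e₃ (r : Prop) (x : Side) (hx : x.level = 1) :
        (O.t = O.s → x = O.startSide.reflect → r) ↔ True :=
      iff_true_intro fun _ h' => absurd h' (ne_of_level (by rw [hx, Side.level_reflect, level_startSide]; decide))
    have hl : z.reflect.level = 1 := by rw [Side.level_reflect, hz]
    constructor
    · have h := H O.t b₂ le_rfl z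
      simp only [hB _ hz, c _ _ hz, e₃ _ _ hz, hwp, false_and, not_true, true_and, and_true,
        or_false, forall_const, (Side.reflect_ne z).symm, IsEmpty.forall_iff] at h
      exact aR₁.elim id fun h' => (h.1 h').2
    · have h := H O.t b₂ le_rfl z.reflect
      simp only [hB _ hl, c _ _ hl, e₃ _ _ hl, hwp, false_and, not_true, true_and, and_true,
        or_false, forall_const, (Side.reflect_ne z), IsEmpty.forall_iff] at h
      rw [← hR]
      rw [hwp] at aR₂
      exact aR₂.elim id fun h' => (h.2 h').2

end SelfOverlap

theorem TileComplex.IsSelection.ite {p q : ℕ × Side → Prop} (hp : IsSelection p)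
    (hq : IsSelection q) (c : ℕ → Prop) [DecidablePred c] :
    IsSelection fun a => if c a.1 then p a else q a := by
  constructor <;> intro i x <;> simp only <;> split_ifs
  exacts [hp.reflect i x, hq.reflect i x, hp.cofoot i x, hq.cofoot i x]

/-- Two sides of a tile are both selected or both not selected, if and only if they are equal or
opposite; this can be read off from the signs and the levels. -/
theorem TileComplex.IsSelection.iff_iff {T : TileComplex} {f : T.Edge → Bool}
    (hf : T.IsSignFunction f) {p : ℕ × Side → Prop} (hp : IsSelection p) {i : ℕ} (hi : i ∈ T.tiles)
    (x y : Side) : (p (i, x) ↔ p (i, y)) ↔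
      (f (T.edge (i, x)) = f (T.edge (i, y)) ↔ x.level = y.level) := by
  have hr := hf.reflect hi y
  have hc := hf.cofoot hi y
  have hcr := hf.cofoot hi y.reflect
  by_cases hl : x.level = y.level
  · rcases Side.eq_or_eq_reflect_of_level hl with rfl | rfl
    · simp
    · rw [hp.reflect, hr]
      simp
  · have hl' := Side.level_cofoot_ne y
    have hl'' := Side.level_cofoot_ne y.reflect
    rcases Side.eq_cofoot_or_of_level_ne hl with rfl | rfl
    · rw [hp.cofoot, hc]
      simp [hl']
    · rw [hp.cofoot, hp.reflect, hcr, hr]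
      rw [Side.level_reflect] at hl''
      simp [hl'']

namespace SelfOverlap

variable {G : SnakeGraph} {f : G.Edge → Bool} {O : SelfOverlap G f}

/-- If a selection contains no interior edge of the overlap, but of any such edge exactly one of
the two sides, it is determined by its value at one side. -/
theorem iff_of_alternating (hR : O.Regular) {p : ℕ × Side → Prop} (hp : IsSelection p)
    (h : ∀ i, O.s ≤ i → i < O.t → (p (i + 1, G.inSide i) ↔ ¬ p (i, G.outSide i))) {i : ℕ}
    (h₁ : O.s ≤ i) (h₂ : i ≤ O.t) (x : Side) : (p (i, x) ↔ p (O.s, O.startSide)) ↔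
      (f (G.edge i x) = f (G.edge O.s O.startSide) ↔ x.level = 0) := by
  obtain ⟨b₁, b₂, b₃, b₄, b₅⟩ := O.bounds
  induction i, h₁ using Nat.le_induction generalizing x with
  | base =>
    rw [hp.iff_iff hR.sign (i := O.s) ⟨b₁, by omega⟩, level_startSide]
  | succ i hi ih =>
    have h3 := ih (by omega) (G.outSide i)
    have h4 := h i hi (by omega)
    have h5 := hp.iff_iff hR.sign (i := i + 1) ⟨by omega, by omega⟩ x (G.inSide i)
    rw [← edge_step hi (by omega), G.level_outSide] at h3
    rw [G.level_inSide] at h5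
    revert h3 h4 h5
    simp only [SnakeGraph.edge]
    generalize f _ = u, f _ = v, f _ = w
    generalize p _ = P, p _ = Q, p _ = R, p _ = S
    clear * -
    cases u <;> cases v <;> cases w <;> by_cases P <;> by_cases Q <;> by_cases R <;> by_cases S <;>
      simp_all

/-- In the situation of `iff_of_alternating`, exactly one of the sides of the overlap at `e_{s'-1}` and
at `e_t` is selected, since they have the same sign but different levels. -/
theorem start_iff_finish (hR : O.Regular) {p : ℕ × Side → Prop} (hp : IsSelection p)
    (h : ∀ i, O.s ≤ i → i < O.t → (p (i + 1, G.inSide i) ↔ ¬ p (i, G.outSide i))) :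
    p (O.t, G.outSide O.t) ↔ ¬ p (O.s, O.startSide) := by
  obtain ⟨b₁, b₂, b₃, b₄, b₅⟩ := O.bounds
  have h1 := iff_of_alternating hR hp h b₂ le_rfl (G.outSide O.t)
  rw [← hR.sign_start, G.level_outSide] at h1
  simp only [one_ne_zero, iff_false] at h1
  tauto

/-- If two selections differ on every tile of the overlap, they are opposite to each other. -/
theorem opposite_of_not_agree {p q : ℕ × Side → Prop} {L R : Prop} (hp : IsSelection p)
    (hq : IsSelection q) (h : ∀ m ≤ O.t - O.s + 2, ¬ O.Agree m p q L R) {i : ℕ} (h₁ : O.s ≤ i)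
    (h₂ : i ≤ O.t) (x : Side) : q (i, x) ↔ ¬ p (i, x) := by
  by_contra hne
  have hpq : p (i, x) ↔ q (i, x) := by tauto
  refine h (i - O.s + 1) (by omega) ⟨by omega, fun j hj₁ hj₂ hj y => ?_, by omega⟩
  obtain rfl : i = j := by omega
  exact hp.congr hq hpq y

theorem not_endL_of_not_agree {p q : ℕ × Side → Prop} {L R : Prop}
    (h : ∀ m ≤ O.t - O.s + 2, ¬ O.Agree m p q L R) : ¬ L ∧ ¬ R := by
  constructor
  · exact fun hL => h 0 (by omega) ⟨fun _ => hL, fun j hj₁ _ hj => by omega, by omega⟩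
  · exact fun hR' => h _ le_rfl ⟨by omega, fun j hj₁ _ hj => by omega, fun _ => hR'⟩

/-- For matchings of `G₃` and `G₄°` there is always a switching position: otherwise the selections
were opposite to each other on the overlap, without interior edges there, which is incompatible with
the crossing. -/
theorem exists_agree (hR : O.Regular) {X Y : ℕ × Side → Prop} (hX : IsSelection X)
    (hY : IsSelection Y) (aX : O.G3.Admissible O.G3.tiles X) (aY : O.G4.Admissible O.G4.tiles Y) :
    ∃ m ≤ O.t - O.s + 2, O.Agree m X Y (O.EndL X Y) (O.EndR X Y) := by
  by_contra! hno
  have b := O.bounds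
  have hop : ∀ i, O.s ≤ i → i ≤ O.t → ∀ x, Y (i, x) ↔ ¬ X (i, x) := fun i h₁ h₂ x =>
    opposite_of_not_agree hX hY hno h₁ h₂ x
  obtain ⟨hL, hE⟩ := not_endL_of_not_agree hno
  obtain ⟨x₁, x₂, x₃, x₄⟩ := (admissible3_iff' hR).1 aX
  obtain ⟨y₁, y₂, y₃, y₄⟩ := (admissible4_iff' hR).1 aY
  have hs : Y (O.s, O.startSide) := by
    by_contra hs
    refine hL ⟨fun h => (x₃ h).elim id fun h' => ?_, y₃.elim id fun h => absurd h hs⟩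
    rw [hX.reflect] at h'
    exact absurd ((hop _ le_rfl b.2.1 _).2 h') hs
  have ht : Y (O.t, G.outSide O.t) := by
    by_contra ht
    refine hE ⟨y₄.elim (fun h => absurd h ht) id, fun h => (x₄ h).elim (fun h' => ?_) id⟩
    rw [hX.reflect] at h'
    exact absurd ((hop _ b.2.1 le_rfl _).2 h') ht
  refine (start_iff_finish hR hY fun i h₁ h₂ => ?_).1 ht hs
  have h3 := x₁ i h₁ h₂
  have h4 := y₁ i h₁ h₂
  have h5 := hop i h₁ h₂.le (G.outSide i)
  have h6 := hop (i + 1) (by omega) h₂ (G.inSide i)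
  clear * - h3 h4 h5 h6
  grind

theorem exists_isSplice_of (m : ℕ) {σ : ℕ × Side → Prop} (hσ : IsSelection σ) :
    ∃ X Y, IsSelection X ∧ IsSelection Y ∧ O.IsSplice m σ X Y := by
  obtain ⟨b₁, b₂, b₃, b₄, b₅⟩ := O.bounds
  refine ⟨_, _, (isSelection_shift (O := O) hσ).ite hσ (fun i => O.s ≤ i ∧ i ≤ O.t ∧ O.s + m ≤ i),
    (isSelection_shift (O := O) hσ).ite hσ (fun i => O.s ≤ i ∧ i ≤ O.t ∧ i < O.s + m), ?_⟩
  refine ⟨fun i h₁ h₂ h₃ x => ⟨?_, ?_⟩, fun i h₁ h₂ h₃ x => ⟨?_, ?_⟩, fun i hi x => ?_,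
    fun i hi x => ?_⟩ <;> simp only
  · rw [if_neg (by omega)]
  · rw [if_pos ⟨h₁, h₂, h₃⟩]
  · rw [if_pos ⟨h₁, h₂, h₃⟩]
  · rw [if_neg (by omega)]
  · rw [outer_iff] at hi
    rw [if_neg (by omega)]
  · rw [middle_iff] at hi
    rw [if_neg (by omega)]

theorem exists_isSplice_to (hR : O.Regular) (m : ℕ) {X Y : ℕ × Side → Prop} (hX : IsSelection X)
    (hY : IsSelection Y) : ∃ σ, IsSelection σ ∧ O.IsSplice m σ X Y := by
  obtain ⟨b₁, b₂, b₃, b₄, b₅⟩ := O.bounds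
  have hlt := hR.lt
  have hback {p : ℕ × Side → Prop} (hp : IsSelection p) :
      IsSelection fun a => p (a.1 - (O.s' - O.s), O.ρ a.2) := by
    constructor <;> intro i x <;> simp only
    · rw [O.ρ_reflect, hp.reflect]
    · rw [O.ρ_cofoot, hp.cofoot]
  have h1 := (hback hY).ite (hback hX) (fun i => i - (O.s' - O.s) < O.s + m)
  have h2 := h1.ite (hY.ite hX fun i => O.t < i ∧ i < O.s') (fun i => O.s' ≤ i ∧ i ≤ O.t')
  refine ⟨_, (hX.ite hY fun i => i < O.s + m).ite h2 (fun i => O.s ≤ i ∧ i ≤ O.t), ?_⟩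
  refine ⟨fun i h₁ h₂ h₃ x => ⟨?_, ?_⟩, fun i h₁ h₂ h₃ x => ⟨?_, ?_⟩, fun i hi x => ?_,
    fun i hi x => ?_⟩ <;> simp only [shift, O.ρ_ρ, Nat.add_sub_cancel]
  · rw [if_pos ⟨h₁, h₂⟩, if_pos h₃]
  · rw [if_neg (by omega), if_pos (by omega), if_pos h₃]
  · rw [if_neg (by omega), if_pos (by omega), if_neg (by omega)]
  · rw [if_pos ⟨h₁, h₂⟩, if_neg (by omega)]
  · rw [outer_iff] at hi
    rw [if_neg (by omega), if_neg (by omega), if_neg (by omega)]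
  · rw [middle_iff] at hi
    rw [if_neg (by omega), if_neg (by omega), if_pos (by omega)]

/-! ### Sides of outer and middle tiles that are not glued -/

theorem mem_matching_unglued {i : ℕ} {x : Side} {σ : ℕ × Side → Prop} (h₁ : 1 ≤ i) (h₂ : i ≤ G.d)
    (hx : x = (G.outSide i).reflect ∨ x = (G.inSide (i - 1)).reflect) :
    G.edge i x ∈ G.complex.matching G.complex.tiles σ ↔ σ (i, x) := by
  refine G.isChain.isStrip.mem_matching_of_not_glue (show i ∈ G.complex.tiles from ⟨h₁, h₂⟩)
    fun b => ?_
  rcases hx with rfl | rfl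
  · exact G.isChain.not_glue_out (k := i) h₁ h₂
  · exact G.isChain.not_glue_inn (k := i) h₁ h₂

theorem outerFree_of_unglued {i : ℕ} {x : Side}
    (hx : x = (G.outSide i).reflect ∨ x = (G.inSide (i - 1)).reflect) : O.OuterFree i x := by
  constructor
  · rintro ⟨-, h⟩
    rcases hx with rfl | rfl
    · exact Side.reflect_ne _ h
    · simpa using congrArg Side.level h
  · rintro ⟨rfl, h⟩
    rcases hx with rfl | rfl
    · simpa using congrArg Side.level h
    · exact Side.reflect_ne _ h

theorem middleFree_of_unglued {i : ℕ} {x : Side}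
    (hx : x = (G.outSide i).reflect ∨ x = (G.inSide (i - 1)).reflect) : O.MiddleFree i x := by
  constructor
  · rintro ⟨-, h⟩
    rcases hx with rfl | rfl
    · exact Side.reflect_ne _ h
    · simpa using congrArg Side.level h
  · rintro ⟨rfl, h⟩
    rcases hx with rfl | rfl
    · simpa using congrArg Side.level h
    · exact Side.reflect_ne _ h

theorem mem_matching3_unglued (hR : O.Regular) {i : ℕ} {x : Side} {σ : ℕ × Side → Prop}
    (hi : i ∈ O.outer) (hx : x = (G.outSide i).reflect ∨ x = (G.inSide (i - 1)).reflect) :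
    O.G3.edge (i, x) ∈ O.G3.matching O.G3.tiles σ ↔ σ (i, x) := by
  obtain ⟨b₁, b₂, b₃, b₄, b₅⟩ := O.bounds
  refine (isChain3 hR).isStrip.mem_matching_of_not_glue (show i ∈ O.G3.tiles from Or.inl hi)
    fun b => ?_
  rw [glue3_outer_iff hR hi (outerFree_of_unglued hx)]
  rw [outer_iff] at hi
  rcases hx with rfl | rfl
  · exact G.isChain.not_glue_out (k := i) (by omega) (by omega)
  · exact G.isChain.not_glue_inn (k := i) (by omega) (by omega)

theorem mem_matching4_unglued (hR : O.Regular) {i : ℕ} {x : Side} {σ : ℕ × Side → Prop}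
    (hi : i ∈ O.middle) (hx : x = (G.outSide i).reflect ∨ x = (G.inSide (i - 1)).reflect) :
    O.G4.edge (i, x) ∈ O.G4.matching O.G4.tiles σ ↔ σ (i, x) := by
  obtain ⟨b₁, b₂, b₃, b₄, b₅⟩ := O.bounds
  refine (isStrip4 hR).mem_matching_of_not_glue (show i ∈ O.G4.tiles from Or.inr hi)
    fun b => ?_
  rw [glue4_middle_iff hR hi (middleFree_of_unglued hx)]
  rw [middle_iff] at hi
  rcases hx with rfl | rfl
  · exact G.isChain.not_glue_out (k := i) (by omega) (by omega)
  · exact G.isChain.not_glue_inn (k := i) (by omega) (by omega)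

/-! ### Switching positions -/

theorem isSwitchingPosition_iff (hR : O.Regular) {σ : ℕ × Side → Prop} (hσ : IsSelection σ)
    (aσ : G.complex.Admissible G.complex.tiles σ) {m : ℕ} :
    O.IsSwitchingPosition (G.complex.matching G.complex.tiles σ) m ↔
      m ≤ O.t - O.s + 2 ∧ O.Agree m σ (O.shift σ) (O.EndL σ σ) (O.EndR σ σ) := by
  refine and_congr_right fun hm => ⟨fun h => ?_, fun h => ?_⟩
  · obtain ⟨w, hw, aw, he⟩ := (isChain3 hR).isPerfectMatching_iff.1 h
    obtain ⟨a₁, a₂, a₃, a₄, a₅, a₆, a₇, a₈⟩ := (admissible1_iff' hR).1 aσ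
    obtain ⟨w₁, w₂, w₃, w₄⟩ := (admissible3_iff' hR).1 aw
    have hout : ∀ i ∈ O.outer, ∀ x, w (i, x) ↔ σ (i, x) := by
      intro i hi
      refine hw.congr hσ (x := (G.outSide i).reflect) ?_
      rw [← mem_matching3_unglued (σ := w) hR hi (Or.inl rfl), ← he,
        mem_switch3_outer hR hi (outerFree_of_unglued (Or.inl rfl))]
      rw [outer_iff] at hi
      have b := O.bounds
      exact mem_matching_unglued (by omega) (by omega) (Or.inl rfl)
    refine agree_of_core hσ (isSelection_shift hσ) hw (z := G.outSide O.t)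
      (L' := 1 < O.s → w (O.s - 1, G.outSide (O.s - 1)))
      (R' := O.t' < G.d → w (O.t' + 1, G.inSide O.t')) (G.level_outSide _) (fun i h₁ h₂ x => ?_)
      (forall_congr' fun h => hout _ (mem_outer_start h) _)
      (forall_congr' fun h => hout _ (mem_outer_finish h) _) ?_ a₆ a₇.symm ?_
    · have := mem_switch3 hR (m := m) (P := G.complex.matching G.complex.tiles σ) h₁ h₂ x
      rw [he, mem_matching3 hR h₁ h₂, mem_matching_left hR h₁ h₂, mem_matching_right hR h₁ h₂]
        at this
      exact this
    · by_cases hs : 1 < O.s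
      · exact (w₃ hs).imp_left fun h _ => h
      · exact Or.inl fun h => absurd h hs
    · by_cases ht : O.t' < G.d
      · exact (w₄ ht).symm.imp_left fun h _ => h
      · exact Or.inl fun h => absurd h ht
  · obtain ⟨X, Y, hX, hY, hsp⟩ := exists_isSplice_of m hσ
    rw [hsp.switch3_eq hR hm h]
    exact (isChain3 hR).isPerfectMatching_iff.2 ⟨X, hX, ((hsp.admissible_iff hR hm h).2 aσ).1, rfl⟩

theorem isSwitchingPosition34_iff (hR : O.Regular) {X Y : ℕ × Side → Prop} (hX : IsSelection X)
    (hY : IsSelection Y) (aX : O.G3.Admissible O.G3.tiles X)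
    (aY : O.G4.Admissible O.G4.tiles Y) {m : ℕ} :
    O.IsSwitchingPosition34 (O.G3.matching O.G3.tiles X) (O.G4.matching O.G4.tiles Y) m ↔
      m ≤ O.t - O.s + 2 ∧ O.Agree m X Y (O.EndL X Y) (O.EndR X Y) := by
  refine and_congr_right fun hm => ⟨fun h => ?_, fun h => ?_⟩
  · obtain ⟨w, hw, aw, he⟩ := G.isChain.isPerfectMatching_iff.1 h
    obtain ⟨a₁, a₂, a₃, a₄, a₅, a₆, a₇, a₈⟩ := (admissible1_iff' hR).1 aw
    obtain ⟨x₁, x₂, x₃, x₄⟩ := (admissible3_iff' hR).1 aX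
    obtain ⟨y₁, y₂, y₃, y₄⟩ := (admissible4_iff' hR).1 aY
    have hout : ∀ i ∈ O.outer, ∀ x, w (i, x) ↔ X (i, x) := by
      intro i hi
      refine hw.congr hX (x := (G.outSide i).reflect) ?_
      rw [← mem_matching3_unglued (σ := X) hR hi (Or.inl rfl),
        ← mem_switchBack_outer hR hi (outerFree_of_unglued (Or.inl rfl)), he]
      rw [outer_iff] at hi
      have b := O.bounds
      exact (mem_matching_unglued (by omega) (by omega) (Or.inl rfl)).symm
    have hmid : ∀ i ∈ O.middle, ∀ x, w (i, x) ↔ Y (i, x) := by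
      intro i hi
      refine hw.congr hY (x := (G.outSide i).reflect) ?_
      rw [← mem_matching4_unglued (σ := Y) hR hi (Or.inl rfl),
        ← mem_switchBack_middle hR hi (middleFree_of_unglued (Or.inl rfl)), he]
      rw [middle_iff] at hi
      have b := O.bounds
      exact (mem_matching_unglued (by omega) (by omega) (Or.inl rfl)).symm
    have hag := agree_of_core (m := m) hX hY hw (z := (G.outSide O.t).reflect)
      (L' := 1 < O.s → w (O.s - 1, G.outSide (O.s - 1)))
      (L₁ := 1 < O.s → X (O.s - 1, G.outSide (O.s - 1)))
      (L₂ := Y (O.s' - 1, G.outSide (O.s' - 1)))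
      (R₁ := O.t' < G.d → X (O.t' + 1, G.inSide O.t'))
      (R₂ := Y (O.t + 1, G.inSide O.t))
      (R' := w (O.t + 1, G.inSide O.t)) (by simp) (fun i h₁ h₂ x => ?_)
      (forall_congr' fun h => hout _ (mem_outer_start h) _)
      (hmid _ (mem_middle_start hR) _) ?_ y₃ ?_ (by simpa using a₇.symm)
    · exact ⟨hag.start, hag.tile, fun h => (hag.finish h).symm⟩
    · have := mem_switchBack_left hR (m := m) (P3 := O.G3.matching O.G3.tiles X)
        (P4 := O.G4.matching O.G4.tiles Y) h₁ h₂ x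
      rw [he, mem_matching3 hR h₁ h₂, mem_matching_left hR h₁ h₂, mem_matching4 hR h₁ h₂]
        at this
      rw [Side.reflect_reflect]
      exact this
    · by_cases hs : 1 < O.s
      · exact (a₅ hs).imp_left fun h _ => h
      · exact Or.inl fun h => absurd h hs
    · by_cases ht : O.t' < G.d
      · exact (x₄ ht).symm.imp_left fun h _ => h
      · exact Or.inl fun h => absurd h ht
  · obtain ⟨σ, hσ, hsp⟩ := exists_isSplice_to hR m hX hY
    rw [hsp.agree_iff hR] at h
    rw [hsp.switchBack_eq hR hm h]
    exact G.isChain.isPerfectMatching_iff.2 ⟨σ, hσ, (hsp.admissible_iff hR hm h).1 ⟨aX, aY⟩, rfl⟩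

end SelfOverlap

namespace SelfOverlap

variable {G : SnakeGraph} {f : G.Edge → Bool} {O : SelfOverlap G f}

/-- Switching preserves the switching positions. -/
theorem IsSplice.isSwitchingPosition_eq (hR : O.Regular) {m : ℕ} {σ X Y : ℕ × Side → Prop}
    (h : O.IsSplice m σ X Y) (hσ : IsSelection σ) (hX : IsSelection X) (hY : IsSelection Y)
    (aσ : G.complex.Admissible G.complex.tiles σ) (aX : O.G3.Admissible O.G3.tiles X)
    (aY : O.G4.Admissible O.G4.tiles Y) :
    O.IsSwitchingPosition34 (O.G3.matching O.G3.tiles X) (O.G4.matching O.G4.tiles Y) =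
      O.IsSwitchingPosition (G.complex.matching G.complex.tiles σ) := by
  funext k
  rw [isSwitchingPosition_iff hR hσ aσ, isSwitchingPosition34_iff hR hX hY aX aY, h.agree_iff hR]

theorem ψ_φ_of_switch (hR : O.Regular) (f56 : O.G56'.Edge → Bool) {P : Set G.Edge}
    (hP : P ∈ O.matchG1) (h : ∃ m, O.IsSwitchingPosition P m) :
    O.φ f56 P ∈ Sum.inl '' (O.matchG3 ×ˢ O.matchG4) ∧ O.ψ (O.φ f56 P) = P := by
  classical
  obtain ⟨σ, hσ, aσ, rfl⟩ := G.isChain.isPerfectMatching_iff.1 hP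
  have hm := Nat.find_spec h
  rw [isSwitchingPosition_iff hR hσ aσ] at hm
  obtain ⟨hm, ha⟩ := hm
  obtain ⟨X, Y, hX, hY, hsp⟩ := exists_isSplice_of (O := O) (Nat.find h) hσ
  obtain ⟨aX, aY⟩ := (hsp.admissible_iff hR hm ha).2 aσ
  have hφ : O.φ f56 (G.complex.matching G.complex.tiles σ) =
      Sum.inl (O.G3.matching O.G3.tiles X, O.G4.matching O.G4.tiles Y) := by
    rw [φ, dif_pos h]
    congr 2
    · convert hsp.switch3_eq hR hm ha
    · convert hsp.switch4_eq hR hm ha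
  rw [hφ]
  refine ⟨⟨_, ⟨(isChain3 hR).isPerfectMatching_iff.2 ⟨X, hX, aX, rfl⟩,
    (isGoodMatching_iff hR).2 ⟨Y, hY, aY, rfl⟩⟩, rfl⟩, ?_⟩
  have heq := hsp.isSwitchingPosition_eq hR hσ hX hY aσ aX aY
  have h' := h
  simp only [← heq] at h'
  rw [ψ, dif_pos h']
  convert hsp.switchBack_eq hR hm ha using 3

theorem φ_ψ_inl (hR : O.Regular) (f56 : O.G56'.Edge → Bool) {P3 : Set O.G3.Edge}
    {P4 : Set O.G4.Edge} (h3 : P3 ∈ O.matchG3) (h4 : P4 ∈ O.matchG4) :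
    O.ψ (Sum.inl (P3, P4)) ∈ O.matchG1 ∧ O.φ f56 (O.ψ (Sum.inl (P3, P4))) = Sum.inl (P3, P4) := by
  classical
  obtain ⟨X, hX, aX, rfl⟩ := (isChain3 hR).isPerfectMatching_iff.1 h3
  obtain ⟨Y, hY, aY, rfl⟩ := (isGoodMatching_iff hR).1 h4
  have h : ∃ m, O.IsSwitchingPosition34 (O.G3.matching O.G3.tiles X)
      (O.G4.matching O.G4.tiles Y) m := by
    obtain ⟨m, hm, ha⟩ := exists_agree hR hX hY aX aY
    exact ⟨m, (isSwitchingPosition34_iff hR hX hY aX aY).2 ⟨hm, ha⟩⟩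
  have hm := Nat.find_spec h
  rw [isSwitchingPosition34_iff hR hX hY aX aY] at hm
  obtain ⟨hm, ha⟩ := hm
  obtain ⟨σ, hσ, hsp⟩ := exists_isSplice_to hR (Nat.find h) hX hY
  rw [hsp.agree_iff hR] at ha
  have aσ := (hsp.admissible_iff hR hm ha).1 ⟨aX, aY⟩
  have hψ : O.ψ (Sum.inl (O.G3.matching O.G3.tiles X, O.G4.matching O.G4.tiles Y)) =
      G.complex.matching G.complex.tiles σ := by
    rw [ψ, dif_pos h]
    convert hsp.switchBack_eq hR hm ha
  rw [hψ]
  refine ⟨G.isChain.isPerfectMatching_iff.2 ⟨σ, hσ, aσ, rfl⟩, ?_⟩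
  have heq := hsp.isSwitchingPosition_eq hR hσ hX hY aσ aX aY
  have h' := h
  simp only [heq] at h'
  rw [φ, dif_pos h']
  congr 2
  · convert hsp.switch3_eq hR hm ha using 3
    rw [heq]
  · convert hsp.switch4_eq hR hm ha using 3
    rw [heq]

end SelfOverlap

namespace TileComplex

variable {T : TileComplex}

/-! ### Coordinates for selections on a chain with a sign function -/

/-- Selections with arbitrary prescribed values at one side of each tile. -/
theorem exists_isSelection_eq (z : ℕ → Side) (V : ℕ → Prop) :
    ∃ σ, IsSelection σ ∧ ∀ i, σ (i, z i) ↔ V i :=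
  ⟨_, isSelection_horizontal fun i => ((z i).IsHorizontal ↔ V i), fun i => by
    by_cases h : (z i).IsHorizontal <;> simp [h]⟩

/-- The coordinate of a selection on the `k`-th tile of a chain: of the two sides that may be shared
with the next tile, the one of sign `κ` is selected. -/
def Up (g : T.Edge → Bool) (κ : Bool) (τ : ℕ → ℕ) (out : ℕ → Side) (σ : ℕ × Side → Prop)
    (k : ℕ) : Prop :=
  σ (τ k, out k) ↔ g (T.edge (τ k, out k)) = κ

namespace IsChain

variable {n : ℕ} {τ : ℕ → ℕ} {inn out : ℕ → Side} {g : T.Edge → Bool} {κ : Bool}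
  {σ : ℕ × Side → Prop}

theorem mem_tiles (hC : T.IsChain n τ inn out) {k : ℕ} (h₁ : 1 ≤ k) (h₂ : k ≤ n) :
    τ k ∈ T.tiles := by
  rw [hC.tiles_eq]
  exact ⟨k, ⟨h₁, h₂⟩, rfl⟩

theorem iff_up (hC : T.IsChain n τ inn out) (hg : T.IsSignFunction g) (hσ : IsSelection σ) {k : ℕ}
    (h₁ : 1 ≤ k) (h₂ : k ≤ n) (z : Side) : σ (τ k, z) ↔
      (Up g κ τ out σ k ↔ (g (T.edge (τ k, z)) = κ ↔ z.level = (out k).level)) := by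
  have h := hσ.iff_iff hg (hC.mem_tiles h₁ h₂) z (out k)
  revert h
  unfold Up
  generalize g _ = u, g _ = v, σ _ = P, σ _ = Q
  cases u <;> cases v <;> cases κ <;> by_cases P <;> by_cases Q <;> simp_all

theorem out_iff_up (hC : T.IsChain n τ inn out) (hg : T.IsSignFunction g) (hσ : IsSelection σ)
    {k : ℕ} (h₁ : 1 ≤ k) (h₂ : k ≤ n) :
    σ (τ k, out k) ↔ (Up g κ τ out σ k ↔ g (T.edge (τ k, out k)) = κ) := by
  rw [hC.iff_up hg hσ h₁ h₂ (κ := κ)]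
  simp

theorem edge_inn (hC : T.IsChain n τ inn out) {k : ℕ} (h₁ : 1 ≤ k) (h₂ : k < n) :
    T.edge (τ (k + 1), inn (k + 1)) = T.edge (τ k, out k) :=
  (edge_eq_of_glue (hC.glue h₁ h₂)).symm

theorem inn_iff_up (hC : T.IsChain n τ inn out) (hg : T.IsSignFunction g) (hσ : IsSelection σ)
    {k : ℕ} (h₁ : 1 ≤ k) (h₂ : k < n) :
    σ (τ (k + 1), inn (k + 1)) ↔ ¬ (Up g κ τ out σ (k + 1) ↔ g (T.edge (τ k, out k)) = κ) := by
  rw [hC.iff_up hg hσ (by omega) h₂ (κ := κ), hC.edge_inn h₁ h₂]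
  have := (hC.level_ne (k := k + 1) (by omega) h₂).symm
  simp only [this, iff_false]
  tauto

/-- An interior edge is chosen if and only if the coordinate changes there: from up to down if its sign
is `κ`, and from down to up otherwise. -/
theorem mem_interior_iff (hC : T.IsChain n τ inn out) (hg : T.IsSignFunction g)
    (hσ : IsSelection σ) {k : ℕ} (h₁ : 1 ≤ k) (h₂ : k < n) :
    T.edge (τ k, out k) ∈ T.matching T.tiles σ ↔
      (g (T.edge (τ k, out k)) = κ ∧ Up g κ τ out σ k ∧ ¬ Up g κ τ out σ (k + 1)) ∨
      (g (T.edge (τ k, out k)) ≠ κ ∧ ¬ Up g κ τ out σ k ∧ Up g κ τ out σ (k + 1)) := by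
  rw [hC.isStrip.mem_matching_of_glue (hC.mem_tiles h₁ h₂.le) (hC.glue h₁ h₂)
    (hC.mem_tiles (by omega) h₂), hC.out_iff_up hg hσ h₁ h₂.le (κ := κ),
    hC.inn_iff_up hg hσ h₁ h₂ (κ := κ)]
  by_cases h : g (T.edge (τ k, out k)) = κ <;> simp [h]

/-- A selection is admissible if and only if the coordinate changes from up to down only at edges of
sign `κ`, and from down to up only at the other ones. -/
theorem admissible_iff_up (hC : T.IsChain n τ inn out) (hg : T.IsSignFunction g)
    (hσ : IsSelection σ) : T.Admissible T.tiles σ ↔ ∀ k, 1 ≤ k → k < n →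
      (g (T.edge (τ k, out k)) = κ → Up g κ τ out σ (k + 1) → Up g κ τ out σ k) ∧
      (g (T.edge (τ k, out k)) ≠ κ → Up g κ τ out σ k → Up g κ τ out σ (k + 1)) := by
  have key : ∀ k, 1 ≤ k → k < n → ((σ (τ k, out k) ∨ σ (τ (k + 1), inn (k + 1))) ↔
      (g (T.edge (τ k, out k)) = κ → Up g κ τ out σ (k + 1) → Up g κ τ out σ k) ∧
      (g (T.edge (τ k, out k)) ≠ κ → Up g κ τ out σ k → Up g κ τ out σ (k + 1))) := by
    intro k h₁ h₂
    rw [hC.out_iff_up hg hσ h₁ h₂.le (κ := κ), hC.inn_iff_up hg hσ h₁ h₂ (κ := κ)]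
    by_cases h : g (T.edge (τ k, out k)) = κ <;> by_cases h' : Up g κ τ out σ k <;>
      by_cases h'' : Up g κ τ out σ (k + 1) <;> simp [h, h', h'']
  constructor
  · intro h k h₁ h₂
    exact (key k h₁ h₂).1 (h _ _ (hC.glue h₁ h₂) (hC.mem_tiles h₁ h₂.le)
      (hC.mem_tiles (by omega) h₂))
  · intro h x y hxy _ _
    obtain ⟨k, h₁, h₂, ⟨rfl, rfl⟩ | ⟨rfl, rfl⟩⟩ := hC.glue_iff.1 hxy
    · exact (key k h₁ h₂).2 (h k h₁ h₂)
    · exact ((key k h₁ h₂).2 (h k h₁ h₂)).symm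

theorem eq_of_up (hC : T.IsChain n τ inn out) (hg : T.IsSignFunction g) {ρ : ℕ × Side → Prop}
    (hσ : IsSelection σ) (hρ : IsSelection ρ) {k : ℕ} (h₁ : 1 ≤ k) (h₂ : k ≤ n)
    (h : Up g κ τ out σ k ↔ Up g κ τ out ρ k) (z : Side) : σ (τ k, z) ↔ ρ (τ k, z) := by
  rw [hC.iff_up hg hσ h₁ h₂ (κ := κ), hC.iff_up hg hρ h₁ h₂ (κ := κ), h]

theorem exists_up (hC : T.IsChain n τ inn out) (g : T.Edge → Bool) (κ : Bool) (U : ℕ → Prop) :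
    ∃ σ, IsSelection σ ∧ ∀ k, 1 ≤ k → k ≤ n → (Up g κ τ out σ k ↔ U k) := by
  have hinj : InjOn τ (Icc 1 n) := fun k hk l hl h => hC.inj hk.1 hk.2 hl.1 hl.2 h
  have hinv : ∀ k, 1 ≤ k → k ≤ n → Function.invFunOn τ (Icc 1 n) (τ k) = k := fun k h₁ h₂ =>
    hinj.leftInvOn_invFunOn ⟨h₁, h₂⟩
  obtain ⟨σ, hσ, h⟩ := exists_isSelection_eq (fun i => out (Function.invFunOn τ (Icc 1 n) i))
    (fun i => U (Function.invFunOn τ (Icc 1 n) i) ↔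
      g (T.edge (i, out (Function.invFunOn τ (Icc 1 n) i))) = κ)
  refine ⟨σ, hσ, fun k h₁ h₂ => ?_⟩
  have := h (τ k)
  simp only [hinv k h₁ h₂] at this
  rw [Up, this]
  tauto

end IsChain

/-- If the edges of the tiles in `A` that are chosen by `ρ` are also chosen by `σ`, then `σ` selects
every side of these tiles that `ρ` selects, as long as it is not glued to a side outside of `A`
which is not selected by `ρ`. -/
theorem IsStrip.sel_of_subset (hT : T.IsStrip) {σ ρ : ℕ × Side → Prop} (hσ : IsSelection σ)
    (hρ : IsSelection ρ) (aσ : T.Admissible T.tiles σ) {A : Set ℕ} (hA : A ⊆ T.tiles)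
    (hsub : ∀ e ∈ T.edgesOf A, e ∈ T.matching T.tiles ρ → e ∈ T.matching T.tiles σ) {i : ℕ}
    (hi : i ∈ A) {x : Side} (hx : ρ (i, x))
    (hb : ∀ b, T.Glue (i, x) b → b.1 ∈ T.tiles → ρ b ∨ b.1 ∈ A) : σ (i, x) := by
  by_cases h : ∀ b, T.Glue (i, x) b → b.1 ∈ T.tiles → ρ b
  · have := hsub _ ⟨i, hi, x, rfl⟩ ((hT.mem_matching (hA hi) x).2 ⟨hx, h⟩)
    exact ((hT.mem_matching (hA hi) x).1 this).1
  · push Not at h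
    obtain ⟨b, hg, hbT, hbρ⟩ := h
    have hbA := (hb b hg hbT).resolve_left hbρ
    have hun : ∀ c, ¬ T.Glue (b.1, b.2.reflect) c := fun c => hT.reflect hg.symm
    have := hsub _ ⟨b.1, hbA, b.2.reflect, rfl⟩ ((hT.mem_matching_of_not_glue hbT hun).2
      ((hρ.reflect _ _).2 hbρ))
    rw [hT.mem_matching_of_not_glue hbT hun, hσ.reflect] at this
    exact (aσ _ _ hg (hA hi) hbT).resolve_right this

end TileComplex

namespace TileComplex

variable {T : TileComplex}

/-! ### Windows of a chain -/

theorem isPerfectMatching_singleton {E : T.Edge} {P : Set T.Edge} :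
    IsPerfectMatching (T.subgraph {E}) P ↔ P = {E} := by
  rw [isPerfectMatching_subgraph]
  constructor
  · rintro ⟨h₁, h₂⟩
    refine h₁.antisymm (singleton_subset_iff.2 ?_)
    obtain ⟨v, hv⟩ : ∃ v, v ∈ T.ends E := (T.ends E).ind fun u v => ⟨u, Sym2.mem_mk_left u v⟩
    obtain ⟨e, ⟨he, rfl, -⟩, -⟩ := h₂ E rfl v hv
    exact he
  · rintro rfl
    refine ⟨Subset.rfl, ?_⟩
    rintro e rfl v hv
    exact ⟨e, ⟨rfl, rfl, hv⟩, fun e' he' => he'.1⟩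

/-- The edge set `F` of a chain with sign function `g` is what remains when the part up to an
interior edge `a` (if `cL` holds) and the part from an interior edge `b` on (if `cR` holds) are
removed, where `a` is the first and `b` is the last interior edge of sign `κ`. If `a = b`, it
is a single edge of sign `κ`; this edge may also be an edge at the end of the chain, with `a = 0` or
`a = n`, if there is no interior edge of sign `κ`. -/
structure IsWindow (T : TileComplex) (n : ℕ) (τ : ℕ → ℕ) (out : ℕ → Side) (g : T.Edge → Bool)
    (κ : Bool) (cL cR : Prop) (a b : ℕ) (F : Set T.Edge) : Prop where
  one_le_n : 1 ≤ n
  le : a ≤ b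
  le_n : b ≤ n
  left_none : ¬ cL → a = 0
  left : cL → 1 ≤ a
  left_sign : ∀ k, 1 ≤ k → k < a → g (T.edge (τ k, out k)) ≠ κ
  right_none : ¬ cR → b = n
  right : cR → b < n
  right_sign : ∀ k, b < k → k < n → g (T.edge (τ k, out k)) ≠ κ
  sign_a : 1 ≤ a → a < n → g (T.edge (τ a, out a)) = κ
  sign_b : 1 ≤ b → b < n → g (T.edge (τ b, out b)) = κ
  edges : (a < b ∧ F = T.edgesOf (τ '' Ioc a b)) ∨ (a = b ∧ ∃ E, F = {E} ∧
    ((1 ≤ a ∧ a < n ∧ E = T.edge (τ a, out a)) ∨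
      (a = n ∧ ∃ z, z.level = (out n).level ∧ g (T.edge (τ n, z)) = κ ∧ E = T.edge (τ n, z)) ∨
      (a = 0 ∧ ∃ z, z.level ≠ (out 1).level ∧ g (T.edge (τ 1, z)) = κ ∧ E = T.edge (τ 1, z))))

/-- The admissible selections on a chain with prescribed coordinates at the ends where the chain is
cut off. -/
structure Fits (T : TileComplex) (n : ℕ) (τ : ℕ → ℕ) (out : ℕ → Side) (g : T.Edge → Bool)
    (κ : Bool) (cL cR : Prop) (σ : ℕ × Side → Prop) : Prop where
  sel : IsSelection σ
  adm : T.Admissible T.tiles σ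
  up : cL → Up g κ τ out σ 1
  down : cR → ¬ Up g κ τ out σ n

variable {n : ℕ} {τ : ℕ → ℕ} {inn out : ℕ → Side} {g : T.Edge → Bool} {κ : Bool}
  {σ : ℕ × Side → Prop} {cL cR : Prop} {a b : ℕ} {F : Set T.Edge}

namespace IsWindow

/-- All interior edges before `a` have a sign different from `κ`, so that the coordinate stays up. -/
theorem up (hW : T.IsWindow n τ out g κ cL cR a b F) (hC : T.IsChain n τ inn out)
    (hg : T.IsSignFunction g) (h : T.Fits n τ out g κ cL cR σ) {k : ℕ} (h₁ : 1 ≤ k) (h₂ : k ≤ a) :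
    Up g κ τ out σ k := by
  have hle := hW.le
  have hn := hW.le_n
  induction k, h₁ using Nat.le_induction with
  | base =>
    refine h.up ?_
    by_contra hc
    have := hW.left_none hc
    omega
  | succ k hk ih =>
    exact (((hC.admissible_iff_up hg h.sel (κ := κ)).1 h.adm) k hk (by omega)).2
      (hW.left_sign k hk (by omega)) (ih (by omega))

/-- All interior edges after `b` have a sign different from `κ`, so that the coordinate has been down
before if it is down at the end. -/
theorem down (hW : T.IsWindow n τ out g κ cL cR a b F) (hC : T.IsChain n τ inn out)
    (hg : T.IsSignFunction g) (h : T.Fits n τ out g κ cL cR σ) {k : ℕ} (h₁ : b < k) (h₂ : k ≤ n) :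
    ¬ Up g κ τ out σ k := by
  induction h₂ using Nat.decreasingInduction with
  | self =>
    refine h.down ?_
    by_contra hc
    have := hW.right_none hc
    omega
  | of_succ k hk ih =>
    exact fun h' => ih (by omega) ((((hC.admissible_iff_up hg h.sel (κ := κ)).1 h.adm) k (by omega)
      (by omega)).2 (hW.right_sign k h₁ hk) h')

/-- The single edge of a window is chosen if and only if the coordinates change there. -/
theorem single_mem_iff (hW : T.IsWindow n τ out g κ cL cR a b F) (hC : T.IsChain n τ inn out)
    (hg : T.IsSignFunction g) (hσ : IsSelection σ) {E : T.Edge} (hE :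
      (1 ≤ a ∧ a < n ∧ E = T.edge (τ a, out a)) ∨
      (a = n ∧ ∃ z, z.level = (out n).level ∧ g (T.edge (τ n, z)) = κ ∧ E = T.edge (τ n, z)) ∨
      (a = 0 ∧ ∃ z, z.level ≠ (out 1).level ∧ g (T.edge (τ 1, z)) = κ ∧ E = T.edge (τ 1, z))) :
    E ∈ T.matching T.tiles σ ↔
      (1 ≤ a → Up g κ τ out σ a) ∧ (a < n → ¬ Up g κ τ out σ (a + 1)) := by
  have hn := hW.one_le_n
  rcases hE with ⟨h₁, h₂, rfl⟩ | ⟨rfl, z, hz, hs, rfl⟩ | ⟨rfl, z, hz, hs, rfl⟩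
  · rw [hC.mem_interior_iff hg hσ h₁ h₂ (κ := κ)]
    simp [h₁, h₂, hW.sign_a h₁ h₂]
  · have hun : ∀ c, ¬ T.Glue (τ a, z) c := by
      intro c hc
      rcases (hC.glue_tile_iff hn le_rfl).1 hc with ⟨h, -⟩ | ⟨-, rfl, -⟩
      · omega
      · exact hC.level_ne hn le_rfl hz.symm
    rw [hC.isStrip.mem_matching_of_not_glue (hC.mem_tiles hn le_rfl) hun,
      hC.iff_up hg hσ hn le_rfl (κ := κ)]
    simp [hz, hs, hn]
  · have hun : ∀ c, ¬ T.Glue (τ 1, z) c := by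
      intro c hc
      rcases (hC.glue_tile_iff le_rfl hn).1 hc with ⟨-, rfl, -⟩ | ⟨h, -⟩
      · exact hz rfl
      · omega
    rw [hC.isStrip.mem_matching_of_not_glue (hC.mem_tiles le_rfl hn) hun,
      hC.iff_up hg hσ le_rfl hn (κ := κ)]
    have : 0 < n := hn
    simp [hz, hs, this]

theorem matching_inter (hW : T.IsWindow n τ out g κ cL cR a b F) (hC : T.IsChain n τ inn out)
    (hg : T.IsSignFunction g) (h : T.Fits n τ out g κ cL cR σ) :
    T.matching T.tiles σ ∩ T.edgesOf (τ '' Ioc a b) = T.matching (τ '' Ioc a b) σ := by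
  have hle := hW.le
  have hn := hW.le_n
  ext e
  constructor
  · rintro ⟨h₁, h₂⟩
    refine ⟨h₂, ?_⟩
    rintro i ⟨k, hk, rfl⟩ x he
    exact h₁.2 _ (hC.mem_tiles (by have := hk.1; omega) (hk.2.trans hW.le_n)) x he
  · rintro ⟨h₁, h₂⟩
    refine ⟨?_, h₁⟩
    obtain ⟨i, ⟨k, hk, rfl⟩, x, rfl⟩ := h₁
    have hk' := mem_Ioc.1 hk
    rw [hC.isStrip.mem_matching (hC.mem_tiles (by omega) (by omega))]
    refine ⟨h₂ _ ⟨k, hk, rfl⟩ x rfl, fun c hc _ => ?_⟩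
    rcases (hC.glue_tile_iff (by omega) (by omega)).1 hc with ⟨h3, rfl, rfl⟩ | ⟨h3, rfl, rfl⟩
    · by_cases hkb : k = b
      · subst hkb
        rw [hC.inn_iff_up hg h.sel (by omega) h3 (κ := κ), hW.sign_b (by omega) h3]
        simpa using hW.down hC hg h (k := k + 1) (by omega) (by omega)
      · exact h₂ _ ⟨k + 1, ⟨by omega, by omega⟩, rfl⟩ _ (edge_eq_of_glue hc).symm
    · by_cases hka : k = a + 1
      · subst hka
        simp only [Nat.add_sub_cancel]
        rw [hC.out_iff_up hg h.sel (by omega) (by omega) (κ := κ), hW.sign_a (by omega) (by omega)]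
        simpa using hW.up hC hg h (k := a) (by omega) le_rfl
      · exact h₂ _ ⟨k - 1, ⟨by omega, by omega⟩, rfl⟩ _ (edge_eq_of_glue hc).symm

theorem seg_subset (hC : T.IsChain n τ inn out) (hn : b ≤ n) : τ '' Ioc a b ⊆ T.tiles := by
  rintro _ ⟨k, hk, rfl⟩
  have := mem_Ioc.1 hk
  exact hC.mem_tiles (by omega) (by omega)

theorem subset_edgesOf (hW : T.IsWindow n τ out g κ cL cR a b F) (hC : T.IsChain n τ inn out) :
    F ⊆ T.edgesOf T.tiles := by
  have hn := hW.one_le_n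
  rcases hW.edges with ⟨-, rfl⟩ | ⟨-, E, rfl, hE⟩
  · rintro _ ⟨i, hi, x, rfl⟩
    exact ⟨i, seg_subset hC hW.le_n hi, x, rfl⟩
  · rintro e rfl
    rcases hE with ⟨h₁, h₂, rfl⟩ | ⟨-, z, -, -, rfl⟩ | ⟨-, z, -, -, rfl⟩
    · exact ⟨_, hC.mem_tiles h₁ h₂.le, _, rfl⟩
    · exact ⟨_, hC.mem_tiles hn le_rfl, _, rfl⟩
    · exact ⟨_, hC.mem_tiles le_rfl hn, _, rfl⟩

/-- The part of a fitting matching in the window is a perfect matching. -/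
theorem isPerfectMatching_inter (hW : T.IsWindow n τ out g κ cL cR a b F)
    (hC : T.IsChain n τ inn out) (hg : T.IsSignFunction g) (h : T.Fits n τ out g κ cL cR σ) :
    IsPerfectMatching (T.subgraph F) (T.matching T.tiles σ ∩ F) := by
  rcases hW.edges with ⟨-, hF⟩ | ⟨hab, E, hF, hE⟩
  · have hsub := seg_subset (a := a) hC hW.le_n
    rw [hF, hW.matching_inter hC hg h]
    exact hC.isStrip.isPerfectMatching_matching (hC.isConvex hW.le_n) h.sel
      fun x y hxy hx hy => h.adm x y hxy (hsub hx) (hsub hy)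
  · have hEm : E ∈ T.matching T.tiles σ := (hW.single_mem_iff hC hg h.sel hE).2
      ⟨fun h1 => hW.up hC hg h h1 le_rfl, fun h1 => hW.down hC hg h (by omega) h1⟩
    rw [hF, isPerfectMatching_singleton]
    exact inter_eq_right.2 (singleton_subset_iff.2 hEm)

theorem exists_of_interior (hC : T.IsChain n τ inn out) {e : T.Edge} (he : e ∈ T.interior) :
    ∃ k, 1 ≤ k ∧ k < n ∧ e = T.edge (τ k, out k) := by
  obtain ⟨x, y, hxy, rfl⟩ := he
  obtain ⟨k, h₁, h₂, ⟨rfl, -⟩ | ⟨-, rfl⟩⟩ := hC.glue_iff.1 (Or.inl hxy)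
  · exact ⟨k, h₁, h₂, rfl⟩
  · exact ⟨k, h₁, h₂, hC.edge_inn h₁ h₂⟩

theorem mem_interior (hC : T.IsChain n τ inn out) {k : ℕ} (h₁ : 1 ≤ k) (h₂ : k < n) :
    T.edge (τ k, out k) ∈ T.interior := by
  rcases hC.glue h₁ h₂ with h | h
  · exact ⟨_, _, h, rfl⟩
  · exact ⟨_, _, h, edge_eq_of_glue (hC.glue h₁ h₂)⟩

/-- The interior edges in the window are those from `a` to `b`; the edges along which the chain is cut
belong to it. -/
theorem mem_of_interior (hW : T.IsWindow n τ out g κ cL cR a b F) (hC : T.IsChain n τ inn out)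
    {k : ℕ} (h₁ : 1 ≤ k) (h₂ : k < n) : T.edge (τ k, out k) ∈ F ↔ a ≤ k ∧ k ≤ b := by
  have hle := hW.le
  have hn := hW.le_n
  rcases hW.edges with ⟨hab, hF⟩ | ⟨hab, E, hF, hE⟩
  · rw [hF]
    constructor
    · rintro ⟨_, ⟨l, hl, rfl⟩, x, he⟩
      have hl' := mem_Ioc.1 hl
      rcases hC.isStrip.edge_eq_iff.1 he with h | h
      · have := hC.inj h₁ h₂.le (by omega) (by omega) (Prod.mk.inj h).1
        omega
      · rcases (hC.glue_tile_iff h₁ h₂.le).1 h with ⟨-, -, h⟩ | ⟨-, h, -⟩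
        · have := hC.inj (by omega) (by omega) (by omega) h₂ (Prod.mk.inj h).1
          omega
        · exact absurd (by rw [h]) (hC.level_ne h₁ h₂.le)
    · rintro ⟨h3, h4⟩
      rcases Nat.eq_or_lt_of_le h3 with rfl | h3
      · exact ⟨_, ⟨a + 1, ⟨by omega, by omega⟩, rfl⟩, _, (hC.edge_inn h₁ h₂).symm⟩
      · exact ⟨_, ⟨k, ⟨h3, h4⟩, rfl⟩, _, rfl⟩
  · subst hab
    rw [hF, mem_singleton_iff]
    have key : ∀ l z, 1 ≤ l → l ≤ n → T.edge (τ k, out k) = T.edge (τ l, z) →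
        (k = l ∧ z = out k) ∨ (l = k + 1 ∧ z = inn (k + 1)) := by
      intro l z hl₁ hl₂ he
      rcases hC.isStrip.edge_eq_iff.1 he with h | h
      · exact Or.inl ⟨hC.inj h₁ h₂.le hl₁ hl₂ (Prod.mk.inj h).1, (Prod.mk.inj h).2.symm⟩
      · rcases (hC.glue_tile_iff h₁ h₂.le).1 h with ⟨-, -, h⟩ | ⟨-, h, -⟩
        · exact Or.inr ⟨hC.inj hl₁ hl₂ (by omega) h₂ (Prod.mk.inj h).1, (Prod.mk.inj h).2⟩
        · exact absurd (by rw [h]) (hC.level_ne h₁ h₂.le)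
    rcases hE with ⟨h3, h4, rfl⟩ | ⟨h3, z, hz, -, rfl⟩ | ⟨rfl, z, hz, -, rfl⟩
    · constructor
      · intro he
        rcases key a _ h3 h4.le he with ⟨rfl, -⟩ | ⟨rfl, h⟩
        · exact ⟨le_rfl, le_rfl⟩
        · exact absurd (by rw [h]) (hC.level_ne (k := k + 1) (by omega) h₂)
      · intro h
        obtain rfl : a = k := by omega
        rfl
    · constructor
      · intro he
        rcases key n _ hW.one_le_n le_rfl he with ⟨rfl, -⟩ | ⟨rfl, h⟩
        · omega
        · exact absurd (by rw [← hz, h]) (hC.level_ne (k := k + 1) (by omega) le_rfl)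
      · omega
    · constructor
      · intro he
        rcases key 1 _ le_rfl hW.one_le_n he with ⟨rfl, h⟩ | ⟨h, -⟩
        · exact absurd (by rw [h]) hz
        · omega
      · omega

/-- Outside of the window a fitting matching has only boundary edges. -/
theorem diff_subset_boundary (hW : T.IsWindow n τ out g κ cL cR a b F)
    (hC : T.IsChain n τ inn out) (hg : T.IsSignFunction g) (h : T.Fits n τ out g κ cL cR σ) :
    T.matching T.tiles σ \ F ⊆ T.boundary := by
  rintro e ⟨he, heF⟩
  refine ⟨he.1, fun hi => heF ?_⟩
  obtain ⟨k, h₁, h₂, rfl⟩ := exists_of_interior hC hi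
  rw [hW.mem_of_interior hC h₁ h₂]
  rw [hC.mem_interior_iff hg h.sel h₁ h₂ (κ := κ)] at he
  by_contra hne
  rcases Nat.lt_or_ge k a with hk | hk
  · have h3 := hW.up hC hg h h₁ hk.le
    have h4 := hW.up hC hg h (k := k + 1) (by omega) hk
    tauto
  · have h3 := hW.down hC hg h (k := k) (by omega) h₂.le
    have h4 := hW.down hC hg h (k := k + 1) (by omega) h₂
    tauto

/-- Every perfect matching of the window is the part of a fitting matching. -/
theorem exists_fits (hW : T.IsWindow n τ out g κ cL cR a b F) (hC : T.IsChain n τ inn out)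
    (hg : T.IsSignFunction g) {P : Set T.Edge} (hP : IsPerfectMatching (T.subgraph F) P) :
    ∃ σ, T.Fits n τ out g κ cL cR σ ∧ P = T.matching T.tiles σ ∩ F := by
  have hle := hW.le
  have hn := hW.le_n
  -- on the window, the coordinates are those of a selection `ρ` that gives the matching `P`
  obtain ⟨ρ, hρ, hadm, hPρ⟩ : ∃ ρ, IsSelection ρ ∧ T.Admissible (τ '' Ioc a b) ρ ∧
      (a < b → P = T.matching (τ '' Ioc a b) ρ) := by
    rcases hW.edges with ⟨hab, hF⟩ | ⟨hab, E, hF, hE⟩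
    · rw [hF] at hP
      obtain ⟨ρ, h₁, h₂, h₃⟩ := hC.exists_selection hW.le_n hP
      exact ⟨ρ, h₁, h₂, fun _ => h₃⟩
    · refine ⟨_, isSelection_horizontal fun _ => True, fun x y _ hx => ?_, fun h => by omega⟩
      rw [hab, Ioc_self, image_empty] at hx
      exact absurd hx (notMem_empty _)
  obtain ⟨σ, hσ, hU⟩ := hC.exists_up g κ fun k => k ≤ a ∨ (k ≤ b ∧ Up g κ τ out ρ k)
  have hσρ : ∀ k, a < k → k ≤ b → ∀ z, σ (τ k, z) ↔ ρ (τ k, z) := by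
    intro k h₁ h₂
    refine hC.eq_of_up hg hσ hρ (κ := κ) (by omega) (by omega) ?_
    rw [hU k (by omega) (by omega)]
    simp only [h₂, true_and, not_le.2 h₁, false_or]
  have hfit : T.Fits n τ out g κ cL cR σ := by
    refine ⟨hσ, fun x y hxy hx hy => ?_, fun h => ?_, fun h => ?_⟩
    · have key : ∀ k, 1 ≤ k → k < n → σ (τ k, out k) ∨ σ (τ (k + 1), inn (k + 1)) := by
        intro k h₁ h₂
        by_cases hk : a < k ∧ k + 1 ≤ b
        · rw [hσρ k hk.1 (by omega), hσρ (k + 1) (by omega) hk.2]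
          exact hadm _ _ (hC.glue h₁ h₂) ⟨k, ⟨hk.1, by omega⟩, rfl⟩ ⟨k + 1, ⟨by omega, hk.2⟩, rfl⟩
        · rw [hC.out_iff_up hg hσ h₁ h₂.le (κ := κ), hC.inn_iff_up hg hσ h₁ h₂ (κ := κ),
            hU k h₁ h₂.le, hU (k + 1) (by omega) h₂]
          rcases Nat.lt_trichotomy k a with h | rfl | h
          · have := hW.left_sign k h₁ h
            simp [this, Nat.succ_le_of_lt h]
          · simp [hW.sign_a h₁ h₂]
          · have h3 : ¬ k ≤ a := by omega
            have h4 : ¬ k + 1 ≤ a := by omega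
            have h5 : ¬ k + 1 ≤ b := by omega
            by_cases hkb : k = b
            · subst hkb
              simp [hW.sign_b h₁ h₂, h4]
            · have := hW.right_sign k (by omega) h₂
              have h6 : ¬ k ≤ b := by omega
              simp [this, h3, h6]
      obtain ⟨k, h₁, h₂, ⟨rfl, rfl⟩ | ⟨rfl, rfl⟩⟩ := hC.glue_iff.1 hxy
      · exact key k h₁ h₂
      · exact (key k h₁ h₂).symm
    · exact (hU 1 le_rfl hW.one_le_n).2 (Or.inl (hW.left h))
    · rw [hU n hW.one_le_n le_rfl]
      have := hW.right h
      rintro (h' | h') <;> omega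
  refine ⟨σ, hfit, ?_⟩
  rcases hW.edges with ⟨hab, hF⟩ | ⟨hab, E, hF, hE⟩
  · rw [hF, hW.matching_inter hC hg hfit, hPρ hab]
    refine matching_congr ?_
    rintro _ ⟨k, hk, rfl⟩ x
    exact (hσρ k hk.1 hk.2 x).symm
  · have h1 := hW.isPerfectMatching_inter hC hg hfit
    rw [hF, isPerfectMatching_singleton] at h1 hP
    rw [hF, h1, hP]

/-- If the part of `ρ` in the window is contained in the matching `σ`, and outside of the window
`σ` has only boundary edges, then `σ` agrees with `ρ`. -/
theorem eq_of_subset (hW : T.IsWindow n τ out g κ cL cR a b F) (hC : T.IsChain n τ inn out)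
    (hg : T.IsSignFunction g) {ρ : ℕ × Side → Prop} (hρ : T.Fits n τ out g κ cL cR ρ)
    (hσ : IsSelection σ) (aσ : T.Admissible T.tiles σ)
    (hsub : T.matching T.tiles ρ ∩ F ⊆ T.matching T.tiles σ)
    (hbd : T.matching T.tiles σ \ (T.matching T.tiles ρ ∩ F) ⊆ T.boundary) {k : ℕ} (h₁ : 1 ≤ k)
    (h₂ : k ≤ n) : Up g κ τ out σ k ↔ Up g κ τ out ρ k := by
  have hle := hW.le
  have hn := hW.le_n
  have hadm := (hC.admissible_iff_up hg hσ (κ := κ)).1 aσ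
  have hin : ∀ l, a < l → l ≤ b → (Up g κ τ out σ l ↔ Up g κ τ out ρ l) := by
    intro l hl₁ hl₂
    rcases hW.edges with ⟨hab, hF⟩ | ⟨hab, -⟩
    swap
    · omega
    have key : ∀ x, ρ (τ l, x) → x = out l ∨ x = (out l).reflect → σ (τ l, x) := by
      intro x hx hx'
      refine hC.isStrip.sel_of_subset hσ hρ.sel aσ (seg_subset (a := a) hC hW.le_n)
        (fun e he he' => hsub ⟨he', by rwa [hF]⟩) ⟨l, ⟨hl₁, hl₂⟩, rfl⟩ hx fun c hc _ => ?_
      rcases hx' with rfl | rfl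
      · rcases (hC.glue_tile_iff (by omega) (by omega)).1 hc with ⟨h3, -, rfl⟩ | ⟨-, h3, -⟩
        · by_cases hlb : l = b
          · subst hlb
            left
            rw [hC.inn_iff_up hg hρ.sel (by omega) h3 (κ := κ), hW.sign_b (by omega) h3]
            simpa using hW.down hC hg hρ (k := l + 1) (by omega) (by omega)
          · exact Or.inr ⟨l + 1, ⟨by omega, by omega⟩, rfl⟩
        · exact absurd (by rw [h3]) (hC.level_ne (k := l) (by omega) (by omega))
      · exact absurd hc (hC.not_glue_out (by omega) (by omega))
    have : σ (τ l, out l) ↔ ρ (τ l, out l) := by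
      refine ⟨fun h => ?_, fun h => key _ h (Or.inl rfl)⟩
      by_contra h'
      have := key _ ((hρ.sel.reflect _ _).2 h') (Or.inr rfl)
      rw [hσ.reflect] at this
      exact this h
    unfold Up
    rw [this]
  have hout : ∀ l, 1 ≤ l → l < n → (l < a ∨ b < l) → (Up g κ τ out σ (l + 1) ↔
      Up g κ τ out σ l) := by
    intro l hl₁ hl₂ hl
    have hs : g (T.edge (τ l, out l)) ≠ κ := by
      rcases hl with hl | hl
      · exact hW.left_sign l hl₁ hl
      · exact hW.right_sign l hl hl₂
    refine ⟨fun h => ?_, (hadm l hl₁ hl₂).2 hs⟩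
    by_contra h'
    have hmem := (hC.mem_interior_iff hg hσ hl₁ hl₂ (κ := κ)).2 (Or.inr ⟨hs, h', h⟩)
    refine (hbd ⟨hmem, fun h'' => ?_⟩).2 (mem_interior hC hl₁ hl₂)
    have := (hW.mem_of_interior hC hl₁ hl₂).1 h''.2
    omega
  -- the coordinates at the ends of the window
  have hends : (1 ≤ a → Up g κ τ out σ a) ∧ (b < n → ¬ Up g κ τ out σ (b + 1)) := by
    rcases hW.edges with ⟨hab, hF⟩ | ⟨hab, E, hF, hE⟩
    · constructor
      · intro ha
        have hs := hW.sign_a ha (by omega)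
        by_contra h
        have h3 : ¬ Up g κ τ out ρ (a + 1) := by
          rw [← hin (a + 1) (by omega) (by omega)]
          exact fun h' => h ((hadm a ha (by omega)).1 hs h')
        have h4 := hsub ⟨(hC.mem_interior_iff hg hρ.sel ha (by omega) (κ := κ)).2
          (Or.inl ⟨hs, hW.up hC hg hρ ha le_rfl, h3⟩),
          (hW.mem_of_interior hC ha (by omega)).2 ⟨le_rfl, hle⟩⟩
        rw [hC.mem_interior_iff hg hσ ha (by omega) (κ := κ)] at h4
        tauto
      · intro hb h
        have hs := hW.sign_b (by omega) hb
        have h3 : Up g κ τ out ρ b := by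
          rw [← hin b (by omega) (by omega)]
          exact (hadm b (by omega) hb).1 hs h
        have h4 := hsub ⟨(hC.mem_interior_iff hg hρ.sel (by omega) hb (κ := κ)).2
          (Or.inl ⟨hs, h3, hW.down hC hg hρ (by omega) hb⟩),
          (hW.mem_of_interior hC (by omega) hb).2 ⟨hle, le_rfl⟩⟩
        rw [hC.mem_interior_iff hg hσ (by omega) hb (κ := κ)] at h4
        tauto
    · have h3 : E ∈ T.matching T.tiles σ := hsub (by
        have := hW.isPerfectMatching_inter hC hg hρ
        rw [hF, isPerfectMatching_singleton] at this
        rw [hF, this]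
        exact rfl)
      rw [← hab]
      exact (hW.single_mem_iff hC hg hσ hE).1 h3
  have hup : ∀ l, 1 ≤ l → l ≤ a → Up g κ τ out σ l := by
    intro l hl₁ hl₂
    induction hl₂ using Nat.decreasingInduction with
    | self => exact hends.1 hl₁
    | of_succ l hl ih => exact (hout l hl₁ (by omega) (Or.inl hl)).1 (ih (by omega))
  have hdown : ∀ l, b + 1 ≤ l → l ≤ n → ¬ Up g κ τ out σ l := by
    intro l hl₁ hl₂
    induction l, hl₁ using Nat.le_induction with
    | base => exact hends.2 hl₂
    | succ l hl ih => rw [hout l (by omega) (by omega) (Or.inr hl)]; exact ih (by omega)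
  rcases Nat.lt_or_ge a k with ha | ha
  · rcases Nat.lt_or_ge b k with hb | hb
    · exact iff_of_false (hdown k hb h₂) (hW.down hC hg hρ hb h₂)
    · exact hin k ha hb
  · exact iff_of_true (hup k h₁ ha) (hW.up hC hg hρ h₁ ha)

theorem matching_eq_of_subset (hW : T.IsWindow n τ out g κ cL cR a b F)
    (hC : T.IsChain n τ inn out) (hg : T.IsSignFunction g) {ρ : ℕ × Side → Prop}
    (hρ : T.Fits n τ out g κ cL cR ρ) (hσ : IsSelection σ) (aσ : T.Admissible T.tiles σ)
    (hsub : T.matching T.tiles ρ ∩ F ⊆ T.matching T.tiles σ)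
    (hbd : T.matching T.tiles σ \ (T.matching T.tiles ρ ∩ F) ⊆ T.boundary) :
    T.matching T.tiles σ = T.matching T.tiles ρ := by
  refine matching_congr fun i hi x => ?_
  rw [hC.tiles_eq] at hi
  obtain ⟨k, ⟨h₁, h₂⟩, rfl⟩ := hi
  exact hC.eq_of_up hg hσ hρ.sel h₁ h₂ (hW.eq_of_subset hC hg hρ hσ aσ hsub hbd h₁ h₂) x

end IsWindow

end TileComplex

/-- Any two sign functions agree on a tile up to a global sign. -/
theorem TileComplex.IsSignFunction.eq_iff {T T' : TileComplex} {f : T.Edge → Bool}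
    {g : T'.Edge → Bool} (hf : T.IsSignFunction f) (hg : T'.IsSignFunction g) {i : ℕ}
    (hi : i ∈ T.tiles) (hi' : i ∈ T'.tiles) (x y : Side) :
    f (T.edge (i, x)) = f (T.edge (i, y)) ↔ g (T'.edge (i, x)) = g (T'.edge (i, y)) := by
  have h := (isSelection_horizontal fun _ => True)
  have h₁ := h.iff_iff hf hi x y
  have h₂ := h.iff_iff hg hi' x y
  rw [h₁] at h₂
  by_cases hl : x.level = y.level <;> simpa [hl, not_iff_not] using h₂

namespace SelfOverlap

variable {G : SnakeGraph} {f : G.Edge → Bool} {O : SelfOverlap G f} {f56 : O.G56'.Edge → Bool}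

theorem glue56_middle (hR : O.Regular) {i : ℕ} (h₁ : O.t < i) (h₂ : i + 1 < O.s') :
    O.G56'.Glue (i, G.outSide i) (i + 1, G.inSide i) :=
  Or.inl ((G56'_glued hR).2 (Or.inl ⟨i, by omega, Or.inr (Or.inl ⟨h₁, h₂⟩), rfl, rfl⟩))

theorem sign56_iff (hR : O.Regular) (hf56 : O.G56'.IsSignFunction f56) {i : ℕ} (h₁ : O.t + 1 ≤ i)
    (h₂ : i < O.s') (x : Side) :
    f56 (O.G56'.edge (i, x)) = f56 (O.G56'.edge (O.t + 1, G.inSide O.t)) ↔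
      f (G.edge i x) = f (G.edge (O.t + 1) (G.inSide O.t)) := by
  obtain ⟨b₁, b₂, b₃, b₄, b₅⟩ := O.bounds
  induction i, h₁ using Nat.le_induction generalizing x with
  | base =>
    exact hf56.eq_iff hR.sign (mem_tiles56.2 (by omega)) ⟨by omega, by omega⟩ _ _
  | succ i hi ih =>
    have h3 := ih (by omega) (G.outSide i)
    have h4 := hf56.eq_iff hR.sign (i := i + 1) (mem_tiles56.2 (by omega))
      ⟨by omega, by omega⟩ x (G.inSide i)
    rw [edge_eq_of_glue (glue56_middle hR (by omega) h₂), ← G.edge_step (by omega) (by omega)] at h3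
    revert h3 h4
    simp only [SnakeGraph.edge]
    generalize f56 _ = u, f56 _ = v, f56 _ = w, f _ = u', f _ = v', f _ = w'
    clear * -
    revert u v w u' v' w'
    decide

/-- The edges `e_{s'-1}` and `e_t` have the same sign also in `G₅₆'` if `s = 1` and `t' = d`. -/
theorem sign56_eq (hR : O.Regular) (hf56 : O.G56'.IsSignFunction f56) :
    f56 (O.G56'.edge (O.s' - 1, G.outSide (O.s' - 1))) =
      f56 (O.G56'.edge (O.t + 1, G.inSide O.t)) := by
  obtain ⟨b₁, b₂, b₃, b₄, b₅⟩ := O.bounds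
  have hlt := hR.lt
  rw [sign56_iff hR hf56 (by omega) (by omega), G.edge_step (by omega) (by omega),
    ← hR.sign_start, sign_startSide (O := O), SnakeGraph.intEdge]

theorem isInt56_iff (hR : O.Regular) {k : ℕ} {e : O.G56'.Edge} : O.IsInt56 k e ↔
    1 ≤ k ∧ k < O.n56 ∧ e = O.G56'.edge (O.tile56 k, O.out56 k) := by
  have hC := isChain56 hR
  refine and_congr_right fun h₁ => and_congr_right fun h₂ => ?_
  constructor
  · rintro ⟨⟨_, rfl, x, rfl⟩, _, rfl, y, he⟩
    rcases hC.isStrip.edge_eq_iff.1 he with h | h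
    · have := hC.inj h₁ h₂.le (by omega) h₂ (Prod.mk.inj h).1
      omega
    · rcases (hC.glue_tile_iff h₁ h₂.le).1 h with ⟨-, rfl, -⟩ | ⟨h3, -, h⟩
      · rfl
      · have := hC.inj (by omega) h₂ (by omega) (by omega) (Prod.mk.inj h).1
        omega
  · rintro rfl
    exact ⟨⟨_, rfl, _, rfl⟩, _, rfl, _, (hC.edge_inn h₁ h₂).symm⟩

theorem mem_intOfSign (hR : O.Regular) {κ : Bool} {k : ℕ} : k ∈ O.intOfSign f56 κ ↔
    1 ≤ k ∧ k < O.n56 ∧ f56 (O.G56'.edge (O.tile56 k, O.out56 k)) = κ := by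
  constructor
  · rintro ⟨e, he, h⟩
    obtain ⟨h₁, h₂, rfl⟩ := (isInt56_iff hR).1 he
    exact ⟨h₁, h₂, h⟩
  · rintro ⟨h₁, h₂, h⟩
    exact ⟨_, (isInt56_iff hR).2 ⟨h₁, h₂, rfl⟩, h⟩

theorem first56_of_lt (h : 1 < O.s) : O.tile56 1 = 1 ∧ (O.out56 1).level = 1 := by
  unfold tile56 out56
  rw [if_pos h]
  refine ⟨rfl, ?_⟩
  split_ifs
  · simp
  · simp

theorem first56_of_eq (hR : O.Regular) (h : O.s = 1) :
    O.tile56 1 = O.s' - 1 ∧ (O.out56 1).level = 0 := by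
  obtain ⟨b₁, b₂, b₃, b₄, b₅⟩ := O.bounds
  have hlt := hR.lt
  unfold tile56 out56
  rw [if_neg (by omega), if_pos (by omega), if_neg (by omega), if_neg (by omega)]
  refine ⟨by omega, ?_⟩
  split_ifs
  · simp
  · simp
  · omega

theorem last56_of_lt (hR : O.Regular) (h : O.t' < G.d) :
    O.tile56 O.n56 = G.d ∧ (O.out56 O.n56).level = 1 := by
  obtain ⟨b₁, b₂, b₃, b₄, b₅⟩ := O.bounds
  have hlt := hR.lt
  unfold tile56 out56 n56
  rw [if_neg (by omega), if_neg (by omega), if_neg (by omega), if_neg (by omega),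
    if_neg (by omega), if_neg (by omega)]
  exact ⟨by omega, by simp⟩

theorem last56_of_eq (hR : O.Regular) (h : O.t' = G.d) :
    O.tile56 O.n56 = O.t + 1 ∧ (O.out56 O.n56).level = 0 := by
  obtain ⟨b₁, b₂, b₃, b₄, b₅⟩ := O.bounds
  have hlt := hR.lt
  unfold tile56 out56 n56
  rw [if_neg (by omega), if_pos (by omega), if_neg (by omega), if_neg (by omega),
    if_neg (by omega), if_pos (by omega)]
  exact ⟨by omega, by simp⟩

theorem one_le_n56 (hR : O.Regular) : 1 ≤ O.n56 := by
  have hlt := hR.lt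
  unfold n56
  omega

variable (O f56) in
/-- The sign that determines `G₅₆`. It is the common value of the signs of `e_{s'-1}` and `e_t` in
`G₅₆'` if these are the same. -/
def κ56 : Bool := f56 (O.G56'.edge (O.t + 1, G.inSide O.t))

variable (O f56) in
/-- The selections on `G₅₆'` that correspond to matchings of `G₅₆`. -/
def Fits56 (σ : ℕ × Side → Prop) : Prop :=
  O.G56'.Fits O.n56 O.tile56 O.out56 f56 (O.κ56 f56) (O.s = 1) (O.t' = G.d) σ

theorem fits56_iff (hR : O.Regular) (hf56 : O.G56'.IsSignFunction f56) {σ : ℕ × Side → Prop} :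
    O.Fits56 f56 σ ↔ IsSelection σ ∧ O.G56'.Admissible O.G56'.tiles σ ∧
      (O.s = 1 → ¬ σ (O.s' - 1, G.outSide (O.s' - 1))) ∧
      (O.t' = G.d → ¬ σ (O.t + 1, G.inSide O.t)) := by
  have hC := isChain56 hR
  have h₁ (hσ : IsSelection σ) (h : O.s = 1) : σ (O.s' - 1, G.outSide (O.s' - 1)) ↔
      ¬ Up f56 (O.κ56 f56) O.tile56 O.out56 σ 1 := by
    obtain ⟨h1, h2⟩ := first56_of_eq hR h
    have := hC.iff_up hf56 hσ le_rfl (one_le_n56 hR) (κ := O.κ56 f56) (G.outSide (O.s' - 1))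
    rw [h1, h2, sign56_eq hR hf56] at this
    simpa [κ56] using this
  have h₂ (hσ : IsSelection σ) (h : O.t' = G.d) : σ (O.t + 1, G.inSide O.t) ↔
      Up f56 (O.κ56 f56) O.tile56 O.out56 σ O.n56 := by
    obtain ⟨h1, h2⟩ := last56_of_eq hR h
    have := hC.iff_up hf56 hσ (one_le_n56 hR) le_rfl (κ := O.κ56 f56) (G.inSide O.t)
    rw [h1, h2] at this
    simpa [κ56] using this
  constructor
  · rintro ⟨hσ, a, u, d⟩
    exact ⟨hσ, a, fun h => by rw [h₁ hσ h, not_not]; exact u h, fun h => by rw [h₂ hσ h]; exact d h⟩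
  · rintro ⟨hσ, a, u, d⟩
    exact ⟨hσ, a, fun h => by have := u h; rwa [h₁ hσ h, not_not] at this,
      fun h => by rw [← h₂ hσ h]; exact d h⟩

theorem exists_side (hg : O.G56'.IsSignFunction f56) (κ : Bool) {i : ℕ} (hi : i ∈ O.G56'.tiles)
    (l : Side) : ∃ z, z.level = l.level ∧ f56 (O.G56'.edge (i, z)) = κ ∧
      ∀ x : Side, x.level = l.level → f56 (O.G56'.edge (i, x)) = κ → x = z := by
  have hr := hg.reflect hi l
  by_cases h : f56 (O.G56'.edge (i, l)) = κ
  · refine ⟨l, rfl, h, fun x hx hx' => ?_⟩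
    rcases Side.eq_or_eq_reflect_of_level hx with rfl | rfl
    · rfl
    · rw [hr, ← h] at hx'
      simp at hx'
  · refine ⟨l.reflect, by simp, by rw [hr]; exact (Bool.eq_not.2 h) ▸ by simp, fun x hx hx' => ?_⟩
    rcases Side.eq_or_eq_reflect_of_level hx with rfl | rfl
    · exact absurd hx' h
    · rfl

end SelfOverlap

namespace SelfOverlap

variable {G : SnakeGraph} {f : G.Edge → Bool} {O : SelfOverlap G f} {f56 : O.G56'.Edge → Bool}

open Classical in
/-- `G₅₆` is a window of the chain `G₅₆'`, or it is zero and there are no selections that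
correspond to it. -/
theorem exists_window (hR : O.Regular) (hf56 : O.G56'.IsSignFunction f56) :
    (∃ F a b, O.G56 f56 = some F ∧ O.G56'.IsWindow O.n56 O.tile56 O.out56 f56 (O.κ56 f56)
      (O.s = 1) (O.t' = G.d) a b F) ∨
    (O.G56 f56 = none ∧ ∀ σ, ¬ O.Fits56 f56 σ) := by
  obtain ⟨b₁, b₂, b₃, b₄, b₅⟩ := O.bounds
  have hC := isChain56 hR
  have hn := one_le_n56 hR
  set K := O.intOfSign f56 (O.κ56 f56) with hKdef
  have hmem : ∀ {k}, k ∈ K ↔ 1 ≤ k ∧ k < O.n56 ∧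
      f56 (O.G56'.edge (O.tile56 k, O.out56 k)) = O.κ56 f56 := fun {k} => mem_intOfSign hR
  have hnot {k : ℕ} (h₁ : 1 ≤ k) (h₂ : k < O.n56) (h : k ∉ K) :
      f56 (O.G56'.edge (O.tile56 k, O.out56 k)) ≠ O.κ56 f56 := fun h' => h (hmem.2 ⟨h₁, h₂, h'⟩)
  have hinf : K.Nonempty → sInf K ∈ K := Nat.sInf_mem
  have hbdd : BddAbove K := ⟨O.n56, fun k hk => (hmem.1 hk).2.1.le⟩
  have hsup : K.Nonempty → sSup K ∈ K := fun h => Nat.sSup_mem h hbdd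
  have hlt_inf {k : ℕ} (h : k < sInf K) : k ∉ K := Nat.notMem_of_lt_sInf h
  have hsup_lt {k : ℕ} (h : sSup K < k) : k ∉ K := fun h' => absurd (le_csSup hbdd h') (not_le.2 h)
  have hG : O.G56 f56 =
    if 1 < O.s ∧ O.t' < G.d then some (O.segment56 0 O.n56)
    else if O.t' < G.d then
      if K.Nonempty then some (O.segment56 (sInf K) O.n56)
      else some {e | ∃ x : Side, x.IsNE ∧ e = O.G56'.edge (G.d, x) ∧ f56 e = O.κ56 f56}
    else if 1 < O.s then
      if K.Nonempty then some (O.segment56 0 (sSup K))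
      else some {e | ∃ x : Side, x.IsSW ∧ e = O.G56'.edge (1, x) ∧ f56 e = O.κ56 f56}
    else
      if K.Nonempty then
        if sInf K < sSup K then some (O.segment56 (sInf K) (sSup K))
        else if sInf K = sSup K then some {e | O.IsInt56 (sInf K) e}
        else none
      else none := by
    unfold G56
    simp only [sign56_eq hR hf56, and_self]
    rfl
  have hNE (x : Side) : x.IsNE ↔ x.level = 1 := by cases x <;> simp [Side.IsNE, Side.level]
  have hSW (x : Side) : x.IsSW ↔ x.level = 0 := by cases x <;> simp [Side.IsSW, Side.level]
  rw [hG]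
  by_cases hs : 1 < O.s
  · have hs' : ¬ O.s = 1 := by omega
    by_cases ht : O.t' < G.d
    · have ht' : ¬ O.t' = G.d := by omega
      rw [if_pos ⟨hs, ht⟩]
      exact Or.inl ⟨_, 0, O.n56, rfl, hn, hn.trans' (Nat.zero_le _), le_rfl, fun _ => rfl,
        fun h => absurd h hs', by omega, fun _ => rfl, fun h => absurd h ht', by omega, by omega,
        by omega, Or.inl ⟨hn, rfl⟩⟩
    · have ht' : O.t' = G.d := by omega
      rw [if_neg (by omega), if_neg ht, if_pos hs]
      split_ifs with hK
      · have h := hmem.1 (hsup hK)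
        exact Or.inl ⟨_, 0, sSup K, rfl, hn, Nat.zero_le _, h.2.1.le, fun _ => rfl,
          fun h => absurd h hs', by omega, fun h => absurd ht' h, fun _ => h.2.1,
          fun k h₁ h₂ => hnot (by omega) h₂ (hsup_lt h₁), by omega, fun _ _ => h.2.2,
          Or.inl ⟨h.1, rfl⟩⟩
      · rw [not_nonempty_iff_eq_empty] at hK
        obtain ⟨h1, h2⟩ := first56_of_lt hs
        have hi := hC.mem_tiles le_rfl hn
        obtain ⟨z, hz, hzs, hu⟩ := exists_side hf56 (O.κ56 f56) hi (O.out56 1).cofoot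
        have hl := Side.level_cofoot_ne (O.out56 1)
        have hl0 : (O.out56 1).cofoot.level = 0 := by
          revert hl h2
          cases (O.out56 1) <;> simp [Side.cofoot, Side.level]
        refine Or.inl ⟨_, 0, 0, rfl, hn, le_rfl, Nat.zero_le _, fun _ => rfl,
          fun h => absurd h hs', by omega, fun h => absurd ht' h, fun _ => hn,
          fun k h₁ h₂ => hnot h₁ h₂ (by simp [hK]), by omega, by omega, Or.inr ⟨rfl, _, ?_,
          Or.inr (Or.inr ⟨rfl, z, by rwa [hz], hzs, rfl⟩)⟩⟩
        ext e
        constructor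
        · rintro ⟨x, hx, rfl, hxs⟩
          rw [hu x (by rw [hl0, ← hSW]; exact hx) (by rw [h1]; exact hxs), mem_singleton_iff, h1]
        · rintro rfl
          exact ⟨z, (hSW z).2 (by rw [hz, hl0]), by rw [h1], hzs⟩
  · have hs' : O.s = 1 := by omega
    by_cases ht : O.t' < G.d
    · have ht' : ¬ O.t' = G.d := by omega
      rw [if_neg (by omega), if_pos ht]
      split_ifs with hK
      · have h := hmem.1 (hinf hK)
        exact Or.inl ⟨_, sInf K, O.n56, rfl, hn, h.2.1.le, le_rfl, fun h => absurd hs' h,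
          fun _ => h.1, fun k h₁ h₂ => hnot h₁ (by omega) (hlt_inf h₂), fun _ => rfl,
          fun h => absurd h ht', by omega, fun _ _ => h.2.2, by omega, Or.inl ⟨h.2.1, rfl⟩⟩
      · rw [not_nonempty_iff_eq_empty] at hK
        obtain ⟨h1, h2⟩ := last56_of_lt hR ht
        have hi := hC.mem_tiles hn le_rfl
        obtain ⟨z, hz, hzs, hu⟩ := exists_side hf56 (O.κ56 f56) hi (O.out56 O.n56)
        refine Or.inl ⟨_, O.n56, O.n56, rfl, hn, le_rfl, le_rfl, fun h => absurd hs' h,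
          fun _ => hn, fun k h₁ h₂ => hnot h₁ h₂ (by simp [hK]), fun _ => rfl,
          fun h => absurd h ht', by omega, by omega, by omega, Or.inr ⟨rfl, _, ?_,
          Or.inr (Or.inl ⟨rfl, z, hz, hzs, rfl⟩)⟩⟩
        ext e
        constructor
        · rintro ⟨x, hx, rfl, hxs⟩
          rw [hu x (by rw [h2, ← hNE]; exact hx) (by rw [h1]; exact hxs), mem_singleton_iff, h1]
        · rintro rfl
          exact ⟨z, (hNE z).2 (by rw [hz, h2]), by rw [h1], hzs⟩
    · have ht' : O.t' = G.d := by omega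
      rw [if_neg (by omega), if_neg ht, if_neg hs]
      by_cases hK : K.Nonempty
      · have h := hmem.1 (hinf hK)
        have h' := hmem.1 (hsup hK)
        have hle : sInf K ≤ sSup K := Nat.sInf_le (hsup hK)
        rw [if_pos hK]
        left
        rcases Nat.eq_or_lt_of_le hle with heq | hlt
        · rw [if_neg (by omega), if_pos heq]
          refine ⟨_, sInf K, sSup K, rfl, hn, hle, h'.2.1.le, fun h => absurd hs' h,
            fun _ => h.1, fun k h₁ h₂ => hnot h₁ (by omega) (hlt_inf h₂), fun h => absurd ht' h,
            fun _ => h'.2.1, fun k h₁ h₂ => hnot (by omega) h₂ (hsup_lt h₁), fun _ _ => h.2.2,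
            fun _ _ => h'.2.2, Or.inr ⟨heq, _, ?_, Or.inl ⟨h.1, h.2.1, rfl⟩⟩⟩
          ext e
          exact (isInt56_iff hR).trans ⟨fun he => he.2.2, fun he => ⟨h.1, h.2.1, he⟩⟩
        · rw [if_pos hlt]
          exact ⟨_, sInf K, sSup K, rfl, hn, hle, h'.2.1.le, fun h => absurd hs' h,
            fun _ => h.1, fun k h₁ h₂ => hnot h₁ (by omega) (hlt_inf h₂), fun h => absurd ht' h,
            fun _ => h'.2.1, fun k h₁ h₂ => hnot (by omega) h₂ (hsup_lt h₁), fun _ _ => h.2.2,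
            fun _ _ => h'.2.2, Or.inl ⟨hlt, rfl⟩⟩
      · rw [if_neg hK]
        rw [not_nonempty_iff_eq_empty] at hK
        refine Or.inr ⟨rfl, fun σ hσ => hσ.down ht' ?_⟩
        -- without an interior edge of sign `κ`, the first coordinate determines the last one
        have hadm := (hC.admissible_iff_up hf56 hσ.sel (κ := O.κ56 f56)).1 hσ.adm
        have key : ∀ k, 1 ≤ k → k ≤ O.n56 → Up f56 (O.κ56 f56) O.tile56 O.out56 σ k := by
          intro k h₁ h₂
          induction k, h₁ using Nat.le_induction with
          | base => exact hσ.up hs'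
          | succ k hk ih =>
            exact (hadm k hk h₂).2 (hnot hk h₂ (by simp [hK])) (ih (by omega))
        exact key _ hn le_rfl

end SelfOverlap

namespace SelfOverlap

variable {G : SnakeGraph} {f : G.Edge → Bool} {O : SelfOverlap G f} {f56 : O.G56'.Edge → Bool}

/-! ### Matchings without a switching position -/

variable (O) in
/-- The edge `e_i` is an interior edge of `G₅₆'`. -/
def IsInner (i : ℕ) : Prop := i + 1 < O.s ∨ (O.t < i ∧ i + 1 < O.s') ∨ (O.t' < i ∧ i < G.d)

/-- The glueings of a tile of `G₅₆'`. -/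
theorem glue56_tile_iff (hR : O.Regular) {i : ℕ} {x : Side} {b : ℕ × Side} :
    O.G56'.Glue (i, x) b ↔
      (1 ≤ i ∧ O.IsInner i ∧ x = G.outSide i ∧ b = (i + 1, G.inSide i)) ∨
      (1 < i ∧ O.IsInner (i - 1) ∧ x = G.inSide (i - 1) ∧ b = (i - 1, G.outSide (i - 1))) ∨
      (1 < O.s ∧ i = O.s - 1 ∧ x = (G.outSide (O.s - 1)).reflect ∧
        b = (O.s' - 1, (G.outSide (O.s' - 1)).reflect)) ∨
      (1 < O.s ∧ i = O.s' - 1 ∧ x = (G.outSide (O.s' - 1)).reflect ∧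
        b = (O.s - 1, (G.outSide (O.s - 1)).reflect)) ∨
      (O.t' < G.d ∧ i = O.t + 1 ∧ x = (G.inSide O.t).reflect ∧
        b = (O.t' + 1, (G.inSide O.t').reflect)) ∨
      (O.t' < G.d ∧ i = O.t' + 1 ∧ x = (G.inSide O.t').reflect ∧
        b = (O.t + 1, (G.inSide O.t).reflect)) := by
  rw [TileComplex.Glue, G56'_glued hR, G56'_glued hR]
  constructor
  · rintro ((⟨i, h₁, h₂, ha, rfl⟩ | ⟨h, ha, rfl⟩ | ⟨h, ha, rfl⟩) |
      (⟨i, h₁, h₂, rfl, ha⟩ | ⟨h, rfl, ha⟩ | ⟨h, rfl, ha⟩)) <;> obtain ⟨rfl, rfl⟩ := Prod.mk.inj ha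
    · exact Or.inl ⟨h₁, h₂, rfl, rfl⟩
    · exact Or.inr (Or.inr (Or.inl ⟨h, rfl, rfl, rfl⟩))
    · exact Or.inr (Or.inr (Or.inr (Or.inr (Or.inl ⟨h, rfl, rfl, rfl⟩))))
    · exact Or.inr (Or.inl ⟨by omega, h₂, by simp, by simp⟩)
    · exact Or.inr (Or.inr (Or.inr (Or.inl ⟨h, rfl, rfl, rfl⟩)))
    · exact Or.inr (Or.inr (Or.inr (Or.inr (Or.inr ⟨h, rfl, rfl, rfl⟩))))
  · rintro (⟨h₁, h₂, rfl, rfl⟩ | ⟨h₁, h₂, rfl, rfl⟩ | ⟨h, rfl, rfl, rfl⟩ | ⟨h, rfl, rfl, rfl⟩ |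
      ⟨h, rfl, rfl, rfl⟩ | ⟨h, rfl, rfl, rfl⟩)
    · exact Or.inl (Or.inl ⟨i, h₁, h₂, rfl, rfl⟩)
    · exact Or.inr (Or.inl ⟨i - 1, by omega, h₂, rfl, by rw [Nat.sub_add_cancel h₁.le]⟩)
    · exact Or.inl (Or.inr (Or.inl ⟨h, rfl, rfl⟩))
    · exact Or.inr (Or.inr (Or.inl ⟨h, rfl, rfl⟩))
    · exact Or.inl (Or.inr (Or.inr ⟨h, rfl, rfl⟩))
    · exact Or.inr (Or.inr (Or.inr ⟨h, rfl, rfl⟩))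

theorem glue56_inner (hR : O.Regular) {i : ℕ} (h₁ : 1 ≤ i) (h₂ : O.IsInner i) :
    O.G56'.Glue (i, G.outSide i) (i + 1, G.inSide i) :=
  (glue56_tile_iff hR).2 (Or.inl ⟨h₁, h₂, rfl, rfl⟩)

theorem IsInner.mem_tiles {i : ℕ} (h₁ : 1 ≤ i) (h : O.IsInner i) :
    i ∈ O.G56'.tiles ∧ i + 1 ∈ O.G56'.tiles := by
  obtain ⟨b₁, b₂, b₃, b₄, b₅⟩ := O.bounds
  rw [mem_tiles56, mem_tiles56]
  unfold IsInner at h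
  omega

/-- In `G₅₆'` the condition that `e_{s-1}` and `e_{s'-1}` are not both selected is a condition on the
glueing edge, or, if `s = 1`, the condition for `G₅₆`. -/
theorem fits56_iff' (hR : O.Regular) (hf56 : O.G56'.IsSignFunction f56) {σ : ℕ × Side → Prop} :
    O.Fits56 f56 σ ↔ IsSelection σ ∧ O.AdmOuter σ ∧ O.AdmMiddle σ ∧ ¬ O.EndL σ σ ∧
      ¬ O.EndR σ σ := by
  obtain ⟨b₁, b₂, b₃, b₄, b₅⟩ := O.bounds
  have hlt := hR.lt
  rw [fits56_iff hR hf56]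
  refine and_congr_right fun hσ => ?_
  constructor
  · rintro ⟨h, hs, ht⟩
    have key : ∀ i, 1 ≤ i → O.IsInner i → σ (i, G.outSide i) ∨ σ (i + 1, G.inSide i) :=
      fun i h₁ h₂ => h _ _ (glue56_inner hR h₁ h₂) (h₂.mem_tiles h₁).1 (h₂.mem_tiles h₁).2
    refine ⟨fun i h₁ h₂ => key i h₁ (by unfold IsInner; omega),
      fun i h₁ h₂ => key i (by omega) (by unfold IsInner; omega), ?_, ?_⟩
    · rintro ⟨h₁, h₂⟩
      by_cases hs' : 1 < O.s
      · have h3 := h _ _ ((glue56_tile_iff hR).2 (Or.inr (Or.inr (Or.inl ⟨hs', rfl, rfl, rfl⟩))))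
          (mem_tiles56.2 (by simp only; omega)) (mem_tiles56.2 (by simp only; omega))
        rw [hσ.reflect, hσ.reflect] at h3
        exact h3.elim (fun h4 => h4 (h₁ hs')) fun h4 => h4 h₂
      · exact hs (by omega) h₂
    · rintro ⟨h₁, h₂⟩
      by_cases ht' : O.t' < G.d
      · have h3 := h _ _ ((glue56_tile_iff hR).2
          (Or.inr (Or.inr (Or.inr (Or.inr (Or.inl ⟨ht', rfl, rfl, rfl⟩))))))
          (mem_tiles56.2 (by simp only; omega)) (mem_tiles56.2 (by simp only; omega))
        rw [hσ.reflect, hσ.reflect] at h3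
        exact h3.elim (fun h4 => h4 h₁) fun h4 => h4 (h₂ ht')
      · exact ht (by omega) h₁
  · rintro ⟨h₁, h₂, h₃, h₄⟩
    refine ⟨?_, fun hs h => h₃ ⟨fun h' => by omega, h⟩, fun ht h => h₄ ⟨h, fun h' => by omega⟩⟩
    have hL : 1 < O.s → σ (O.s - 1, (G.outSide (O.s - 1)).reflect) ∨
        σ (O.s' - 1, (G.outSide (O.s' - 1)).reflect) := by
      intro hs
      rw [hσ.reflect, hσ.reflect]
      by_contra hne
      push Not at hne
      exact h₃ ⟨fun _ => hne.1, hne.2⟩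
    have hE : O.t' < G.d → σ (O.t + 1, (G.inSide O.t).reflect) ∨
        σ (O.t' + 1, (G.inSide O.t').reflect) := by
      intro ht
      rw [hσ.reflect, hσ.reflect]
      by_contra hne
      push Not at hne
      exact h₄ ⟨hne.1, fun _ => hne.2⟩
    have key : ∀ i, 1 ≤ i → O.IsInner i → σ (i, G.outSide i) ∨ σ (i + 1, G.inSide i) := by
      rintro i hi (h | h | h)
      · exact h₁ i hi (Or.inl h)
      · exact h₂ i h.1 h.2
      · exact h₁ i hi (Or.inr h)
    have key' : ∀ x y, O.G56'.glued x y → σ x ∨ σ y := by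
      intro x y hxy
      rcases (G56'_glued hR).1 hxy with ⟨i, hi, hi', rfl, rfl⟩ | ⟨h, rfl, rfl⟩ | ⟨h, rfl, rfl⟩
      · exact key i hi hi'
      · exact hL h
      · exact hE h
    rintro x y (hxy | hxy) - -
    · exact key' x y hxy
    · exact (key' y x hxy).symm

variable (O) in
/-- The selections on the overlap without interior edges which, on the two copies of the overlap,
are opposite to each other, and which allow all edges where the overlap meets other tiles. -/
structure Opposed (σ : ℕ × Side → Prop) : Prop where
  left : ∀ i, O.s ≤ i → i ≤ O.t → ∀ x, σ (i, x) ↔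
    ¬ (f (G.edge i x) = f (G.edge O.s O.startSide) ↔ x.level = 0)
  right : ∀ i, O.s ≤ i → i ≤ O.t → ∀ x, O.shift σ (i, x) ↔
    (f (G.edge i x) = f (G.edge O.s O.startSide) ↔ x.level = 0)

theorem opposed_of_alternating (hR : O.Regular) {σ : ℕ × Side → Prop} (hσ : IsSelection σ)
    (h₁ : ∀ i, O.s ≤ i → i < O.t → (σ (i + 1, G.inSide i) ↔ ¬ σ (i, G.outSide i)))
    (h₂ : ∀ i, O.s ≤ i → i < O.t → (O.shift σ (i + 1, G.inSide i) ↔ ¬ O.shift σ (i, G.outSide i)))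
    (h₃ : ¬ σ (O.s, O.startSide)) (h₄ : O.shift σ (O.s, O.startSide)) : O.Opposed σ := by
  refine ⟨fun i hi hi' x => ?_, fun i hi hi' x => ?_⟩
  · rw [← iff_of_alternating hR hσ h₁ hi hi' x]
    simp [h₃]
  · rw [← iff_of_alternating hR (isSelection_shift hσ) h₂ hi hi' x]
    simp [h₄]

namespace Opposed

variable {σ : ℕ × Side → Prop}

theorem atA (h : O.Opposed σ) (hσ : IsSelection σ) : σ (O.s, O.startSide.reflect) := by
  rw [hσ.reflect, h.left _ le_rfl O.bounds.2.1]
  simp [level_startSide]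

theorem atB (h : O.Opposed σ) : O.shift σ (O.s, O.startSide) := by
  rw [h.right _ le_rfl O.bounds.2.1]
  simp [level_startSide]

theorem atC (hR : O.Regular) (h : O.Opposed σ) : σ (O.t, G.outSide O.t) := by
  rw [h.left _ O.bounds.2.1 le_rfl, hR.sign_start]
  simp

theorem atD (hR : O.Regular) (h : O.Opposed σ) (hσ : IsSelection σ) :
    O.shift σ (O.t, (G.outSide O.t).reflect) := by
  rw [(isSelection_shift hσ).reflect, h.right _ O.bounds.2.1 le_rfl, hR.sign_start]
  simp

theorem step_left (h : O.Opposed σ) {i : ℕ} (h₁ : O.s ≤ i) (h₂ : i < O.t) :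
    σ (i + 1, G.inSide i) ↔ ¬ σ (i, G.outSide i) := by
  rw [h.left _ (by omega) h₂, h.left _ h₁ h₂.le, edge_step h₁ h₂]
  simp

theorem step_right (h : O.Opposed σ) {i : ℕ} (h₁ : O.s ≤ i) (h₂ : i < O.t) :
    O.shift σ (i + 1, G.inSide i) ↔ ¬ O.shift σ (i, G.outSide i) := by
  rw [h.right _ (by omega) h₂, h.right _ h₁ h₂.le, edge_step h₁ h₂]
  simp

theorem not_agree (h : O.Opposed σ) (hL : ¬ O.EndL σ σ) (hE : ¬ O.EndR σ σ) {m : ℕ}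
    (hm : m ≤ O.t - O.s + 2) : ¬ O.Agree m σ (O.shift σ) (O.EndL σ σ) (O.EndR σ σ) := by
  obtain ⟨b₁, b₂, b₃, b₄, b₅⟩ := O.bounds
  rintro ⟨h₁, h₂, h₃⟩
  rcases Nat.eq_zero_or_pos m with h0 | h0
  · exact hL (h₁ h0)
  · by_cases h4 : m = O.t - O.s + 2
    · exact hE (h₃ h4)
    · have h5 := h₂ (O.s + m - 1) (by omega) (by omega) (by omega) O.startSide
      rw [h.left _ (by omega) (by omega), h.right _ (by omega) (by omega)] at h5
      tauto

/-- If there is no switching position, the selection is determined on the overlap. -/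
theorem of_not_agree (hR : O.Regular) (hf56 : O.G56'.IsSignFunction f56) (hσ : IsSelection σ)
    (aσ : G.complex.Admissible G.complex.tiles σ)
    (h : ∀ m ≤ O.t - O.s + 2, ¬ O.Agree m σ (O.shift σ) (O.EndL σ σ) (O.EndR σ σ)) :
    O.Opposed σ ∧ O.Fits56 f56 σ := by
  obtain ⟨b₁, b₂, b₃, b₄, b₅⟩ := O.bounds
  obtain ⟨a₁, a₂, a₃, a₄, a₅, a₆, a₇, a₈⟩ := (admissible1_iff' hR).1 aσ
  have hop : ∀ i, O.s ≤ i → i ≤ O.t → ∀ x, O.shift σ (i, x) ↔ ¬ σ (i, x) := fun i h₁ h₂ x =>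
    opposite_of_not_agree hσ (isSelection_shift hσ) h h₁ h₂ x
  obtain ⟨hL, hE⟩ := not_endL_of_not_agree h
  have h₃ : ¬ σ (O.s, O.startSide) := by
    intro hs
    refine hL ⟨fun h' => (a₅ h').resolve_right ?_, a₆.resolve_right ?_⟩
    · rwa [hσ.reflect, not_not]
    · rwa [hop _ le_rfl b₂, not_not]
  refine ⟨opposed_of_alternating hR hσ (fun i hi₁ hi₂ => ?_) (fun i hi₁ hi₂ => ?_) h₃
    ((hop _ le_rfl b₂ _).2 h₃), (fits56_iff' hR hf56).2 ⟨hσ, a₃, a₄, hL, hE⟩⟩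
  all_goals
    have h4 := a₁ i hi₁ hi₂
    have h5 := a₂ i hi₁ hi₂
    have h6 := hop i hi₁ hi₂.le (G.outSide i)
    have h7 := hop (i + 1) (by omega) hi₂ (G.inSide i)
    clear * - h4 h5 h6 h7
    grind

theorem admissible (hR : O.Regular) (hf56 : O.G56'.IsSignFunction f56) (h : O.Opposed σ)
    (hfit : O.Fits56 f56 σ) : G.complex.Admissible G.complex.tiles σ ∧
      ∀ m ≤ O.t - O.s + 2, ¬ O.Agree m σ (O.shift σ) (O.EndL σ σ) (O.EndR σ σ) := by
  obtain ⟨hσ, a₁, a₂, a₃, a₄⟩ := (fits56_iff' hR hf56).1 hfit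
  refine ⟨(admissible1_iff' hR).2 ⟨fun i h₁ h₂ => ?_, fun i h₁ h₂ => ?_, a₁, a₂,
    fun _ => Or.inr (h.atA hσ), Or.inr h.atB, Or.inl (h.atC hR), fun _ => Or.inl (h.atD hR hσ)⟩,
    fun m hm => h.not_agree a₃ a₄ hm⟩
  · rw [h.step_left h₁ h₂]
    exact em _
  · rw [h.step_right h₁ h₂]
    exact em _

end Opposed

theorem Fits56.congr (hR : O.Regular) (hf56 : O.G56'.IsSignFunction f56)
    {σ ρ : ℕ × Side → Prop} (hσ : IsSelection σ) (hρ : O.Fits56 f56 ρ)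
    (h : ∀ i ∈ O.G56'.tiles, ∀ x, σ (i, x) ↔ ρ (i, x)) : O.Fits56 f56 σ := by
  obtain ⟨b₁, b₂, b₃, b₄, b₅⟩ := O.bounds
  have hlt := hR.lt
  obtain ⟨-, a, c₁, c₂⟩ := (fits56_iff hR hf56).1 hρ
  refine (fits56_iff hR hf56).2 ⟨hσ, fun x y hxy hx hy => ?_, fun hs => ?_, fun ht => ?_⟩
  · have := a x y hxy hx hy
    rwa [← h x.1 hx x.2, ← h y.1 hy y.2] at this
  · rw [h _ (mem_tiles56.2 (by omega))]
    exact c₁ hs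
  · rw [h _ (mem_tiles56.2 (by omega))]
    exact c₂ ht

/-- A selection on `G₅₆'` extends to the overlap in such a way that there is no switching
position. -/
theorem exists_opposed (hR : O.Regular) {ρ : ℕ × Side → Prop} (hρ : IsSelection ρ) :
    ∃ σ, IsSelection σ ∧ O.Opposed σ ∧ ∀ i ∈ O.G56'.tiles, ∀ x, σ (i, x) ↔ ρ (i, x) := by
  obtain ⟨b₁, b₂, b₃, b₄, b₅⟩ := O.bounds
  have hlt := hR.lt
  obtain ⟨p, hp, hp'⟩ := exists_isSelection_eq (fun _ => .south)
    fun i => ¬ f (G.edge i .south) = f (G.edge O.s O.startSide)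
  obtain ⟨q, hq, hq'⟩ := exists_isSelection_eq (fun _ => O.ρ .south)
    fun i => f (G.edge i (O.ρ .south)) = f (G.edge O.s O.startSide)
  have hls : (Side.south).level = 0 := rfl
  refine ⟨_, hp.ite (hq.ite hρ fun i => O.s' ≤ i ∧ i ≤ O.t') (fun i => O.s ≤ i ∧ i ≤ O.t),
    ⟨fun i h₁ h₂ x => ?_, fun i h₁ h₂ x => ?_⟩, fun i hi x => ?_⟩
  · simp only [h₁, h₂, and_self, if_true]
    have h := hp.iff_iff hR.sign (i := i) ⟨by omega, by omega⟩ x .south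
    rw [hls] at h
    have h' := hp' i
    revert h h'
    simp only [SnakeGraph.edge]
    generalize f _ = u, f _ = v, f _ = w, p _ = P, p _ = Q
    clear * -
    cases u <;> cases v <;> cases w <;> by_cases P <;> by_cases Q <;> simp_all
  · simp only [shift]
    rw [if_neg (by omega), if_pos (by omega), ← O.sign_eq i h₁ h₂ x]
    have h := hq.iff_iff hR.sign (i := i + (O.s' - O.s)) ⟨by omega, by omega⟩ (O.ρ x) (O.ρ .south)
    rw [O.level_ρ, O.level_ρ, hls] at h
    have h' := hq' (i + (O.s' - O.s))
    revert h h'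
    simp only [SnakeGraph.edge]
    generalize f _ = u, f _ = v, f _ = w, q _ = P, q _ = Q
    clear * -
    cases u <;> cases v <;> cases w <;> by_cases P <;> by_cases Q <;> simp_all
  · rw [mem_tiles56] at hi
    simp only
    rw [if_neg (by omega), if_neg (by omega)]

end SelfOverlap

theorem TileComplex.IsChain.mem_tiles_of_edge {T : TileComplex} {n : ℕ} {τ : ℕ → ℕ}
    {inn out : ℕ → Side} (hC : T.IsChain n τ inn out) {i : ℕ} {x : Side}
    (h : T.edge (i, x) ∈ T.edgesOf T.tiles) : i ∈ T.tiles := by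
  obtain ⟨j, hj, y, he⟩ := h
  rcases hC.isStrip.edge_eq_iff.1 he with h | h
  · rwa [(Prod.mk.inj h).1]
  · obtain ⟨k, h₁, h₂, rfl⟩ := hC.exists_of_glue h
    exact hC.mem_tiles h₁ h₂

theorem SnakeGraph.outSide_ne_inSide (G : SnakeGraph) (i j : ℕ) : G.outSide i ≠ G.inSide j := by
  intro h
  simpa using congrArg Side.level h

theorem SnakeGraph.outSide_ne_reflect_inSide (G : SnakeGraph) (i j : ℕ) :
    G.outSide i ≠ (G.inSide j).reflect := by
  intro h
  simpa using congrArg Side.level h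

theorem SnakeGraph.inSide_ne_reflect_outSide (G : SnakeGraph) (i j : ℕ) :
    G.inSide i ≠ (G.outSide j).reflect := by
  intro h
  simpa using congrArg Side.level h

theorem SnakeGraph.int_mem_matching (G : SnakeGraph) {σ : ℕ × Side → Prop} {i : ℕ} (h₁ : 1 ≤ i)
    (h₂ : i < G.d) : G.edge i (G.outSide i) ∈ G.complex.matching G.complex.tiles σ ↔
      σ (i, G.outSide i) ∧ σ (i + 1, G.inSide i) := by
  rw [G.mem_matching h₁ h₂.le]
  refine and_congr_right fun _ => ⟨fun h => h.1 h₂ rfl, fun h => ⟨fun _ _ => h, fun _ h' => ?_⟩⟩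
  exact absurd h' (G.outSide_ne_inSide _ _)

namespace SelfOverlap

variable {G : SnakeGraph} {f : G.Edge → Bool} {O : SelfOverlap G f} {f56 : O.G56'.Edge → Bool}

theorem mem_matching56 (hR : O.Regular) {σ : ℕ × Side → Prop} {i : ℕ} (hi : i ∈ O.G56'.tiles)
    (x : Side) : O.G56'.edge (i, x) ∈ O.G56'.matching O.G56'.tiles σ ↔
      σ (i, x) ∧ ∀ b, O.G56'.Glue (i, x) b → σ b := by
  have hC := isChain56 hR
  rw [hC.isStrip.mem_matching hi]
  refine and_congr_right fun _ => forall_congr' fun b => forall_congr' fun hb => ?_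
  obtain ⟨k, h₁, h₂, h⟩ := hC.exists_of_glue hb.symm
  have : b.1 ∈ O.G56'.tiles := h ▸ hC.mem_tiles h₁ h₂
  exact ⟨fun h => h this, fun h _ => h⟩

/-- In `G₅₆'` the edges in which the outer and the middle tiles meet the overlap are not glued. -/
theorem not_glue56_out (hR : O.Regular) {i : ℕ} (hi : i + 1 = O.s ∨ i + 1 = O.s') (b : ℕ × Side) :
    ¬ O.G56'.Glue (i, G.outSide i) b := by
  obtain ⟨b₁, b₂, b₃, b₄, b₅⟩ := O.bounds
  have hlt := hR.lt
  rw [glue56_tile_iff hR]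
  rintro (⟨-, h, -⟩ | ⟨-, -, h, -⟩ | ⟨-, rfl, h, -⟩ | ⟨-, rfl, h, -⟩ | ⟨-, -, h, -⟩ | ⟨-, -, h, -⟩)
  · unfold IsInner at h
    omega
  · exact G.outSide_ne_inSide _ _ h
  · exact Side.reflect_ne _ h.symm
  · exact Side.reflect_ne _ h.symm
  · exact G.outSide_ne_reflect_inSide _ _ h
  · exact G.outSide_ne_reflect_inSide _ _ h

theorem not_glue56_in (hR : O.Regular) {i : ℕ} (hi : i = O.t ∨ i = O.t') (b : ℕ × Side) :
    ¬ O.G56'.Glue (i + 1, G.inSide i) b := by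
  obtain ⟨b₁, b₂, b₃, b₄, b₅⟩ := O.bounds
  have hlt := hR.lt
  rw [glue56_tile_iff hR]
  rintro (⟨-, -, h, -⟩ | ⟨-, h, -⟩ | ⟨-, -, h, -⟩ | ⟨-, -, h, -⟩ | ⟨-, h, h', -⟩ | ⟨-, h, h', -⟩)
  · exact G.outSide_ne_inSide _ _ h.symm
  · unfold IsInner at h
    omega
  · exact G.inSide_ne_reflect_outSide _ _ h
  · exact G.inSide_ne_reflect_outSide _ _ h
  · obtain rfl : i = O.t := by omega
    exact Side.reflect_ne _ h'.symm
  · obtain rfl : i = O.t' := by omega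
    exact Side.reflect_ne _ h'.symm

theorem shift_start_iff (σ : ℕ × Side → Prop) :
    O.shift σ (O.s, O.startSide) ↔ σ (O.s', G.inSide (O.s' - 1)) := by
  have hs' : O.s + (O.s' - O.s) = O.s' := by have := O.bounds; omega
  simp only [shift, hs', ρ_startSide]

theorem shift_finish_iff (hR : O.Regular) (σ : ℕ × Side → Prop) (h : O.t' < G.d) :
    O.shift σ (O.t, (G.outSide O.t).reflect) ↔ σ (O.t', G.outSide O.t') := by
  simp only [shift, ← O.t'_eq, ← hR.finish h, ρ_ρ]

namespace Opposed

variable {σ : ℕ × Side → Prop}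

/-- An edge of `G₅₆'` that belongs to a matching comes from edges in the corresponding matching of
`G`: on the side of the overlap, the edges where it meets other tiles are all selected. -/
theorem edge_mem_matching (hR : O.Regular) (h : O.Opposed σ) (hσ : IsSelection σ) {i : ℕ} {x : Side}
    (hi : i ∈ O.G56'.tiles)
    (he : O.G56'.edge (i, x) ∈ O.G56'.matching O.G56'.tiles σ) :
    G.edge i x ∈ G.complex.matching G.complex.tiles σ := by
  obtain ⟨b₁, b₂, b₃, b₄, b₅⟩ := O.bounds
  have hlt := hR.lt
  rw [mem_matching56 hR hi] at he
  rw [mem_tiles56] at hi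
  refine (G.mem_matching (by omega) (by omega) x).2 ⟨he.1, ?_, ?_⟩
  · rintro hd rfl
    by_cases hin : O.IsInner i
    · exact he.2 _ (glue56_inner hR (by omega) hin)
    · unfold IsInner at hin
      by_cases hs : i < O.s
      · obtain rfl : i = O.s - 1 := by omega
        rw [hR.start (by omega), Nat.sub_add_cancel b₁]
        exact h.atA hσ
      · obtain rfl : i = O.s' - 1 := by omega
        rw [Nat.sub_add_cancel (by omega), ← shift_start_iff σ]
        exact h.atB
  · rintro h1 rfl
    obtain ⟨j, rfl⟩ : ∃ j, i = j + 1 := ⟨i - 1, by omega⟩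
    rw [Nat.add_sub_cancel] at he ⊢
    by_cases hin : O.IsInner j
    · exact he.2 _ (glue56_inner hR (by omega) hin).symm
    · unfold IsInner at hin
      by_cases ht : j = O.t
      · subst ht
        exact h.atC hR
      · obtain rfl : j = O.t' := by omega
        rw [← shift_finish_iff hR σ (by omega)]
        exact h.atD hR hσ

/-- The interior edges of `G` in a matching come from edges of `G₅₆'`. -/
theorem mem_lift56 (hR : O.Regular) (h : O.Opposed σ) {e : G.Edge}
    (he : e ∈ G.complex.matching G.complex.tiles σ) (hint : e ∈ G.complex.interior) :
    e ∈ O.lift56 (O.G56'.matching O.G56'.tiles σ) := by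
  obtain ⟨b₁, b₂, b₃, b₄, b₅⟩ := O.bounds
  have hlt := hR.lt
  obtain ⟨_, _, ⟨i, h₁, h₂, rfl, rfl⟩, rfl⟩ := hint
  have he' := (G.int_mem_matching h₁ h₂).1 he
  by_cases hin : O.IsInner i
  · refine ⟨i, _, (mem_matching56 hR (hin.mem_tiles h₁).1 _).2 ⟨he'.1, fun b hb => ?_⟩, rfl⟩
    rw [(isChain56 hR).isStrip.unique hb (glue56_inner hR h₁ hin)]
    exact he'.2
  · unfold IsInner at hin
    by_cases h3 : i + 1 = O.s ∨ i + 1 = O.s'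
    · exact ⟨i, _, (mem_matching56 hR (mem_tiles56.2 (by omega)) _).2
        ⟨he'.1, fun b hb => absurd hb (not_glue56_out hR h3 b)⟩, rfl⟩
    · by_cases h4 : i = O.t ∨ i = O.t'
      · exact ⟨i + 1, _, (mem_matching56 hR (mem_tiles56.2 (by omega)) _).2
          ⟨he'.2, fun b hb => absurd hb (not_glue56_in hR h4 b)⟩, (G.edge_step h₁ h₂).symm⟩
      · exfalso
        by_cases h5 : i < O.t
        · exact (h.step_left (by omega) h5).1 he'.2 he'.1
        · obtain ⟨j, rfl⟩ : ∃ j, i = j + (O.s' - O.s) := ⟨i - (O.s' - O.s), by omega⟩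
          have h6 := h.step_right (i := j) (by omega) (by omega)
          simp only [shift] at h6
          rw [ρ_outSide (by omega) (by omega), ρ_inSide (by omega) (by omega),
            show j + 1 + (O.s' - O.s) = j + (O.s' - O.s) + 1 by omega] at h6
          exact h6.1 he'.2 he'.1

theorem restrict56_eq (hR : O.Regular) (h : O.Opposed σ) (hσ : IsSelection σ)
    {F : Set O.G56'.Edge} (hF : O.G56 f56 = some F) (hsub : F ⊆ O.G56'.edgesOf O.G56'.tiles) :
    O.restrict56 f56 (G.complex.matching G.complex.tiles σ) =
      O.G56'.matching O.G56'.tiles σ ∩ F := by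
  ext e
  constructor
  · rintro ⟨⟨F', hF', heF⟩, he⟩
    obtain rfl : F = F' := Option.some.inj (hF.symm.trans hF')
    refine ⟨⟨hsub heF, fun i hi x hx => ?_⟩, heF⟩
    have b := O.bounds
    have hi' := mem_tiles56.1 hi
    have hlt := hR.lt
    exact ((G.mem_matching (by omega) (by omega) x).1 (he i x hx)).1
  · rintro ⟨he, heF⟩
    refine ⟨⟨F, hF, heF⟩, ?_⟩
    rintro i x rfl
    exact h.edge_mem_matching hR hσ ((isChain56 hR).mem_tiles_of_edge he.1) he

end Opposed

/-! ### Uniqueness of the completion -/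

/-- At these sides of the tiles of `G₅₆'` all glueings are already present in `G`. -/
theorem glue_of_glue56 (hR : O.Regular) {i : ℕ} {x : Side}
    (h : (x.level = 0 ∧ i ≠ O.t + 1 ∧ i ≠ O.t' + 1) ∨
      (x.level = 1 ∧ i + 1 ≠ O.s ∧ i + 1 ≠ O.s')) {b : ℕ × Side}
    (hb : O.G56'.Glue (i, x) b) : G.complex.Glue (i, x) b := by
  obtain ⟨b₁, b₂, b₃, b₄, b₅⟩ := O.bounds
  have hlt := hR.lt
  rcases (glue56_tile_iff hR).1 hb with ⟨h₁, h₂, rfl, rfl⟩ | ⟨h₁, h₂, rfl, rfl⟩ |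
    ⟨h₁, rfl, rfl, rfl⟩ | ⟨h₁, rfl, rfl, rfl⟩ | ⟨h₁, rfl, rfl, rfl⟩ | ⟨h₁, rfl, rfl, rfl⟩
  · unfold IsInner at h₂
    exact G.glue h₁ (by omega)
  · unfold IsInner at h₂
    have := G.glue (i := i - 1) (by omega) (by omega)
    rw [Nat.sub_add_cancel h₁.le] at this
    exact this.symm
  all_goals
    simp at h
    try omega

section Unique

variable {σ ρ : ℕ × Side → Prop}

/-- Let the edges of `G` that come from the matching of `ρ` belong to the matching of `σ`, and let `ρ`
select a side whose glueing in `G₅₆'` is one of `G`. Either this side is in the matching of `ρ`; or `ρ`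
does not select the side glued to it, but chooses the reflection of that side, and then `σ` does not
select it either and has to select the given side by admissibility. -/
theorem sel_of_lift_subset (hR : O.Regular) (hσ : IsSelection σ)
    (aσ : G.complex.Admissible G.complex.tiles σ) (hρ : IsSelection ρ)
    (hsub : O.lift56 (O.G56'.matching O.G56'.tiles ρ) ⊆ G.complex.matching G.complex.tiles σ)
    {i : ℕ} {x : Side} (hi : i ∈ O.G56'.tiles)
    (hg : ∀ b, O.G56'.Glue (i, x) b → G.complex.Glue (i, x) b) (hx : ρ (i, x)) : σ (i, x) := by
  have hC := isChain56 hR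
  have hd {j : ℕ} (hj : j ∈ O.G56'.tiles) : 1 ≤ j ∧ j ≤ G.d := by
    have hj' := mem_tiles56.1 hj
    have b := O.bounds
    have hlt := hR.lt
    omega
  have key {j : ℕ} {y : Side} (hj : j ∈ O.G56'.tiles)
      (h : O.G56'.edge (j, y) ∈ O.G56'.matching O.G56'.tiles ρ) : σ (j, y) :=
    ((G.mem_matching (hd hj).1 (hd hj).2 y).1 (hsub ⟨j, y, h, rfl⟩)).1
  by_cases he : O.G56'.edge (i, x) ∈ O.G56'.matching O.G56'.tiles ρ
  · exact key hi he
  · rw [mem_matching56 hR hi] at he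
    push Not at he
    obtain ⟨⟨j, y⟩, hb, hj⟩ := he hx
    obtain ⟨k, h₁, h₂, h⟩ := hC.exists_of_glue hb.symm
    have hjt : j ∈ O.G56'.tiles := h ▸ hC.mem_tiles h₁ h₂
    have h3 : σ (j, y.reflect) := by
      refine key hjt ((mem_matching56 hR hjt _).2 ⟨?_, fun c hc => ?_⟩)
      · rwa [hρ.reflect]
      · exact absurd hc (hC.isStrip.reflect hb.symm)
    rw [hσ.reflect] at h3
    exact (aσ _ _ (hg _ hb) (hd hi) (hd hjt)).resolve_right h3

theorem sel_iff_of_lift_subset (hR : O.Regular) (hσ : IsSelection σ)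
    (aσ : G.complex.Admissible G.complex.tiles σ) (hρ : IsSelection ρ)
    (hsub : O.lift56 (O.G56'.matching O.G56'.tiles ρ) ⊆ G.complex.matching G.complex.tiles σ)
    {i : ℕ} (hi : i ∈ O.G56'.tiles) (x : Side) : σ (i, x) ↔ ρ (i, x) := by
  obtain ⟨b₁, b₂, b₃, b₄, b₅⟩ := O.bounds
  have hlt := hR.lt
  have hi' := mem_tiles56.1 hi
  have key (y : Side) (hy : (y.level = 0 ∧ i ≠ O.t + 1 ∧ i ≠ O.t' + 1) ∨
      (y.level = 1 ∧ i + 1 ≠ O.s ∧ i + 1 ≠ O.s')) : σ (i, x) ↔ ρ (i, x) := by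
    refine hσ.congr hρ (x := y) ⟨fun h => ?_, fun h => ?_⟩ x
    · by_contra h'
      rw [← hρ.reflect] at h'
      have := sel_of_lift_subset hR hσ aσ hρ hsub hi
        (fun b hb => glue_of_glue56 hR (by simpa using hy) hb) h'
      rw [hσ.reflect] at this
      exact this h
    · exact sel_of_lift_subset hR hσ aσ hρ hsub hi (fun b hb => glue_of_glue56 hR hy hb) h
  by_cases h1 : i ≠ O.t + 1 ∧ i ≠ O.t' + 1
  · exact key .south (Or.inl ⟨rfl, h1⟩)
  · by_cases h2 : i + 1 ≠ O.s ∧ i + 1 ≠ O.s'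
    · exact key .north (Or.inr ⟨rfl, h2⟩)
    · -- if there is only one middle tile, its edges `e_t` and `e_{s'-1}` have the same sign, so that
      -- exactly one of them is selected
      obtain rfl : i = O.t + 1 := by omega
      have hsign : f (G.edge (O.t + 1) (G.outSide (O.t + 1))) =
          f (G.edge (O.t + 1) (G.inSide O.t)) := by
        rw [G.edge_step (by omega) (by omega), ← hR.sign_start, sign_startSide (O := O),
          SnakeGraph.intEdge, show O.s' - 1 = O.t + 1 by omega]
      have hone {p : ℕ × Side → Prop} (hp : IsSelection p) :
          p (O.t + 1, G.outSide (O.t + 1)) ↔ ¬ p (O.t + 1, G.inSide O.t) := by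
        have := hp.iff_iff hR.sign (i := O.t + 1) ⟨by omega, by omega⟩ (G.outSide (O.t + 1))
          (G.inSide O.t)
        simp only [SnakeGraph.edge] at hsign
        rw [hsign] at this
        simp only [SnakeGraph.level_outSide, SnakeGraph.level_inSide, one_ne_zero, iff_false,
          not_true_eq_false] at this
        clear * - this
        grind
      refine hσ.congr hρ (x := G.inSide O.t) ⟨fun h => ?_, fun h => ?_⟩ x
      · by_contra h'
        have := sel_of_lift_subset hR hσ aσ hρ hsub hi
          (fun b hb => absurd hb (not_glue56_out hR (by omega) b)) ((hone hρ).2 h')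
        exact (hone hσ).1 this h
      · exact sel_of_lift_subset hR hσ aσ hρ hsub hi
          (fun b hb => absurd hb (not_glue56_in hR (Or.inl rfl) b)) h

/-- If a matching of `G` contains the edges of a matching of `G₅₆'` and otherwise only boundary
edges, it is determined on the overlap. -/
theorem opposed_of_lift_subset (hR : O.Regular) (hσ : IsSelection σ)
    (aσ : G.complex.Admissible G.complex.tiles σ)
    (hsub : O.lift56 (O.G56'.matching O.G56'.tiles ρ) ⊆ G.complex.matching G.complex.tiles σ)
    (hbd : G.complex.matching G.complex.tiles σ \ O.lift56 (O.G56'.matching O.G56'.tiles ρ) ⊆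
      G.complex.boundary) (heq : ∀ i ∈ O.G56'.tiles, ∀ x, σ (i, x) ↔ ρ (i, x)) : O.Opposed σ := by
  obtain ⟨b₁, b₂, b₃, b₄, b₅⟩ := O.bounds
  have hlt := hR.lt
  have hC := isChain56 hR
  have aσ' := G.admissible_iff.1 aσ
  have halt : ∀ i, (O.s ≤ i ∧ i < O.t) ∨ (O.s' ≤ i ∧ i < O.t') →
      (σ (i + 1, G.inSide i) ↔ ¬ σ (i, G.outSide i)) := by
    intro i hi
    have h₁ := aσ' i (by omega) (by omega)
    refine ⟨fun h h' => ?_, fun h => h₁.resolve_left h⟩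
    have he := (G.int_mem_matching (by omega) (by omega)).2 ⟨h', h⟩
    by_cases hl : G.edge i (G.outSide i) ∈ O.lift56 (O.G56'.matching O.G56'.tiles ρ)
    · obtain ⟨j, y, hj, he'⟩ := hl
      have hj' := mem_tiles56.1 (hC.mem_tiles_of_edge hj.1)
      rcases (G.edge_eq_iff (by omega) (by omega)).1 he' with h3 | h3 | h3
      · omega
      · omega
      · exact G.outSide_ne_inSide _ _ h3.2.1
    · exact (hbd ⟨he, hl⟩).2 ⟨_, _, ⟨i, by omega, by omega, rfl, rfl⟩, rfl⟩
  have hleft : ∀ i, O.s ≤ i → i < O.t → (σ (i + 1, G.inSide i) ↔ ¬ σ (i, G.outSide i)) :=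
    fun i h₁ h₂ => halt i (Or.inl ⟨h₁, h₂⟩)
  refine opposed_of_alternating hR hσ hleft (fun i h₁ h₂ => ?_) ?_ ?_
  · simp only [shift]
    rw [ρ_outSide h₁ h₂, ρ_inSide h₁ h₂,
      show i + 1 + (O.s' - O.s) = i + (O.s' - O.s) + 1 by omega]
    exact halt _ (Or.inr ⟨by omega, by omega⟩)
  · rw [← start_iff_finish hR hσ hleft]
    have ht : O.t + 1 ∈ O.G56'.tiles := mem_tiles56.2 (by omega)
    by_cases h : ρ (O.t + 1, G.inSide O.t)
    · have he := (mem_matching56 hR ht _).2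
        ⟨h, fun b hb => absurd hb (not_glue56_in hR (Or.inl rfl) b)⟩
      have := (G.mem_matching (by omega) (by omega) _).1 (hsub ⟨_, _, he, rfl⟩)
      exact this.2.2 (by omega) rfl
    · exact (aσ' O.t (by omega) (by omega)).resolve_right (mt (heq _ ht _).1 h)
  · rw [shift_start_iff]
    have hs : O.s' - 1 ∈ O.G56'.tiles := mem_tiles56.2 (by omega)
    have hs' : O.s' - 1 + 1 = O.s' := by omega
    by_cases h : ρ (O.s' - 1, G.outSide (O.s' - 1))
    · have he := (mem_matching56 hR hs _).2
        ⟨h, fun b hb => absurd hb (not_glue56_out hR (Or.inr hs') b)⟩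
      have := (G.mem_matching (by omega) (by omega) _).1 (hsub ⟨_, _, he, rfl⟩)
      have h3 := this.2.1 (by omega) rfl
      rwa [hs'] at h3
    · have h3 := aσ' (O.s' - 1) (by omega) (by omega)
      rw [hs'] at h3
      exact h3.resolve_left (mt (heq _ hs _).1 h)

/-- A matching without a switching position is determined by its restriction to `G₅₆'`. -/
theorem Opposed.matching_eq (hR : O.Regular) (hσ : O.Opposed σ) (hρ : O.Opposed ρ)
    (h : ∀ i ∈ O.G56'.tiles, ∀ x, σ (i, x) ↔ ρ (i, x)) :
    G.complex.matching G.complex.tiles σ = G.complex.matching G.complex.tiles ρ := by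
  obtain ⟨b₁, b₂, b₃, b₄, b₅⟩ := O.bounds
  have hlt := hR.lt
  refine matching_congr fun i hi x => ?_
  obtain ⟨h₁, h₂⟩ : 1 ≤ i ∧ i ≤ G.d := hi
  by_cases h3 : i ∈ O.G56'.tiles
  · exact h i h3 x
  · rw [mem_tiles56] at h3
    by_cases h4 : i ≤ O.t
    · rw [hσ.left i (by omega) h4, hρ.left i (by omega) h4]
    · have h5 := hσ.right (i - (O.s' - O.s)) (by omega) (by omega) (O.ρ x)
      rw [← hρ.right (i - (O.s' - O.s)) (by omega) (by omega) (O.ρ x)] at h5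
      simp only [shift, ρ_ρ] at h5
      rwa [Nat.sub_add_cancel (by omega)] at h5

end Unique

/-! ### The matchings of `G₅₆` -/

/-- The part in `G₅₆` of a fitting selection has exactly one completion: its edges in `G₅₆'` outside of
`G₅₆` are forced by the window, and on the overlap the selection is forced because only boundary
edges may be added. -/
theorem isCompletion_iff (hR : O.Regular) (hf56 : O.G56'.IsSignFunction f56)
    {F : Set O.G56'.Edge} {a b : ℕ}
    (hW : O.G56'.IsWindow O.n56 O.tile56 O.out56 f56 (O.κ56 f56) (O.s = 1) (O.t' = G.d) a b F)
    {σ : ℕ × Side → Prop} (hσ : IsSelection σ) (hop : O.Opposed σ) (hfit : O.Fits56 f56 σ)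
    {P : Set G.Edge} : O.IsCompletion (O.G56'.matching O.G56'.tiles σ ∩ F) P ↔
      P = G.complex.matching G.complex.tiles σ := by
  have hC := isChain56 hR
  constructor
  · rintro ⟨P', hP', hsub', hbd', hP, hsub, hbd⟩
    obtain ⟨τ, hτ, aτ, rfl⟩ := hC.isPerfectMatching_iff.1 hP'
    rw [hW.matching_eq_of_subset hC hf56 hfit hτ aτ hsub' hbd'] at hsub hbd
    obtain ⟨τ, hτ, aτ, rfl⟩ := G.isChain.isPerfectMatching_iff.1 hP
    have heq : ∀ i ∈ O.G56'.tiles, ∀ x, τ (i, x) ↔ σ (i, x) := fun i hi x =>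
      sel_iff_of_lift_subset hR hτ aτ hσ hsub hi x
    exact (opposed_of_lift_subset hR hτ aτ hsub hbd heq).matching_eq hR hop heq
  · rintro rfl
    refine ⟨_, hC.isPerfectMatching_iff.2 ⟨σ, hσ, hfit.adm, rfl⟩, inter_subset_left, ?_,
      G.isChain.isPerfectMatching_iff.2 ⟨σ, hσ, (hop.admissible hR hf56 hfit).1, rfl⟩, ?_, ?_⟩
    · rw [sdiff_self_inter]
      exact hW.diff_subset_boundary hC hf56 hfit
    · rintro _ ⟨i, x, he, rfl⟩
      exact hop.edge_mem_matching hR hσ (hC.mem_tiles_of_edge he.1) he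
    · rintro e ⟨he, hl⟩
      exact ⟨he.1, fun hi => hl (hop.mem_lift56 hR he hi)⟩

/-- The matching `P1` of `G` has no switching position, its restriction to `G₅₆` is the matching
`P56`, and it is the only completion of `P56`. -/
structure Unswitchable (O : SelfOverlap G f) (f56 : O.G56'.Edge → Bool) (P1 : Set G.Edge)
    (P56 : Set O.G56'.Edge) : Prop where
  mem_matchG1 : P1 ∈ O.matchG1
  mem_matchG56 : P56 ∈ O.matchG56 f56
  not_switching : ¬ ∃ m, O.IsSwitchingPosition P1 m
  restrict56_eq : O.restrict56 f56 P1 = P56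
  isCompletion_iff : ∀ P, O.IsCompletion P56 P ↔ P = P1

theorem Opposed.unswitchable (hR : O.Regular) (hf56 : O.G56'.IsSignFunction f56)
    {F : Set O.G56'.Edge} {a b : ℕ} (hF : O.G56 f56 = some F)
    (hW : O.G56'.IsWindow O.n56 O.tile56 O.out56 f56 (O.κ56 f56) (O.s = 1) (O.t' = G.d) a b F)
    {σ : ℕ × Side → Prop} (hσ : IsSelection σ) (hop : O.Opposed σ) (hfit : O.Fits56 f56 σ) :
    O.Unswitchable f56 (G.complex.matching G.complex.tiles σ)
      (O.G56'.matching O.G56'.tiles σ ∩ F) := by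
  have hC := isChain56 hR
  obtain ⟨aσ, hno⟩ := hop.admissible hR hf56 hfit
  refine ⟨G.isChain.isPerfectMatching_iff.2 ⟨σ, hσ, aσ, rfl⟩,
    ⟨F, hF, hW.isPerfectMatching_inter hC hf56 hfit⟩, ?_,
    hop.restrict56_eq hR hσ hF (hW.subset_edgesOf hC),
    fun P => SelfOverlap.isCompletion_iff hR hf56 hW hσ hop hfit⟩
  rintro ⟨m, hm⟩
  rw [isSwitchingPosition_iff hR hσ aσ] at hm
  exact hno m hm.1 hm.2

theorem exists_unswitchable_of_matchG1 (hR : O.Regular) (hf56 : O.G56'.IsSignFunction f56)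
    {P1 : Set G.Edge} (h1 : P1 ∈ O.matchG1) (h : ¬ ∃ m, O.IsSwitchingPosition P1 m) :
    ∃ P56, O.Unswitchable f56 P1 P56 := by
  obtain ⟨σ, hσ, aσ, rfl⟩ := G.isChain.isPerfectMatching_iff.1 h1
  obtain ⟨hop, hfit⟩ := Opposed.of_not_agree hR hf56 hσ aσ fun m hm ha =>
    h ⟨m, (isSwitchingPosition_iff hR hσ aσ).2 ⟨hm, ha⟩⟩
  rcases exists_window hR hf56 with ⟨F, a, b, hF, hW⟩ | ⟨-, hno⟩
  · exact ⟨_, hop.unswitchable hR hf56 hF hW hσ hfit⟩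
  · exact absurd hfit (hno σ)

theorem exists_unswitchable_of_matchG56 (hR : O.Regular) (hf56 : O.G56'.IsSignFunction f56)
    {P56 : Set O.G56'.Edge} (h : P56 ∈ O.matchG56 f56) : ∃ P1, O.Unswitchable f56 P1 P56 := by
  obtain ⟨F', hF', hP⟩ := h
  rcases exists_window hR hf56 with ⟨F, a, b, hF, hW⟩ | ⟨hF, -⟩
  · obtain rfl : F = F' := Option.some.inj (hF.symm.trans hF')
    obtain ⟨ρ, hρ, rfl⟩ := hW.exists_fits (isChain56 hR) hf56 hP
    obtain ⟨σ, hσ, hop, heq⟩ := exists_opposed hR hρ.sel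
    rw [← matching_congr heq]
    exact ⟨_, hop.unswitchable hR hf56 hF hW hσ (Fits56.congr hR hf56 hσ hρ heq)⟩
  · exact absurd (hF.symm.trans hF') (by simp)

namespace Unswitchable

variable {P1 : Set G.Edge} {P56 : Set O.G56'.Edge}

theorem φ_eq (h : O.Unswitchable f56 P1 P56) : O.φ f56 P1 = Sum.inr P56 := by
  rw [φ, dif_neg h.not_switching, h.restrict56_eq]

theorem ψ_eq (h : O.Unswitchable f56 P1 P56) : O.ψ (Sum.inr P56) = P1 := by
  have hex : ∃ P, O.IsCompletion P56 P := ⟨P1, (h.isCompletion_iff _).2 rfl⟩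
  rw [ψ, dif_pos hex]
  exact (h.isCompletion_iff _).1 hex.choose_spec

end Unswitchable

end SelfOverlap

end SnakeCalculus

open SnakeCalculus SnakeCalculus.SelfOverlap in
theorem mainTheorem1 (G : SnakeCalculus.SnakeGraph) (f : G.Edge → Bool)
    (hf : G.complex.IsSignFunction f) (O : SnakeCalculus.SelfOverlap G f)
    (hcross : O.IsCrossing) (hst : O.t + 1 < O.s')
    (f56 : O.G56'.Edge → Bool) (hf56 : O.G56'.IsSignFunction f56) :
    (∀ P56 ∈ O.matchG56 f56, ∃! P1, O.IsCompletion P56 P1) ∧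
      Set.BijOn (O.φ f56) O.matchG1 (O.matchRes f56) ∧
      Set.MapsTo O.ψ (O.matchRes f56) O.matchG1 ∧
      Set.InvOn O.ψ (O.φ f56) O.matchG1 (O.matchRes f56) := by
  have hR := regular hf hcross hst
  have hφ : ∀ P ∈ O.matchG1, O.φ f56 P ∈ O.matchRes f56 ∧ O.ψ (O.φ f56 P) = P := by
    intro P hP
    by_cases h : ∃ m, O.IsSwitchingPosition P m
    · obtain ⟨h₁, h₂⟩ := ψ_φ_of_switch hR f56 hP h
      exact ⟨Or.inl h₁, h₂⟩
    · obtain ⟨P56, hu⟩ := exists_unswitchable_of_matchG1 hR hf56 hP h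
      rw [hu.φ_eq]
      exact ⟨Or.inr ⟨P56, hu.mem_matchG56, rfl⟩, hu.ψ_eq⟩
  have hψ : ∀ P ∈ O.matchRes f56, O.ψ P ∈ O.matchG1 ∧ O.φ f56 (O.ψ P) = P := by
    rintro _ (⟨⟨P3, P4⟩, ⟨h3, h4⟩, rfl⟩ | ⟨P56, h, rfl⟩)
    · exact φ_ψ_inl hR f56 h3 h4
    · obtain ⟨P1, hu⟩ := exists_unswitchable_of_matchG56 hR hf56 h
      rw [hu.ψ_eq]
      exact ⟨hu.mem_matchG1, hu.φ_eq⟩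
  have hinv : Set.InvOn O.ψ (O.φ f56) O.matchG1 (O.matchRes f56) :=
    ⟨fun P hP => (hφ P hP).2, fun P hP => (hψ P hP).2⟩
  have hmaps : Set.MapsTo O.ψ (O.matchRes f56) O.matchG1 := fun P hP => (hψ P hP).1
  refine ⟨fun P56 h => ?_, hinv.bijOn (fun P hP => (hφ P hP).1) hmaps, hmaps, hinv⟩
  obtain ⟨P1, hu⟩ := exists_unswitchable_of_matchG56 hR hf56 h
  exact ⟨P1, (hu.isCompletion_iff P1).2 rfl, fun P hP => (hu.isCompletion_iff P).1 hP⟩
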